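/- Let $K, L \subsetneqq \mathbb{R}^2$ be closed convex sets with non-empty interior. By a circle we mean a closed disc of positive radius, by a (parallel) strip the closed set between two distinct parallel lines, and by a half-plane a closed half-plane; a symmetry of a set is a congruence (isometry) of the plane mapping the set onto itself, and it is non-trivial if it is not the identity. (a) The following are equivalent: (1) for all orientation preserving congruences $\varphi, \psi : \mathbb{R}^2 \to \mathbb{R}^2$ with $\operatorname{int}\big((\varphi K) \cap (\psi L)\big) \neq \emptyset$, the set $(\varphi K) \cap (\psi L)$ has some non-trivial symmetry; (2) $K$ and $L$ are two circles, or one of them is a circle and the other one is a strip or a half-plane, or they are two strips, or they are two half-planes. (b) For all orientation preserving congruences $\varphi, \psi$ with $\operatorname{int}\big((\varphi K) \cap (\psi L)\big) \neq \emptyset$ the set $(\varphi K) \cap (\psi L)$ is centrally symmetric (symmetric with respect to some point) if and only if $K$ and $L$ are two congruent circles or two strips. (c) For all orientation preserving congruences $\varphi, \psi$ with $\operatorname{int}\big((\varphi K) \cap (\psi L)\big) \neq \emptyset$ the set $(\varphi K) \cap (\psi L)$ is axially symmetric (symmetric with respect to some line) if and only if $K$ and $L$ are two circles, or one of them is a circle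 and the other one is a strip or a half-plane, or they are two congruent strips, or they are two half-planes. -/

import Mathlib

/-- The Euclidean plane. -/
abbrev Plane : Type := EuclideanSpace ℝ (Fin 2)

/-- Congruences of the plane (a surjective isometry is automatically affine). -/
abbrev PlaneCongruence : Type := Plane ≃ᵃⁱ[ℝ] Plane

/-- A congruence preserves orientation when its linear part has positive determinant. -/
def OrientationPreserving (φ : PlaneCongruence) : Prop :=
  0 < LinearMap.det (φ.linearIsometryEquiv.toLinearEquiv : Plane →ₗ[ℝ] Plane)

/-- Two sets are congruent when some congruence (of either orientation) carries one onto
the other. -/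
def CongruentSets (S T : Set Plane) : Prop :=
  ∃ φ : PlaneCongruence, φ '' S = T

/-- `S` has a symmetry different from the identity. -/
def HasNontrivialSymmetry (S : Set Plane) : Prop :=
  ∃ σ : PlaneCongruence, σ ≠ AffineIsometryEquiv.refl ℝ Plane ∧ σ '' S = S

/-- `S` is symmetric with respect to some point. -/
def IsCentrallySymmetric (S : Set Plane) : Prop :=
  ∃ c : Plane, AffineIsometryEquiv.pointReflection ℝ c '' S = S

/-- `S` is symmetric with respect to some straight line. -/
def IsAxiallySymmetric (S : Set Plane) : Prop :=
  ∃ p q : Plane, p ≠ q ∧ EuclideanGeometry.reflection (line[ℝ, p, q]) '' S = S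

/-- A circle, understood as a convex body: a closed disc of positive radius. -/
def IsCircle (S : Set Plane) : Prop :=
  ∃ (c : Plane) (r : ℝ), 0 < r ∧ S = Metric.closedBall c r

/-- A closed parallel strip, bounded by two distinct parallel lines. -/
def IsStrip (S : Set Plane) : Prop :=
  ∃ (v : Plane) (a b : ℝ), v ≠ 0 ∧ a < b ∧ S = {x | a ≤ inner ℝ v x ∧ inner ℝ v x ≤ b}

/-- A closed half-plane. -/
def IsHalfPlane (S : Set Plane) : Prop :=
  ∃ (v : Plane) (b : ℝ), v ≠ 0 ∧ S = {x | inner ℝ v x ≤ b}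

/-- All intersections of orientation preserving congruent copies of `K` and `L` that have
an interior point satisfy `P`. -/
def AllIntersectionsSatisfy (P : Set Plane → Prop) (K L : Set Plane) : Prop :=
  ∀ φ ψ : PlaneCongruence, OrientationPreserving φ → OrientationPreserving ψ →
    (interior ((φ '' K) ∩ (ψ '' L))).Nonempty → P ((φ '' K) ∩ (ψ '' L))

/-!
Discs, strips and half-planes are singled out as follows. The plane is identified with `ℂ`, so that
the copies of `K` under orientation preserving congruences are the sets `placed a b K`. Suppose that
all intersections of copies of `K` and `L` having interior points have a non-trivial symmetry. It is
shown that the boundary of `K` is a circle, a line, or a pair of parallel lines.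

*Smoothness.* Since convex functions are differentiable somewhere, a copy of `L` looks like a
half-plane near some boundary point. If `K` had a corner, then a suitable intersection near this
corner, blown up, would be arbitrarily close to a scalene triangle. By compactness of the group of
rotations this triangle would have a non-trivial symmetry as well (`false_of_exhaustion`,
`false_of_corner`). So the boundary is locally the graph of a `C¹` function (`exists_smoothChart`).

*Caps.* A short chord of `K` and a chord of `L` of the same length can be put on top of each other,
so that the two caps form a lens. The chord is the only diameter of the lens, and its symmetries
preserve it. Hence the two caps are congruent, or each of them is symmetric (`lens_trichotomy`).
Comparison with a common cap of `L` relates any two caps of `K` over short chords of equal length in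
the same way (`CapDichotomy`).

*Angles.* If a chord makes different angles with the tangents at its ends, then so do, by
continuity, all chords of this length `d` starting on its arc, with the same difference of the
tangents of the angles, and the cap over the next chord is a copy of the first one by a motion.
Along the arc, this motion sends a point `F σ` to a point `G σ` of the boundary, at distance `d` for
both ends of the arc. But the angles show that the distance of `F σ` and `G σ` is strictly monotone
at each parameter where it equals `d`, always in the same sense, which is impossible
(`false_of_adjacent_caps`). So short chords make equal angles with the tangents at both ends.

*Roundness.* For the chords from a fixed point this is a differential equation whose solutions are
arcs of circles and segments (`exists_curvature`). So `K` is locally a disc or a half-plane, and a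
clopen argument along the circle or line makes this global (`eq_disc_or_strip_or_half`).

It remains to inspect the pairs of discs, strips and half-planes. For the pairs to be excluded an
explicit intersection is considered; for the others the centre or the axis of symmetry is given.
-/

open Set Filter Topology
open scoped ComplexConjugate

namespace PlanarConvex

/-! ### Rigid motions of the complex plane -/

/-- The preimage of `K` under the affine map `z ↦ a * z + b`. For `‖a‖ = 1` this map is an
orientation preserving rigid motion, and the sets `placed a b K` are the copies of `K` under
such motions. -/
def placed (a b : ℂ) (K : Set ℂ) : Set ℂ := {z | a * z + b ∈ K}

/-- `S` is invariant under some isometry of `ℂ` other than the identity; the isometries are the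
maps `z ↦ a * z + b` and `z ↦ a * conj z + b` with `‖a‖ = 1`. -/
def HasIsometricSymmetry (S : Set ℂ) : Prop :=
  (∃ a b : ℂ, ‖a‖ = 1 ∧ (a ≠ 1 ∨ b ≠ 0) ∧ ∀ z, a * z + b ∈ S ↔ z ∈ S) ∨
    ∃ a b : ℂ, ‖a‖ = 1 ∧ ∀ z, a * conj z + b ∈ S ↔ z ∈ S

/-- Every intersection with interior points of a directly congruent copy of `K` with one of `L`
has the property `P`. -/
def AllPlacements (P : Set ℂ → Prop) (K L : Set ℂ) : Prop :=
  ∀ a b a' b' : ℂ, ‖a‖ = 1 → ‖a'‖ = 1 → (interior (placed a b K ∩ placed a' b' L)).Nonempty →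
    P (placed a b K ∩ placed a' b' L)

lemma mem_placed {a b z : ℂ} {K : Set ℂ} : z ∈ placed a b K ↔ a * z + b ∈ K := Iff.rfl

lemma placed_one_zero (K : Set ℂ) : placed 1 0 K = K := by ext; simp [mem_placed]

lemma placed_placed (a b a' b' : ℂ) (K : Set ℂ) :
    placed a b (placed a' b' K) = placed (a' * a) (a' * b + b') K := by
  ext z; simp only [mem_placed]; ring_nf

lemma AllPlacements.symm {P : Set ℂ → Prop} {K L : Set ℂ} (H : AllPlacements P K L) :
    AllPlacements P L K := by
  intro a b a' b' ha ha' hi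
  rw [inter_comm] at hi ⊢
  exact H a' b' a b ha' ha hi

lemma AllPlacements.mono {P Q : Set ℂ → Prop} (hPQ : ∀ S, P S → Q S) {K L : Set ℂ}
    (H : AllPlacements P K L) : AllPlacements Q K L :=
  fun a b a' b' ha ha' hi => hPQ _ (H a b a' b' ha ha' hi)

lemma AllPlacements.placed {P : Set ℂ → Prop} {K L : Set ℂ} (H : AllPlacements P K L)
    {a b a' b' : ℂ} (ha : ‖a‖ = 1) (ha' : ‖a'‖ = 1) :
    AllPlacements P (placed a b K) (placed a' b' L) := by
  intro c d c' d' hc hc' hi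
  rw [placed_placed, placed_placed] at hi ⊢
  exact H _ _ _ _ (by simp [ha, hc]) (by simp [ha', hc']) hi

lemma AllPlacements.placed_left {P : Set ℂ → Prop} {K L : Set ℂ} (H : AllPlacements P K L)
    {a b : ℂ} (ha : ‖a‖ = 1) : AllPlacements P (PlanarConvex.placed a b K) L := by
  have := H.placed (a := a) (b := b) (a' := 1) (b' := 0) ha (by simp)
  rwa [placed_one_zero] at this

lemma isClosed_placed {a b : ℂ} {K : Set ℂ} (hK : IsClosed K) : IsClosed (placed a b K) :=
  hK.preimage (f := fun z => a * z + b) (by fun_prop)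

lemma convex_placed {a b : ℂ} {K : Set ℂ} (hK : Convex ℝ K) : Convex ℝ (placed a b K) := by
  intro x hx y hy s t hs ht hst
  have := hK hx hy hs ht hst
  rw [mem_placed]
  convert this using 1
  simp only [Complex.real_smul]
  have : (s : ℂ) + t = 1 := by exact_mod_cast hst
  linear_combination (-b) * this

lemma ne_zero_of_norm_eq_one {a : ℂ} (ha : ‖a‖ = 1) : a ≠ 0 := by
  rintro rfl; simp at ha

lemma mul_conj_of_norm_eq_one {a : ℂ} (ha : ‖a‖ = 1) : a * conj a = 1 := by
  rw [Complex.mul_conj, Complex.normSq_eq_norm_sq, ha]; simp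

lemma conj_mul_of_norm_eq_one {a : ℂ} (ha : ‖a‖ = 1) : conj a * a = 1 := by
  rw [mul_comm, mul_conj_of_norm_eq_one ha]

lemma interior_placed {a b : ℂ} (ha : ‖a‖ = 1) (K : Set ℂ) :
    interior (placed a b K) = placed a b (interior K) :=
  (((Homeomorph.mulLeft₀ a (ne_zero_of_norm_eq_one ha)).trans
    (Homeomorph.addRight b)).preimage_interior K).symm

/-! ### The boundary as the graph of a convex function -/

/-- Inside the region `|re z| < r`, `im z ≤ h`, the set `K` is the epigraph of the convex
function `f`. -/
structure GraphChart (K : Set ℂ) (r h : ℝ) (f : ℝ → ℝ) : Prop where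
  pos : 0 < r
  convexOn : ConvexOn ℝ (Ioo (-r) r) f
  lt : ∀ x ∈ Ioo (-r) r, f x < h
  mem_iff : ∀ z : ℂ, z.re ∈ Ioo (-r) r → z.im ≤ h → (z ∈ K ↔ f z.re ≤ z.im)

namespace GraphChart

variable {K : Set ℂ} {r h : ℝ} {f : ℝ → ℝ}

lemma mem (c : GraphChart K r h f) {x : ℝ} (hx : x ∈ Ioo (-r) r) : (⟨x, f x⟩ : ℂ) ∈ K :=
  (c.mem_iff ⟨x, f x⟩ hx (c.lt x hx).le).2 le_rfl

lemma continuousOn (c : GraphChart K r h f) : ContinuousOn f (Ioo (-r) r) :=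
  c.convexOn.continuousOn isOpen_Ioo

lemma mem_interior (c : GraphChart K r h f) {z : ℂ} (hz : z.re ∈ Ioo (-r) r)
    (hf : f z.re < z.im) (hh : z.im < h) : z ∈ interior K := by
  rw [mem_interior_iff_mem_nhds]
  have h1 : ∀ᶠ w : ℂ in 𝓝 z, w.re ∈ Ioo (-r) r :=
    Complex.continuous_re.continuousAt.eventually_mem (isOpen_Ioo.mem_nhds hz)
  have h2 : ∀ᶠ w : ℂ in 𝓝 z, w.im < h :=
    Complex.continuous_im.continuousAt.eventually_lt continuousAt_const hh
  have hc : ContinuousAt (fun w : ℂ => f w.re) z :=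
    ContinuousAt.comp (f := fun w : ℂ => w.re) (g := f)
      (c.continuousOn.continuousAt (isOpen_Ioo.mem_nhds hz)) Complex.continuous_re.continuousAt
  have h3 : ∀ᶠ w : ℂ in 𝓝 z, f w.re < w.im :=
    hc.eventually_lt Complex.continuous_im.continuousAt hf
  filter_upwards [h1, h2, h3] with w a1 a2 a3
  exact (c.mem_iff w a1 a2.le).2 a3.le

lemma notMem_interior (c : GraphChart K r h f) {z : ℂ} (hz : z.re ∈ Ioo (-r) r)
    (hf : z.im ≤ f z.re) : z ∉ interior K := by
  intro hi
  rw [mem_interior_iff_mem_nhds] at hi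
  have ht : Tendsto (fun t : ℝ => z - t * Complex.I) (𝓝[>] 0) (𝓝 z) := by
    have : Continuous (fun t : ℝ => z - t * Complex.I) := by fun_prop
    have h0 := this.tendsto 0
    simp only [Complex.ofReal_zero, zero_mul, sub_zero] at h0
    exact h0.mono_left nhdsWithin_le_nhds
  have h1 := ht.eventually hi
  obtain ⟨t, ht1, ht2⟩ := (h1.and self_mem_nhdsWithin).exists
  have ht2 : 0 < t := ht2
  have hre : (z - t * Complex.I).re = z.re := by simp
  have him : (z - t * Complex.I).im = z.im - t := by simp
  have := (c.mem_iff (z - t * Complex.I) (by rwa [hre])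
    (by rw [him]; linarith [c.lt _ hz])).1 ht1
  rw [hre, him] at this
  linarith

lemma restrict (c : GraphChart K r h f) {s : ℝ} (hs : 0 < s) (hsr : s ≤ r) :
    GraphChart K s h f := by
  have hsub : Ioo (-s) s ⊆ Ioo (-r) r := Ioo_subset_Ioo (by linarith) hsr
  exact ⟨hs, c.convexOn.subset hsub (convex_Ioo _ _), fun x hx => c.lt x (hsub hx),
    fun z hz => c.mem_iff z (hsub hz)⟩

/-- A chart of `K` recentred at the boundary point over `x₀`. -/
lemma shift (c : GraphChart K r h f) {x₀ : ℝ} (hx : x₀ ∈ Ioo (-r) r) :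
    GraphChart (placed 1 ⟨x₀, f x₀⟩ K) (r - |x₀|) (h - f x₀) (fun x => f (x₀ + x) - f x₀) := by
  have hmem : ∀ x ∈ Ioo (-(r - |x₀|)) (r - |x₀|), x₀ + x ∈ Ioo (-r) r := by
    intro x hx'
    constructor
    · linarith [hx'.1, neg_abs_le x₀]
    · linarith [hx'.2, le_abs_self x₀]
  refine ⟨by linarith [abs_lt.2 hx], ?_, fun x hx' => by linarith [c.lt _ (hmem x hx')], ?_⟩
  · refine ⟨convex_Ioo _ _, fun x hx' y hy s t hs ht hst => ?_⟩
    have := c.convexOn.2 (hmem x hx') (hmem y hy) hs ht hst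
    simp only [smul_eq_mul] at this ⊢
    have e : s * (x₀ + x) + t * (x₀ + y) = x₀ + (s * x + t * y) := by
      linear_combination x₀ * hst
    rw [e] at this
    have e2 : s * f x₀ + t * f x₀ = f x₀ := by linear_combination f x₀ * hst
    linarith
  · intro z hz hzh
    rw [mem_placed, c.mem_iff _ (by simpa [add_comm] using hmem _ hz) (by simp; linarith)]
    simp only [one_mul, Complex.add_re, Complex.add_im]
    rw [add_comm z.re, sub_le_iff_le_add]

end GraphChart

/-- A closed convex set through `0` lying above a line through `0` is, near `0`, an epigraph in
the direction of any of its interior points on the positive imaginary axis. -/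
lemma exists_graphChart {K : Set ℂ} (hKc : IsClosed K) (hKv : Convex ℝ K) {m h : ℝ}
    (hm : ∀ z ∈ K, m * z.re ≤ z.im) (h0 : (0 : ℂ) ∈ K) (hh : (⟨0, h⟩ : ℂ) ∈ interior K) :
    ∃ r f, GraphChart K r h f ∧ f 0 = 0 := by
  obtain ⟨r, hr, hball⟩ := Metric.isOpen_iff.1 isOpen_interior _ hh
  have hx : ∀ x ∈ Ioo (-r) r, (⟨x, h⟩ : ℂ) ∈ interior K := by
    intro x hx
    apply hball
    rw [Metric.mem_ball, Complex.dist_of_im_eq (by rfl)]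
    simpa [Real.dist_eq, abs_lt] using hx
  have hcont : ∀ x : ℝ, Continuous (fun y : ℝ => (⟨x, y⟩ : ℂ)) := fun x => by
    have : (fun y : ℝ => (⟨x, y⟩ : ℂ)) = fun y : ℝ => (x : ℂ) + y * Complex.I := by
      ext y; apply Complex.ext <;> simp
    rw [this]; fun_prop
  have hbdd : ∀ x : ℝ, BddBelow {y : ℝ | (⟨x, y⟩ : ℂ) ∈ K} := fun x => ⟨m * x, fun y hy => hm _ hy⟩
  have hcl : ∀ x : ℝ, IsClosed {y : ℝ | (⟨x, y⟩ : ℂ) ∈ K} := fun x => hKc.preimage (hcont x)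
  have hne : ∀ x ∈ Ioo (-r) r, {y : ℝ | (⟨x, y⟩ : ℂ) ∈ K}.Nonempty :=
    fun x h' => ⟨h, show (⟨x, h⟩ : ℂ) ∈ K from interior_subset (hx x h')⟩
  have hmemf : ∀ x ∈ Ioo (-r) r, (⟨x, sInf {y : ℝ | (⟨x, y⟩ : ℂ) ∈ K}⟩ : ℂ) ∈ K :=
    fun x h' => (hcl x).csInf_mem (hne x h') (hbdd x)
  have hcomb : ∀ (z w : ℂ) (s t : ℝ), s • z + t • w = ⟨s * z.re + t * w.re, s * z.im + t * w.im⟩ :=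
    fun z w s t => by apply Complex.ext <;> simp
  refine ⟨r, fun x => sInf {y : ℝ | (⟨x, y⟩ : ℂ) ∈ K}, ⟨hr, ⟨convex_Ioo _ _, ?_⟩, ?_, ?_⟩, ?_⟩
  · intro x h1 y h2 s t hs ht hst
    refine csInf_le (hbdd _) ?_
    have := hKv (hmemf x h1) (hmemf y h2) hs ht hst
    rw [hcomb] at this
    exact this
  · intro x h1
    have ho : IsOpen {y : ℝ | (⟨x, y⟩ : ℂ) ∈ interior K} := isOpen_interior.preimage (hcont x)
    obtain ⟨ε, hε, hb⟩ := Metric.isOpen_iff.1 ho h (hx x h1)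
    have : (⟨x, h - ε / 2⟩ : ℂ) ∈ K := interior_subset (hb (by
      rw [Metric.mem_ball, Real.dist_eq, abs_lt]; constructor <;> linarith))
    exact (csInf_le (hbdd x) this).trans_lt (by linarith)
  · intro z hz hzh
    refine ⟨fun hzK => csInf_le (hbdd _) hzK, fun hle => ?_⟩
    have hconv : Convex ℝ {y : ℝ | (⟨z.re, y⟩ : ℂ) ∈ K} := by
      intro a ha b hb s t hs ht hst
      have := hKv ha hb hs ht hst
      rw [hcomb] at this
      have e : s * z.re + t * z.re = z.re := by linear_combination z.re * hst
      simp only [e] at this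
      exact this
    exact hconv.ordConnected.out (hmemf _ hz)
      (show (⟨z.re, h⟩ : ℂ) ∈ K from interior_subset (hx _ hz)) ⟨hle, hzh⟩
  · apply le_antisymm
    · exact csInf_le (hbdd 0) h0
    · exact le_csInf ⟨0, h0⟩ fun y hy => by simpa using hm _ hy

/-- A closed convex set with interior points has a chart around each of its boundary points. -/
lemma exists_graphChart_of_mem_frontier {K : Set ℂ} (hKc : IsClosed K) (hKv : Convex ℝ K)
    (hKi : (interior K).Nonempty) {p : ℂ} (hp : p ∈ frontier K) :
    ∃ a r h f, ‖a‖ = 1 ∧ GraphChart (placed a p K) r h f ∧ f 0 = 0 := by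
  obtain ⟨c, hc⟩ := hKi
  have hne : c - p ≠ 0 := fun h0 => hp.2 (by rwa [sub_eq_zero.1 h0] at hc)
  have hn : (‖c - p‖ : ℂ) ≠ 0 := by simpa using hne
  set a : ℂ := (c - p) / ‖c - p‖ / Complex.I with ha
  have ha1 : ‖a‖ = 1 := by simp [ha, hne]
  have hac : a * ⟨0, ‖c - p‖⟩ + p = c := by
    have : (⟨0, ‖c - p‖⟩ : ℂ) = ‖c - p‖ * Complex.I := by apply Complex.ext <;> simp
    rw [this, ha]; field_simp; ring
  have hcl := isClosed_placed (a := a) (b := p) hKc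
  have hcv := convex_placed (a := a) (b := p) hKv
  have hi : (⟨0, ‖c - p‖⟩ : ℂ) ∈ interior (placed a p K) := by
    rw [interior_placed ha1, mem_placed, hac]; exact hc
  have h0 : (0 : ℂ) ∉ interior (placed a p K) := by
    rw [interior_placed ha1, mem_placed]; simpa using hp.2
  obtain ⟨l, hl⟩ := geometric_hahn_banach_open_point hcv.interior isOpen_interior h0
  have hlz : ∀ z : ℂ, l z = z.re * l 1 + z.im * l Complex.I := by
    intro z
    conv_lhs => rw [show z = z.re • (1 : ℂ) + z.im • Complex.I by apply Complex.ext <;> simp]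
    rw [map_add, map_smul, map_smul]; simp
  have hli : l Complex.I < 0 := by
    have := hl _ hi
    rw [map_zero, hlz] at this
    simp only [zero_mul, zero_add] at this
    by_contra hcon
    exact absurd this (not_lt.2 (mul_nonneg (norm_nonneg _) (not_lt.1 hcon)))
  have hlK : ∀ z ∈ placed a p K, l z ≤ 0 := by
    intro z hz
    have hz' : z ∈ closure (interior (placed a p K)) := by
      rw [hcv.closure_interior_eq_closure_of_nonempty_interior ⟨_, hi⟩]
      exact subset_closure hz
    refine closure_minimal (fun w hw => ?_) (isClosed_le l.continuous continuous_const) hz'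
    simpa using (hl w hw).le
  obtain ⟨r, f, hf⟩ := exists_graphChart hcl hcv (m := -(l 1 / l Complex.I)) (h := ‖c - p‖) (by
    intro z hz
    have := hlK z hz
    rw [hlz] at this
    rw [neg_mul, neg_le_iff_add_nonneg]
    have h3 : z.im + l 1 / l Complex.I * z.re
        = (z.re * l 1 + z.im * l Complex.I) / l Complex.I := by
      field_simp [hli.ne]
      ring
    rw [h3]
    exact div_nonneg_of_nonpos this hli.le) (by
      rw [mem_placed]; simpa using hKc.frontier_subset hp) hi
  exact ⟨a, r, _, f, ha1, hf⟩

/-! ### Symmetries of sets close to a scalene triangle -/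

/-- The closed triangle with vertices `P`, `Q`, `R`, in barycentric coordinates. -/
def triangle (P Q R : ℂ) : Set ℂ :=
  {z | ∃ α β γ : ℝ, 0 ≤ α ∧ 0 ≤ β ∧ 0 ≤ γ ∧ α + β + γ = 1 ∧ z = α * P + β * Q + γ * R}

/-- The points of `triangle P Q R` all of whose barycentric coordinates are positive. -/
def openTriangle (P Q R : ℂ) : Set ℂ :=
  {z | ∃ α β γ : ℝ, 0 < α ∧ 0 < β ∧ 0 < γ ∧ α + β + γ = 1 ∧ z = α * P + β * Q + γ * R}

lemma triangle_rotate (P Q R : ℂ) : triangle P Q R = triangle Q R P := by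
  ext z; constructor
  · rintro ⟨α, β, γ, h1, h2, h3, h4, rfl⟩
    exact ⟨β, γ, α, h2, h3, h1, by linarith, by ring⟩
  · rintro ⟨β, γ, α, h2, h3, h1, h4, rfl⟩
    exact ⟨α, β, γ, h1, h2, h3, by linarith, by ring⟩

lemma isCompact_triangle (P Q R : ℂ) : IsCompact (triangle P Q R) := by
  have : triangle P Q R = (fun p : ℝ × ℝ × ℝ => (p.1 : ℂ) * P + p.2.1 * Q + p.2.2 * R) ''
      ((Icc (0 : ℝ) 1 ×ˢ Icc (0 : ℝ) 1 ×ˢ Icc (0 : ℝ) 1) ∩ {p | p.1 + p.2.1 + p.2.2 = 1}) := by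
    ext z; constructor
    · rintro ⟨α, β, γ, h1, h2, h3, h4, rfl⟩
      exact ⟨(α, β, γ), ⟨⟨⟨h1, by linarith⟩, ⟨h2, by linarith⟩, ⟨h3, by linarith⟩⟩, h4⟩, rfl⟩
    · rintro ⟨⟨α, β, γ⟩, ⟨⟨h1, h2, h3⟩, h4⟩, rfl⟩
      exact ⟨α, β, γ, h1.1, h2.1, h3.1, h4, rfl⟩
  rw [this]
  refine IsCompact.image ?_ (by fun_prop)
  refine IsCompact.inter_right (isCompact_Icc.prod (isCompact_Icc.prod isCompact_Icc)) ?_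
  exact isClosed_eq (by fun_prop) (by fun_prop)

/-- A longest side of a triangle that is strictly longer than the others is the only pair of
points of the triangle at its distance. -/
lemma eq_vertices_of_dist_eq {P Q R X Y : ℂ} (h1 : dist P R < dist P Q) (h2 : dist Q R < dist P Q)
    (hX : X ∈ triangle P Q R) (hY : Y ∈ triangle P Q R) (hd : dist X Y = dist P Q) :
    (X = P ∧ Y = Q) ∨ (X = Q ∧ Y = P) := by
  obtain ⟨α, β, γ, a1, a2, a3, a4, rfl⟩ := hX
  obtain ⟨α', β', γ', b1, b2, b3, b4, rfl⟩ := hY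
  have key : dist P Q ≤ (α * β' + β * α') * dist P Q + (α * γ' + γ * α') * dist P R
      + (β * γ' + γ * β') * dist Q R := by
    have e : (α * P + β * Q + γ * R) - (α' * P + β' * Q + γ' * R)
        = ((α * β' - β * α' : ℝ) : ℂ) * (P - Q) + ((α * γ' - γ * α' : ℝ) : ℂ) * (P - R)
          + ((β * γ' - γ * β' : ℝ) : ℂ) * (Q - R) := by
      have e1 : (α' : ℂ) = 1 - β' - γ' := by rw [eq_comm, sub_sub, sub_eq_iff_eq_add]
                                             exact_mod_cast by linarith
      have e2 : (α : ℂ) = 1 - β - γ := by rw [eq_comm, sub_sub, sub_eq_iff_eq_add]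
                                          exact_mod_cast by linarith
      push_cast
      rw [e1, e2]; ring
    conv_lhs => rw [← hd, dist_eq_norm, e]
    refine (norm_add₃_le).trans ?_
    rw [dist_eq_norm, dist_eq_norm, dist_eq_norm, norm_mul, norm_mul, norm_mul, Complex.norm_real,
      Complex.norm_real, Complex.norm_real, Real.norm_eq_abs, Real.norm_eq_abs, Real.norm_eq_abs]
    have := mul_nonneg a1 b2
    have := mul_nonneg a2 b1
    have := mul_nonneg a1 b3
    have := mul_nonneg a3 b1
    have := mul_nonneg a2 b3
    have := mul_nonneg a3 b2
    gcongr <;> rw [abs_le] <;> constructor <;> linarith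
  have hsum : (α * β' + β * α') + (α * γ' + γ * α') + (β * γ' + γ * β')
      + (α * α' + β * β' + γ * γ') = 1 := by
    have : (α + β + γ) * (α' + β' + γ') = 1 := by rw [a4, b4]; ring
    linarith
  have p1 := mul_nonneg a1 b1
  have p2 := mul_nonneg a2 b2
  have p3 := mul_nonneg a3 b3
  have q1 := mul_nonneg a1 b2
  have q2 := mul_nonneg a2 b1
  have q3 := mul_nonneg a1 b3
  have q4 := mul_nonneg a3 b1
  have q5 := mul_nonneg a2 b3
  have q6 := mul_nonneg a3 b2
  have hD : 0 < dist P Q := dist_nonneg.trans_lt h1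
  have r1 : (α * γ' + γ * α') * (dist P Q - dist P R) ≥ 0 := mul_nonneg (by linarith) (by linarith)
  have r2 : (β * γ' + γ * β') * (dist P Q - dist Q R) ≥ 0 := mul_nonneg (by linarith) (by linarith)
  have r3 : (α * α' + β * β' + γ * γ') * dist P Q ≥ 0 := mul_nonneg (by linarith) hD.le
  have hsumD : ((α * β' + β * α') + (α * γ' + γ * α') + (β * γ' + γ * β')
      + (α * α' + β * β' + γ * γ')) * dist P Q = dist P Q := by rw [hsum, one_mul]
  have s1 : (α * γ' + γ * α') * (dist P Q - dist P R) = 0 := by linarith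
  have s2 : (β * γ' + γ * β') * (dist P Q - dist Q R) = 0 := by linarith
  have s3 : (α * α' + β * β' + γ * γ') * dist P Q = 0 := by linarith
  have t1 : α * γ' + γ * α' = 0 := (mul_eq_zero.1 s1).resolve_right (by linarith)
  have t2 : β * γ' + γ * β' = 0 := (mul_eq_zero.1 s2).resolve_right (by linarith)
  have t3 : α * α' + β * β' + γ * γ' = 0 := (mul_eq_zero.1 s3).resolve_right hD.ne'
  have u : α * β' + β * α' = 1 := by linarith
  rcases mul_eq_zero.1 (show α * α' = 0 by linarith) with h | h
  · right
    have v : β * α' = 1 := by rw [h] at u; linarith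
    have w : β = 1 := le_antisymm (by linarith) (by nlinarith)
    have w' : α' = 1 := by rw [w] at v; linarith
    have hg : γ = 0 := by linarith
    have hb : β' = 0 := by linarith
    have hg' : γ' = 0 := by linarith
    simp [h, w, w', hg, hb, hg']
  · left
    have v : α * β' = 1 := by rw [h] at u; linarith
    have w : α = 1 := le_antisymm (by linarith) (by nlinarith)
    have w' : β' = 1 := by rw [w] at v; linarith
    have hg : γ = 0 := by linarith
    have hb : β = 0 := by linarith
    have hg' : γ' = 0 := by linarith
    simp [h, w, w', hg, hb, hg']

lemma norm_sq_eq (z : ℂ) : ‖z‖ ^ 2 = z.re ^ 2 + z.im ^ 2 := by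
  rw [← Complex.normSq_eq_norm_sq, Complex.normSq_apply]; ring

/-- An isometry carrying the vertices of a triangle with a longest side `PQ` and with
`PR ≠ QR` into the triangle fixes the vertices. -/
lemma fixes_vertices_of_longest {P Q R : ℂ} {σ : ℂ → ℂ} (hσ : Isometry σ)
    (hP : σ P ∈ triangle P Q R) (hQ : σ Q ∈ triangle P Q R) (hR : σ R ∈ triangle P Q R)
    (h1 : dist P R < dist P Q) (h2 : dist Q R < dist P Q) (h3 : dist P R ≠ dist Q R)
    (hn : ((R - P) / (Q - P)).im ≠ 0) : σ P = P ∧ σ Q = Q ∧ σ R = R := by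
  have hPQ : Q - P ≠ 0 := by
    intro h; rw [h] at hn; simp at hn
  have hD := eq_vertices_of_dist_eq h1 h2 hP hQ (hσ.dist_eq P Q)
  have dRP := hσ.dist_eq R P
  have dRQ := hσ.dist_eq R Q
  obtain ⟨α, β, γ, α0, β0, g0, hs, hX⟩ := hR
  set r := (R - P) / (Q - P) with hr
  have eR : R = P + r * (Q - P) := by rw [hr]; field_simp; ring
  have eX : σ R = P + (β + γ * r) * (Q - P) := by
    have e2 : (α : ℂ) = 1 - β - γ := by rw [eq_comm, sub_sub, sub_eq_iff_eq_add]
                                        exact_mod_cast by linarith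
    rw [hX, e2, eR]; ring
  have hnorm : 0 < ‖Q - P‖ := norm_pos_iff.2 hPQ
  have c1 : ∀ x : ℂ, dist (P + x * (Q - P)) P = ‖x‖ * ‖Q - P‖ := fun x => by
    rw [dist_eq_norm, add_sub_cancel_left, norm_mul]
  have c2 : ∀ x : ℂ, dist (P + x * (Q - P)) Q = ‖x - 1‖ * ‖Q - P‖ := fun x => by
    rw [dist_eq_norm, ← norm_mul]; ring_nf
  have sq : ∀ x y : ℂ, ‖x‖ * ‖Q - P‖ = ‖y‖ * ‖Q - P‖ →
      x.re ^ 2 + x.im ^ 2 = y.re ^ 2 + y.im ^ 2 := fun x y h => by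
    rw [← norm_sq_eq, ← norm_sq_eq, mul_right_cancel₀ hnorm.ne' h]
  have hre : (β + γ * r : ℂ).re = β + γ * r.re := by simp
  have him : (β + γ * r : ℂ).im = γ * r.im := by simp
  rcases hD with ⟨a1, a2⟩ | ⟨a1, a2⟩
  · refine ⟨a1, a2, ?_⟩
    rw [a1, eX] at dRP
    rw [a2, eX] at dRQ
    rw [eR, c1, c1] at dRP
    rw [eR, c2, c2] at dRQ
    have u1 := sq _ _ dRP
    have u2 := sq _ _ dRQ
    simp only [Complex.sub_re, Complex.sub_im, Complex.one_re, Complex.one_im, hre, him] at u1 u2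
    have v1 : β + γ * r.re = r.re := by linarith
    rw [v1] at u1
    have v2 : γ ^ 2 = 1 := by
      have : (γ ^ 2 - 1) * r.im ^ 2 = 0 := by linarith
      have := (mul_eq_zero.1 this).resolve_right (pow_ne_zero 2 hn)
      linarith
    have v3 : γ = 1 := by nlinarith
    have v4 : β = 0 := by rw [v3] at v1; linarith
    rw [eX, eR, v3, v4]; simp
  · exfalso
    rw [a1, eX] at dRP
    rw [a2, eX] at dRQ
    rw [eR, c1, c2] at dRP
    rw [eR, c2, c1] at dRQ
    have u1 := sq _ _ dRP
    have u2 := sq _ _ dRQ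
    simp only [Complex.sub_re, Complex.sub_im, Complex.one_re, Complex.one_im, hre, him] at u1 u2
    have v1 : β + γ * r.re = 1 - r.re := by linarith
    rw [v1] at u1
    have v2 : γ ^ 2 = 1 := by
      have : (γ ^ 2 - 1) * r.im ^ 2 = 0 := by linarith
      have := (mul_eq_zero.1 this).resolve_right (pow_ne_zero 2 hn)
      linarith
    have v3 : γ = 1 := by nlinarith
    have hβ : β = 1 - 2 * r.re := by rw [v3] at v1; linarith
    have v4 : β = 0 := by linarith
    apply h3
    rw [dist_comm P, dist_comm Q, eR, c1, c2]
    congr 1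
    have : r.re = 1 / 2 := by linarith
    rw [← sq_eq_sq₀ (norm_nonneg _) (norm_nonneg _), norm_sq_eq, norm_sq_eq]
    simp only [Complex.sub_re, Complex.sub_im, Complex.one_re, Complex.one_im, this]
    norm_num

lemma fixes_vertices {P Q R : ℂ} {σ : ℂ → ℂ} (hσ : Isometry σ)
    (hT : ∀ V ∈ triangle P Q R, σ V ∈ triangle P Q R)
    (h1 : dist P Q ≠ dist Q R) (h2 : dist Q R ≠ dist R P) (h3 : dist R P ≠ dist P Q)
    (hn : ((R - P) * conj (Q - P)).im ≠ 0) : σ P = P ∧ σ Q = Q ∧ σ R = R := by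
  have him : ∀ x y : ℂ, (x * conj y).im ≠ 0 → (x / y).im ≠ 0 := by
    intro x y h
    have hy : y ≠ 0 := by rintro rfl; simp at h
    have : (x / y).im = (x * conj y).im / Complex.normSq y := by
      simp only [Complex.div_im, Complex.mul_im, Complex.conj_re, Complex.conj_im]; ring
    rw [this]
    exact div_ne_zero h (by simpa using hy)
  have vP : P ∈ triangle P Q R := ⟨1, 0, 0, by simp⟩
  have vQ : Q ∈ triangle P Q R := ⟨0, 1, 0, by simp⟩
  have vR : R ∈ triangle P Q R := ⟨0, 0, 1, by simp⟩
  have n2 : ((P - Q) * conj (R - Q)).im ≠ 0 := by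
    convert hn using 1; simp only [map_sub, Complex.mul_im, Complex.sub_re, Complex.sub_im,
      Complex.conj_re, Complex.conj_im]; ring
  have n3 : ((Q - R) * conj (P - R)).im ≠ 0 := by
    convert hn using 1; simp only [map_sub, Complex.mul_im, Complex.sub_re, Complex.sub_im,
      Complex.conj_re, Complex.conj_im]; ring
  have tP := hT P vP
  have tQ := hT Q vQ
  have tR := hT R vR
  rcases lt_or_gt_of_ne h1 with a | a
  · rcases lt_or_gt_of_ne h2 with b | b
    · -- `RP` is the longest side
      rw [triangle_rotate, triangle_rotate] at tP tQ tR
      obtain ⟨q1, q2, q3⟩ := fixes_vertices_of_longest hσ tR tP tQ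
        (by rw [dist_comm R Q]; exact b) (by linarith) (by rw [dist_comm R Q]; exact h1.symm)
        (him _ _ n3)
      exact ⟨q2, q3, q1⟩
    · rw [triangle_rotate] at tP tQ tR
      obtain ⟨q1, q2, q3⟩ := fixes_vertices_of_longest hσ tQ tR tP
        (by rw [dist_comm Q P]; exact a) b (by rw [dist_comm Q P]; exact h3.symm)
        (him _ _ n2)
      exact ⟨q3, q1, q2⟩
  · rcases lt_or_gt_of_ne h3 with b | b
    · exact fixes_vertices_of_longest hσ tP tQ tR
        (by rw [dist_comm P R]; exact b) a (by rw [dist_comm P R]; exact h2.symm)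
        (him _ _ hn)
    · rw [triangle_rotate, triangle_rotate] at tP tQ tR
      obtain ⟨q1, q2, q3⟩ := fixes_vertices_of_longest hσ tR tP tQ
        (by rw [dist_comm R Q]; linarith) (by linarith) (by rw [dist_comm R Q]; exact h1.symm)
        (him _ _ n3)
      exact ⟨q2, q3, q1⟩

/-- There are no small non-trivial subgroups of the multiplicative group around `1`: as long as
`a ^ k` stays close to `1`, squaring increases the distance to `1`. -/
lemma exists_pow_far {a : ℂ} (ha1 : a ≠ 1) : ∃ k : ℕ, 1 / 2 ≤ ‖a ^ k - 1‖ := by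
  by_contra! hcon
  have hstep : ∀ j : ℕ, (3 / 2 : ℝ) ^ j * ‖a - 1‖ ≤ ‖a ^ 2 ^ j - 1‖ := by
    intro j
    induction j with
    | zero => simp
    | succ j ih =>
      have e : a ^ 2 ^ (j + 1) - 1 = (a ^ 2 ^ j - 1) * (a ^ 2 ^ j + 1) := by
        rw [pow_succ 2, pow_mul]; ring
      have h2 : (3 / 2 : ℝ) ≤ ‖a ^ 2 ^ j + 1‖ := by
        have h3 : ‖(2 : ℂ)‖ ≤ ‖a ^ 2 ^ j + 1‖ + ‖a ^ 2 ^ j - 1‖ := by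
          have := norm_sub_le (a ^ 2 ^ j + 1) (a ^ 2 ^ j - 1)
          rwa [show a ^ 2 ^ j + 1 - (a ^ 2 ^ j - 1) = 2 by ring] at this
        have h4 := hcon (2 ^ j)
        rw [Complex.norm_ofNat] at h3
        linarith
      rw [e, norm_mul, pow_succ]
      calc (3 / 2 : ℝ) ^ j * (3 / 2) * ‖a - 1‖ = ((3 / 2 : ℝ) ^ j * ‖a - 1‖) * (3 / 2) := by ring
        _ ≤ _ := by gcongr
  have hpos : 0 < ‖a - 1‖ := norm_pos_iff.2 (sub_ne_zero.2 ha1)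
  obtain ⟨n, hn⟩ := pow_unbounded_of_one_lt (1 / ‖a - 1‖) (show (1 : ℝ) < 3 / 2 by norm_num)
  have h1 := hstep n
  have h2 := hcon (2 ^ n)
  rw [div_lt_iff₀ hpos] at hn
  linarith

lemma isometry_mul_add {a : ℂ} (ha : ‖a‖ = 1) (b : ℂ) {τ : ℂ → ℂ} (hτ : Isometry τ) :
    Isometry (fun z => a * τ z + b) := by
  refine Isometry.of_dist_eq fun z w => ?_
  rw [dist_add_right, dist_eq_norm, ← mul_sub, norm_mul, ha, one_mul, ← dist_eq_norm, hτ.dist_eq]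

lemma exists_affine_of_iterate {C : Set ℂ} {a b : ℂ} (h : ∀ z ∈ C, a * z + b ∈ C) (k : ℕ) :
    ∃ b', ∀ z ∈ C, a ^ k * z + b' ∈ C := by
  induction k with
  | zero => exact ⟨0, by simp⟩
  | succ k ih =>
    obtain ⟨b', hb⟩ := ih
    refine ⟨a * b' + b, fun z hz => ?_⟩
    convert h _ (hb z hz) using 1
    ring

/-- A nonempty bounded set with a non-trivial symmetry is mapped into itself by a rotation whose
angle is not small, or by an orientation reversing isometry. -/
lemma exists_far_symmetry {C : Set ℂ} (hb : Bornology.IsBounded C) (hne : C.Nonempty)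
    (h : HasIsometricSymmetry C) :
    (∃ a b : ℂ, ‖a‖ = 1 ∧ 1 / 2 ≤ ‖a - 1‖ ∧ ∀ z ∈ C, a * z + b ∈ C) ∨
      ∃ a b : ℂ, ‖a‖ = 1 ∧ ∀ z ∈ C, a * conj z + b ∈ C := by
  rcases h with ⟨a, b, ha, hab, h⟩ | ⟨a, b, ha, h⟩
  · left
    have hmap : ∀ z ∈ C, a * z + b ∈ C := fun z hz => (h z).2 hz
    by_cases ha1 : a = 1
    · exfalso
      have hb0 : b ≠ 0 := hab.resolve_left (not_not.2 ha1)
      obtain ⟨z, hz⟩ := hne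
      have hk : ∀ k : ℕ, z + k * b ∈ C := by
        intro k
        induction k with
        | zero => simpa using hz
        | succ k ih =>
          have := hmap _ ih
          rw [ha1] at this
          convert this using 1
          push_cast; ring
      obtain ⟨M, hM⟩ := hb.exists_norm_le
      obtain ⟨k, hk'⟩ := exists_nat_gt ((M + ‖z‖) / ‖b‖)
      have hbp : 0 < ‖b‖ := norm_pos_iff.2 hb0
      rw [div_lt_iff₀ hbp] at hk'
      have h1 := hM _ (hk k)
      have h2 : ‖(k : ℂ) * b‖ ≤ ‖z + k * b‖ + ‖z‖ := by
        have := norm_sub_le (z + k * b) z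
        rwa [add_sub_cancel_left] at this
      rw [norm_mul, Complex.norm_natCast] at h2
      linarith
    · obtain ⟨k, hk⟩ := exists_pow_far ha1
      obtain ⟨b', hb'⟩ := exists_affine_of_iterate hmap k
      exact ⟨a ^ k, b', by simp [ha], hk, hb'⟩
  · exact Or.inr ⟨a, b, ha, fun z hz => (h z).2 hz⟩

/-- Isometries of subsets exhausting a triangle from inside subconverge to an isometry of the
triangle. Here `τ` is the identity or complex conjugation, and the closed set `A` records a
constraint on the rotational part. -/
lemma exists_limit_isometry {P Q R : ℂ} {C : ℕ → Set ℂ} (hsub : ∀ n, C n ⊆ triangle P Q R)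
    (hev : ∀ z ∈ openTriangle P Q R, ∀ᶠ n in atTop, z ∈ C n) {τ : ℂ → ℂ} (hτ : Isometry τ)
    {A : Set ℂ} (hA : IsClosed A)
    (hf : ∃ᶠ n in atTop, ∃ a b : ℂ, ‖a‖ = 1 ∧ a ∈ A ∧ ∀ z ∈ C n, a * τ z + b ∈ C n) :
    ∃ a b : ℂ, ‖a‖ = 1 ∧ a ∈ A ∧ ∀ z ∈ triangle P Q R, a * τ z + b ∈ triangle P Q R := by
  obtain ⟨φ, hφ, hφ'⟩ := extraction_of_frequently_atTop hf
  choose a b ha haA hab using hφ'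
  set G : ℂ := (1 / 3 : ℝ) * P + (1 / 3 : ℝ) * Q + (1 / 3 : ℝ) * R with hG
  have hGo : G ∈ openTriangle P Q R :=
    ⟨1 / 3, 1 / 3, 1 / 3, by norm_num, by norm_num, by norm_num, by norm_num, rfl⟩
  obtain ⟨M, hM⟩ := (isCompact_triangle P Q R).isBounded.exists_norm_le
  have hK : IsCompact (Metric.sphere (0 : ℂ) 1 ×ˢ Metric.closedBall (0 : ℂ) (M + ‖τ G‖)) :=
    (isCompact_sphere _ _).prod (isCompact_closedBall _ _)
  have hin : ∀ᶠ n in atTop, (a n, b n) ∈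
      Metric.sphere (0 : ℂ) 1 ×ˢ Metric.closedBall (0 : ℂ) (M + ‖τ G‖) := by
    filter_upwards [hφ.tendsto_atTop.eventually (hev G hGo)] with n hn
    refine ⟨by simp [ha n], ?_⟩
    have h1 := hM _ (hsub _ (hab n G hn))
    rw [mem_closedBall_zero_iff]
    have h2 := norm_sub_le (a n * τ G + b n) (a n * τ G)
    rw [add_sub_cancel_left, norm_mul, ha, one_mul] at h2
    linarith
  obtain ⟨⟨a₀, b₀⟩, hmem, ψ, hψ, hlim⟩ := hK.tendsto_subseq' hin.frequently
  have hlima : Tendsto (fun n => a (ψ n)) atTop (𝓝 a₀) := (continuous_fst.tendsto _).comp hlim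
  have hlimb : Tendsto (fun n => b (ψ n)) atTop (𝓝 b₀) := (continuous_snd.tendsto _).comp hlim
  have hopen : ∀ z ∈ openTriangle P Q R, a₀ * τ z + b₀ ∈ triangle P Q R := by
    intro z hz
    refine (isCompact_triangle P Q R).isClosed.mem_of_tendsto
      ((hlima.mul_const (τ z)).add hlimb) ?_
    filter_upwards [(hφ.comp hψ).tendsto_atTop.eventually (hev z hz)] with n hn
    exact hsub _ (hab (ψ n) z hn)
  refine ⟨a₀, b₀, by simpa using hmem.1, hA.mem_of_tendsto hlima (Eventually.of_forall fun n =>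
    haA _), fun z hz => ?_⟩
  -- `z` is a limit of the points `(1 - t) z + t G` of the open triangle as `t → 0`
  have hcont : Continuous (fun t : ℝ => a₀ * τ ((1 - t : ℝ) * z + t * G) + b₀) := by
    have := hτ.continuous
    fun_prop
  have ht := (hcont.tendsto 0).mono_left (nhdsWithin_le_nhds (s := Ioi 0))
  simp only [sub_zero, Complex.ofReal_one, one_mul, Complex.ofReal_zero, zero_mul, add_zero] at ht
  refine (isCompact_triangle P Q R).isClosed.mem_of_tendsto ht ?_
  filter_upwards [Ioo_mem_nhdsGT (show (0 : ℝ) < 1 by norm_num)] with t ht01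
  apply hopen
  obtain ⟨α, β, γ, h1, h2, h3, h4, rfl⟩ := hz
  have ht0 := ht01.1
  have ht1 : 0 < 1 - t := by linarith [ht01.2]
  refine ⟨(1 - t) * α + t / 3, (1 - t) * β + t / 3, (1 - t) * γ + t / 3, by positivity,
    by positivity, by positivity, by linear_combination (1 - t) * h4, ?_⟩
  rw [hG]; push_cast; ring

/-- Subsets exhausting a scalene triangle from inside do not all have symmetries. -/
lemma false_of_exhaustion {P Q R : ℂ} (h1 : dist P Q ≠ dist Q R) (h2 : dist Q R ≠ dist R P)
    (h3 : dist R P ≠ dist P Q) (hn : ((R - P) * conj (Q - P)).im ≠ 0) {C : ℕ → Set ℂ}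
    (hsub : ∀ n, C n ⊆ triangle P Q R)
    (hev : ∀ z ∈ openTriangle P Q R, ∀ᶠ n in atTop, z ∈ C n)
    (hsym : ∀ᶠ n in atTop, HasIsometricSymmetry (C n)) : False := by
  have hall : ∀ᶠ n in atTop,
      (∃ a b : ℂ, ‖a‖ = 1 ∧ a ∈ {a : ℂ | 1 / 2 ≤ ‖a - 1‖} ∧ ∀ z ∈ C n, a * id z + b ∈ C n) ∨
      ∃ a b : ℂ, ‖a‖ = 1 ∧ a ∈ (univ : Set ℂ) ∧ ∀ z ∈ C n, a * conj z + b ∈ C n := by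
    have hGo : ((1 / 3 : ℝ) * P + (1 / 3 : ℝ) * Q + (1 / 3 : ℝ) * R : ℂ) ∈ openTriangle P Q R :=
      ⟨1 / 3, 1 / 3, 1 / 3, by norm_num, by norm_num, by norm_num, by norm_num, rfl⟩
    filter_upwards [hsym, hev _ hGo] with n hs hg
    rcases exists_far_symmetry ((isCompact_triangle P Q R).isBounded.subset (hsub n)) ⟨_, hg⟩ hs
      with ⟨a, b, ha, ha', h⟩ | ⟨a, b, ha, h⟩
    · exact Or.inl ⟨a, b, ha, ha', h⟩
    · exact Or.inr ⟨a, b, ha, mem_univ _, h⟩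
  have hQP : Q - P ≠ 0 := by rintro h; rw [h] at hn; simp at hn
  rcases frequently_or_distrib.1 hall.frequently with hf | hf
  · obtain ⟨a, b, ha, haA, hT⟩ := exists_limit_isometry hsub hev isometry_id
      (isClosed_le continuous_const (by fun_prop)) hf
    obtain ⟨e1, e2, -⟩ := fixes_vertices (isometry_mul_add ha b isometry_id) hT h1 h2 h3 hn
    simp only [id] at e1 e2
    have : (a - 1) * (Q - P) = 0 := by linear_combination e2 - e1
    have ha1 : a = 1 := sub_eq_zero.1 ((mul_eq_zero.1 this).resolve_right hQP)
    rw [ha1] at haA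
    simp at haA
    linarith
  · have hconj : Isometry (fun z : ℂ => conj z) := Complex.isometry_conj
    obtain ⟨a, b, ha, -, hT⟩ := exists_limit_isometry hsub hev hconj isClosed_univ hf
    obtain ⟨e1, e2, e3⟩ := fixes_vertices (isometry_mul_add ha b hconj) hT h1 h2 h3 hn
    have f1 : a * conj (Q - P) = Q - P := by rw [map_sub]; linear_combination e2 - e1
    have f2 : a * conj (R - P) = R - P := by rw [map_sub]; linear_combination e3 - e1
    have f3 : (R - P) * conj (Q - P) = conj ((R - P) * conj (Q - P)) := by
      rw [map_mul, Complex.conj_conj]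
      linear_combination (-conj (Q - P)) * f2 + conj (R - P) * f1
    exact hn (Complex.conj_eq_iff_im.1 f3.symm)

/-! ### Blow-up at a boundary point and absence of corners -/

/-- The wedge `{z | m₁ * re z ≤ im z ∧ m₂ * re z ≤ im z}` is the tangent cone of `K` at `0`:
it contains `K`, and dilates of `K` exhaust its interior. -/
structure TangentWedge (K : Set ℂ) (m₁ m₂ : ℝ) : Prop where
  support : ∀ z ∈ K, m₁ * z.re ≤ z.im ∧ m₂ * z.re ≤ z.im
  blowup : ∀ z : ℂ, m₁ * z.re < z.im → m₂ * z.re < z.im →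
    ∀ᶠ n : ℕ in atTop, z / ((n + 1 : ℝ) : ℂ) ∈ interior K

lemma tendsto_div_succ (x : ℝ) : Tendsto (fun n : ℕ => x / (n + 1 : ℝ)) atTop (𝓝 0) := by
  have := (tendsto_one_div_add_atTop_nhds_zero_nat (𝕜 := ℝ)).const_mul x
  simpa only [mul_one_div, mul_zero] using this

namespace GraphChart

variable {K : Set ℂ} {r h : ℝ} {f : ℝ → ℝ}

lemma zero_mem (c : GraphChart K r h f) : (0 : ℝ) ∈ Ioo (-r) r := ⟨by linarith [c.pos], c.pos⟩

lemma tangentWedge (c : GraphChart K r h f) (hK : Convex ℝ K) (h0 : f 0 = 0) {m₁ m₂ : ℝ}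
    (h1 : HasDerivWithinAt f m₁ (Iio 0) 0) (h2 : HasDerivWithinAt f m₂ (Ioi 0) 0) :
    TangentWedge K m₁ m₂ := by
  have hint : (0 : ℝ) ∈ interior (Ioo (-r) r) := by rw [interior_Ioo]; exact c.zero_mem
  have hle : m₁ ≤ m₂ := by
    have := c.convexOn.leftDeriv_le_rightDeriv_of_mem_interior hint
    rwa [h1.derivWithin (uniqueDiffWithinAt_Iio 0), h2.derivWithin (uniqueDiffWithinAt_Ioi 0)]
      at this
  have hsub : ∀ x ∈ Ioo (-r) r, m₁ * x ≤ f x ∧ m₂ * x ≤ f x := by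
    intro x hx
    rcases lt_trichotomy x 0 with hneg | rfl | hpos
    · have := c.convexOn.slope_le_of_hasDerivWithinAt_Iio hx c.zero_mem hneg h1
      rw [slope_def_field, h0, div_le_iff₀ (by linarith)] at this
      constructor <;> nlinarith
    · simp [h0]
    · have := c.convexOn.le_slope_of_hasDerivWithinAt_Ioi c.zero_mem hx hpos h2
      rw [slope_def_field, h0, le_div_iff₀ (by linarith)] at this
      constructor <;> nlinarith
  have hh : 0 < h := by simpa [h0] using c.lt 0 c.zero_mem
  refine ⟨fun z hz => ?_, fun z hz1 hz2 => ?_⟩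
  · have hx := (tendsto_div_succ z.re).eventually (isOpen_Ioo.mem_nhds c.zero_mem)
    have hy := (tendsto_div_succ z.im).eventually (gt_mem_nhds hh)
    obtain ⟨n, hn1, hn2⟩ := (hx.and hy).exists
    have hn : (0 : ℝ) < n + 1 := by positivity
    have hmem : z / ((n + 1 : ℝ) : ℂ) ∈ K := by
      have h00 : (0 : ℂ) ∈ K := by
        rw [c.mem_iff 0 (by simpa using c.zero_mem) (by simpa using hh.le)]; simp [h0]
      have := hK.smul_mem_of_zero_mem h00 hz (t := 1 / (n + 1 : ℝ)) ⟨by positivity, by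
        rw [div_le_one hn]; linarith [(Nat.cast_nonneg n : (0 : ℝ) ≤ n)]⟩
      rw [Complex.real_smul] at this
      convert this using 1
      push_cast; ring
    have := (c.mem_iff _ (by rwa [Complex.div_ofReal_re])
      (by rw [Complex.div_ofReal_im]; exact hn2.le)).1 hmem
    rw [Complex.div_ofReal_re, Complex.div_ofReal_im] at this
    obtain ⟨k1, k2⟩ := hsub _ hn1
    constructor
    · have := k1.trans this
      rwa [← mul_div_assoc, div_le_div_iff_of_pos_right hn] at this
    · have := k2.trans this
      rwa [← mul_div_assoc, div_le_div_iff_of_pos_right hn] at this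
  · have hx := (tendsto_div_succ z.re).eventually (isOpen_Ioo.mem_nhds c.zero_mem)
    have hy := (tendsto_div_succ z.im).eventually (gt_mem_nhds hh)
    have hf : ∀ᶠ n : ℕ in atTop, f (z.re / (n + 1 : ℝ)) < z.im / (n + 1 : ℝ) := by
      rcases lt_trichotomy z.re 0 with hneg | hz0 | hpos
      · have ht := (hasDerivWithinAt_iff_tendsto_slope' self_notMem_Iio).1 h1
        have ht2 : Tendsto (fun n : ℕ => z.re / (n + 1 : ℝ)) atTop (𝓝[<] 0) :=
          tendsto_nhdsWithin_iff.2 ⟨tendsto_div_succ _, Eventually.of_forall fun n =>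
            div_neg_of_neg_of_pos hneg (by positivity)⟩
        have hlt : z.im / z.re < m₁ := by rwa [div_lt_iff_of_neg hneg]
        filter_upwards [(ht.comp ht2).eventually (lt_mem_nhds hlt)] with n hn
        have hn0 : (0 : ℝ) < n + 1 := by positivity
        have hneg' : z.re / (n + 1 : ℝ) < 0 := div_neg_of_neg_of_pos hneg hn0
        rw [Function.comp, slope_def_field, h0, sub_zero, sub_zero, lt_div_iff_of_neg hneg'] at hn
        refine hn.trans_eq ?_
        field_simp [hneg.ne]
      · filter_upwards with n
        have hn0 : (0 : ℝ) < n + 1 := by positivity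
        rw [hz0] at hz1 ⊢
        rw [zero_div, h0]
        exact div_pos (by linarith) hn0
      · have ht := (hasDerivWithinAt_iff_tendsto_slope' self_notMem_Ioi).1 h2
        have ht2 : Tendsto (fun n : ℕ => z.re / (n + 1 : ℝ)) atTop (𝓝[>] 0) :=
          tendsto_nhdsWithin_iff.2 ⟨tendsto_div_succ _, Eventually.of_forall fun n =>
            div_pos hpos (by positivity)⟩
        have hlt : m₂ < z.im / z.re := by rwa [lt_div_iff₀ hpos]
        filter_upwards [(ht.comp ht2).eventually (gt_mem_nhds hlt)] with n hn
        have hn0 : (0 : ℝ) < n + 1 := by positivity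
        have hpos' : 0 < z.re / (n + 1 : ℝ) := div_pos hpos hn0
        rw [Function.comp, slope_def_field, h0, sub_zero, sub_zero, div_lt_iff₀ hpos'] at hn
        refine hn.trans_eq ?_
        field_simp [hpos.ne']
    filter_upwards [hx, hy, hf] with n a1 a2 a3
    exact c.mem_interior (by rwa [Complex.div_ofReal_re])
      (by rwa [Complex.div_ofReal_re, Complex.div_ofReal_im]) (by rwa [Complex.div_ofReal_im])

end GraphChart

/-- Two unit vectors with inner product `c ∈ (-1, 1)` span, after suitably shortening the second,
a scalene triangle. -/
lemma exists_scalene_ratio {c : ℝ} (h1 : c < 1) :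
    ∃ κ : ℝ, 0 < κ ∧ κ ^ 2 ≠ 1 ∧ 1 + κ ^ 2 - 2 * κ * c ≠ 1 ∧ 1 + κ ^ 2 - 2 * κ * c ≠ κ ^ 2 := by
  rcases le_or_gt c 0 with h | h
  · exact ⟨1 / 2, by norm_num, by norm_num, by intro h'; linarith, by intro h'; linarith⟩
  · refine ⟨min (1 / 2) c, by positivity, ?_, ?_, ?_⟩
    · have : min (1 / 2) c ≤ 1 / 2 := min_le_left _ _
      have h0 : 0 < min (1 / 2) c := by positivity
      intro h'; nlinarith
    · have : min (1 / 2) c ≤ c := min_le_right _ _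
      have h0 : 0 < min (1 / 2) c := by positivity
      intro h'; nlinarith
    · have : min (1 / 2) c ≤ 1 / 2 := min_le_left _ _
      have h0 : 0 < min (1 / 2) c := by positivity
      intro h'; nlinarith

lemma HasIsometricSymmetry.dilate {S : Set ℂ} (h : HasIsometricSymmetry S) {N : ℂ} (hN : N ≠ 0)
    (hNr : conj N = N) : HasIsometricSymmetry {z | z / N ∈ S} := by
  rcases h with ⟨a, b, ha, hab, h⟩ | ⟨a, b, ha, h⟩
  · refine Or.inl ⟨a, N * b, ha, hab.imp_right fun hb => mul_ne_zero hN hb, fun z => ?_⟩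
    rw [mem_ofPred_eq, mem_ofPred_eq, ← h (z / N),
      show (a * z + N * b) / N = a * (z / N) + b by field_simp]
  · refine Or.inr ⟨a, N * b, ha, fun z => ?_⟩
    rw [mem_ofPred_eq, mem_ofPred_eq, ← h (z / N), map_div₀, hNr,
      show (a * conj z + N * b) / N = a * (conj z / N) + b by field_simp]

/-- If `L` has a half-plane as tangent cone at some boundary point, then `K` has no corner:
small pieces of `K` near a corner, cut off by the boundary of `L`, look like a triangle
whose shape can be prescribed up to the angle at the corner, and a scalene one has no symmetry. -/
lemma false_of_corner {K L : Set ℂ} (H : AllPlacements HasIsometricSymmetry K L) {m₁ m₂ m : ℝ}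
    (hK : TangentWedge K m₁ m₂) (hL : TangentWedge L m m) (hm : m₁ < m₂) : False := by
  set q₁ := √(1 + m₁ ^ 2)
  set q₂ := √(1 + m₂ ^ 2)
  have q₁pos : 0 < q₁ := by positivity
  have q₂pos : 0 < q₂ := by positivity
  have q₁sq : q₁ ^ 2 = 1 + m₁ ^ 2 := Real.sq_sqrt (by positivity)
  have q₂sq : q₂ ^ 2 = 1 + m₂ ^ 2 := Real.sq_sqrt (by positivity)
  set c := -(1 + m₁ * m₂) / (q₁ * q₂) with hc
  have hc1 : c < 1 := by
    rw [hc, div_lt_one (by positivity)]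
    refine lt_of_pow_lt_pow_left₀ 2 (by positivity) ?_
    rw [mul_pow, q₁sq, q₂sq]
    nlinarith [mul_pos (sub_pos.2 hm) (sub_pos.2 hm)]
  obtain ⟨κ, κ0, k1, k2, k3⟩ := exists_scalene_ratio hc1
  set Y : ℂ := ⟨-(1 / q₁), -(m₁ / q₁)⟩ with hY
  set Z : ℂ := ⟨κ / q₂, κ * m₂ / q₂⟩ with hZ
  have dY : dist 0 Y ^ 2 = 1 := by
    rw [dist_zero_left, norm_sq_eq]; simp only [hY]; field_simp; linarith
  have dZ : dist Z 0 ^ 2 = κ ^ 2 := by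
    rw [dist_zero_right, norm_sq_eq]; simp only [hZ]; field_simp; linarith
  have dYZ : dist Y Z ^ 2 = 1 + κ ^ 2 - 2 * κ * c := by
    have e : dist Y Z ^ 2 = dist 0 Y ^ 2 + dist Z 0 ^ 2 - 2 * (Y.re * Z.re + Y.im * Z.im) := by
      rw [dist_eq_norm, dist_zero_left, dist_zero_right, norm_sq_eq, norm_sq_eq, norm_sq_eq]
      simp only [Complex.sub_re, Complex.sub_im]; ring
    rw [e, dY, dZ]
    simp only [hY, hZ, hc]; field_simp; ring
  have hYZ : Y - Z ≠ 0 := by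
    intro h
    have := congrArg Complex.re h
    simp only [hY, hZ, Complex.sub_re, Complex.zero_re] at this
    have h1 : 0 < 1 / q₁ := by positivity
    have h2 : 0 < κ / q₂ := by positivity
    linarith
  have hcross : (Z * conj (Y - 0)).im = -(κ * (m₂ - m₁) / (q₁ * q₂)) := by
    simp only [hY, hZ, sub_zero, Complex.mul_im, Complex.conj_re, Complex.conj_im]; field_simp; ring
  set ρ : ℝ := ‖Y - Z‖ / ‖(⟨1, m⟩ : ℂ)‖ with hρ
  have hw : (⟨1, m⟩ : ℂ) ≠ 0 := fun h => by simpa using congrArg Complex.re h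
  have hρpos : 0 < ρ := div_pos (norm_pos_iff.2 hYZ) (norm_pos_iff.2 hw)
  set a : ℂ := ⟨1, m⟩ * ρ / (Y - Z) with ha
  have ha1 : ‖a‖ = 1 := by
    have h1 := norm_pos_iff.2 hYZ
    have h2 := norm_pos_iff.2 hw
    rw [ha, norm_div, norm_mul, Complex.norm_real, Real.norm_eq_abs, abs_of_pos hρpos, hρ]
    field_simp
  -- in barycentric coordinates, the half-plane bounded by the line `YZ` is `β + γ ≤ 1`
  have hside : ∀ β γ : ℝ, (a * (β * Y + γ * Z) + -(a * Z)).im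
      - m * (a * (β * Y + γ * Z) + -(a * Z)).re
      = (1 - β - γ) * (ρ * (1 + m ^ 2) * (κ * (m₂ - m₁) / (q₁ * q₂)) / Complex.normSq (Y - Z)) := by
    intro β γ
    have e : a * (β * Y + γ * Z) + -(a * Z)
        = ⟨1, m⟩ * ρ * (β + (β + γ - 1) * (Z / (Y - Z))) := by
      rw [ha]; field_simp; ring
    have e2 : (Z / (Y - Z)).im = -(κ * (m₂ - m₁) / (q₁ * q₂)) / Complex.normSq (Y - Z) := by
      rw [← hcross]
      simp only [Complex.div_im, Complex.mul_im, Complex.conj_re, Complex.conj_im, sub_zero,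
        Complex.sub_re, Complex.sub_im]
      ring
    rw [e]
    have e3 : ∀ w : ℂ, (⟨1, m⟩ * (ρ : ℂ) * w).im - m * (⟨1, m⟩ * (ρ : ℂ) * w).re
        = ρ * (1 + m ^ 2) * w.im := by
      intro w
      simp only [Complex.mul_re, Complex.mul_im, Complex.ofReal_re, Complex.ofReal_im]; ring
    rw [e3]
    have e4 : ((β : ℂ) + (β + γ - 1) * (Z / (Y - Z))).im = (β + γ - 1) * (Z / (Y - Z)).im := by
      have : ((β : ℂ) + γ - 1) = ((β + γ - 1 : ℝ) : ℂ) := by push_cast; ring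
      rw [this, Complex.add_im, Complex.ofReal_im, zero_add, Complex.im_ofReal_mul]
    rw [e4, e2]; ring
  have hconst : 0 < ρ * (1 + m ^ 2) * (κ * (m₂ - m₁) / (q₁ * q₂)) / Complex.normSq (Y - Z) := by
    have h1 : 0 < m₂ - m₁ := sub_pos.2 hm
    have h2 : 0 < Complex.normSq (Y - Z) := Complex.normSq_pos.2 hYZ
    positivity
  have hcoord1 : ∀ β γ : ℝ, (β * Y + γ * Z : ℂ).im - m₁ * (β * Y + γ * Z : ℂ).re
      = γ * (κ * (m₂ - m₁) / q₂) := by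
    intro β γ
    simp only [hY, hZ, Complex.add_re, Complex.add_im, Complex.re_ofReal_mul,
      Complex.im_ofReal_mul]
    field_simp; ring
  have hcoord2 : ∀ β γ : ℝ, (β * Y + γ * Z : ℂ).im - m₂ * (β * Y + γ * Z : ℂ).re
      = β * ((m₂ - m₁) / q₁) := by
    intro β γ
    simp only [hY, hZ, Complex.add_re, Complex.add_im, Complex.re_ofReal_mul,
      Complex.im_ofReal_mul]
    field_simp; ring
  have hd1 : 0 < κ * (m₂ - m₁) / q₂ := div_pos (mul_pos κ0 (sub_pos.2 hm)) q₂pos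
  have hd2 : 0 < (m₂ - m₁) / q₁ := div_pos (sub_pos.2 hm) q₁pos
  have hspan : ∀ z : ℂ, ∃ β γ : ℝ, z = β * Y + γ * Z := by
    intro z
    have h1 : m₂ - m₁ ≠ 0 := (sub_pos.2 hm).ne'
    refine ⟨(z.im - m₂ * z.re) / (m₂ - m₁) * q₁, (z.im - m₁ * z.re) / (m₂ - m₁) * q₂ / κ, ?_⟩
    apply Complex.ext
    · simp only [hY, hZ, Complex.add_re, Complex.re_ofReal_mul]; field_simp; ring
    · simp only [hY, hZ, Complex.add_im, Complex.im_ofReal_mul]; field_simp; ring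
  set S : ℕ → Set ℂ := fun n => placed 1 0 K ∩ placed a (-(a * Z) / ((n + 1 : ℝ) : ℂ)) L with hS
  have hNne : ∀ n : ℕ, ((n + 1 : ℝ) : ℂ) ≠ 0 := fun n => by
    exact_mod_cast (by positivity : (0 : ℝ) < n + 1).ne'
  have hmemS : ∀ (n : ℕ) (z : ℂ), z / ((n + 1 : ℝ) : ℂ) ∈ S n ↔ z / ((n + 1 : ℝ) : ℂ) ∈ K ∧
      (a * z + -(a * Z)) / ((n + 1 : ℝ) : ℂ) ∈ L := by
    intro n z
    have h1 := hNne n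
    rw [hS]
    simp only [placed_one_zero, mem_inter_iff, mem_placed]
    rw [show a * (z / ((n + 1 : ℝ) : ℂ)) + -(a * Z) / ((n + 1 : ℝ) : ℂ)
      = (a * z + -(a * Z)) / ((n + 1 : ℝ) : ℂ) by field_simp]
  have hevI : ∀ z ∈ openTriangle 0 Y Z, ∀ᶠ n : ℕ in atTop, z / ((n + 1 : ℝ) : ℂ) ∈ interior K ∧
      (a * z + -(a * Z)) / ((n + 1 : ℝ) : ℂ) ∈ interior L := by
    rintro z ⟨α, β, γ, p1, p2, p3, p4, rfl⟩
    rw [mul_zero, zero_add]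
    have u1 := hcoord1 β γ
    have u2 := hcoord2 β γ
    have u3 := hside β γ
    have v1 := mul_pos p3 hd1
    have v2 := mul_pos p2 hd2
    have v3 := mul_pos (by linarith : 0 < 1 - β - γ) hconst
    exact (hK.blowup _ (by linarith) (by linarith)).and
      (hL.blowup _ (by linarith) (by linarith))
  refine false_of_exhaustion (P := 0) (Q := Y) (R := Z)
    (C := fun n => {z | z / ((n + 1 : ℝ) : ℂ) ∈ S n})
    ?_ ?_ ?_ ?_ ?_ ?_ ?_
  · intro h; rw [h, dYZ] at dY; exact k2 dY
  · intro h; rw [h, dZ] at dYZ; exact k3 dYZ.symm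
  · intro h; rw [h, dY] at dZ; exact k1 dZ.symm
  · rw [sub_zero, hcross, neg_ne_zero]
    exact (div_pos (mul_pos κ0 (sub_pos.2 hm)) (mul_pos q₁pos q₂pos)).ne'
  · intro n z hz
    obtain ⟨hzK, hzL⟩ := (hmemS n z).1 hz
    have hn0 : (0 : ℝ) < n + 1 := by positivity
    obtain ⟨t1, t2⟩ := hK.support _ hzK
    obtain ⟨t3, -⟩ := hL.support _ hzL
    rw [Complex.div_ofReal_re, Complex.div_ofReal_im, ← mul_div_assoc,
      div_le_div_iff_of_pos_right hn0] at t1 t2 t3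
    obtain ⟨β, γ, rfl⟩ := hspan z
    have u1 := hcoord1 β γ
    have u2 := hcoord2 β γ
    have u3 := hside β γ
    refine ⟨1 - β - γ, β, γ, ?_, ?_, ?_, by ring, by ring⟩
    · by_contra hcon
      have := mul_neg_of_neg_of_pos (not_le.1 hcon) hconst
      linarith
    · by_contra hcon
      have := mul_neg_of_neg_of_pos (not_le.1 hcon) hd2
      linarith
    · by_contra hcon
      have := mul_neg_of_neg_of_pos (not_le.1 hcon) hd1
      linarith
  · intro z hz
    filter_upwards [hevI z hz] with n hn
    exact (hmemS n z).2 ⟨interior_subset hn.1, interior_subset hn.2⟩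
  · have hGo : ((1 / 3 : ℝ) * 0 + (1 / 3 : ℝ) * Y + (1 / 3 : ℝ) * Z : ℂ) ∈ openTriangle 0 Y Z :=
      ⟨1 / 3, 1 / 3, 1 / 3, by norm_num, by norm_num, by norm_num, by norm_num, rfl⟩
    filter_upwards [hevI _ hGo] with n hn
    refine (H 1 0 a _ (by simp) ha1
      ⟨((1 / 3 : ℝ) * 0 + (1 / 3 : ℝ) * Y + (1 / 3 : ℝ) * Z : ℂ) / ((n + 1 : ℝ) : ℂ), ?_⟩).dilate
      (hNne n) (Complex.conj_ofReal _)
    · rw [interior_inter, interior_placed (by simp), interior_placed ha1]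
      refine ⟨by simpa [mem_placed] using hn.1, ?_⟩
      have h1 := hNne n
      rw [mem_placed]
      convert hn.2 using 1
      field_simp

/-! ### Smoothness of the boundary -/

/-- A closed convex set with interior points, different from the whole plane. -/
structure IsProperConvex (K : Set ℂ) : Prop where
  isClosed : IsClosed K
  convex : Convex ℝ K
  interior_nonempty : (interior K).Nonempty
  ne_univ : K ≠ univ

lemma IsProperConvex.frontier_nonempty {K : Set ℂ} (hK : IsProperConvex K) :
    (frontier K).Nonempty :=
  nonempty_frontier_iff.2 ⟨hK.interior_nonempty.mono interior_subset, hK.ne_univ⟩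

lemma GraphChart.exists_differentiableAt {K : Set ℂ} {r h : ℝ} {f : ℝ → ℝ}
    (c : GraphChart K r h f) : ∃ x ∈ Ioo (-r) r, DifferentiableAt ℝ f x := by
  obtain ⟨C, t, ht, hL⟩ := c.convexOn.locallyLipschitzOn isOpen_Ioo c.zero_mem
  rw [isOpen_Ioo.nhdsWithin_eq c.zero_mem] at ht
  have hae := hL.ae_differentiableWithinAt_of_mem_of_real (μ := MeasureTheory.volume)
  have hd := MeasureTheory.Measure.dense_of_ae hae
  obtain ⟨x, hx1, hx2⟩ := hd.inter_nhds_nonempty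
    (inter_mem (interior_mem_nhds.2 ht) (isOpen_Ioo.mem_nhds c.zero_mem))
  exact ⟨x, hx2.2, (hx1 (interior_subset hx2.1)).differentiableAt
    (mem_interior_iff_mem_nhds.1 hx2.1)⟩

lemma exists_placed_halfPlane_wedge {L : Set ℂ} (hL : IsProperConvex L) :
    ∃ a b m, ‖a‖ = 1 ∧ TangentWedge (placed a b L) m m := by
  obtain ⟨p, hp⟩ := hL.frontier_nonempty
  obtain ⟨a, r, h, f, ha, c, -⟩ :=
    exists_graphChart_of_mem_frontier hL.isClosed hL.convex hL.interior_nonempty hp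
  obtain ⟨x, hx, hd⟩ := c.exists_differentiableAt
  have hderiv : HasDerivAt (fun y => f (x + y) - f x) (deriv f x) 0 := by
    have h1 : HasDerivAt f (deriv f x) (x + 0) := by simpa using hd.hasDerivAt
    exact (h1.comp_const_add x 0).sub_const _
  have hw := (c.shift hx).tangentWedge (convex_placed (convex_placed hL.convex)) (by simp)
    hderiv.hasDerivWithinAt hderiv.hasDerivWithinAt
  rw [placed_placed] at hw
  exact ⟨_, _, _, by simpa using ha, hw⟩

/-- If all intersections of copies of `K` and `L` have non-trivial symmetries, then the boundary
of `K` is differentiable. -/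
lemma GraphChart.differentiableAt {K L : Set ℂ} (H : AllPlacements HasIsometricSymmetry K L)
    (hK : Convex ℝ K) (hL : IsProperConvex L) {r h : ℝ} {f : ℝ → ℝ} (c : GraphChart K r h f)
    {x : ℝ} (hx : x ∈ Ioo (-r) r) : DifferentiableAt ℝ f x := by
  have hint : x ∈ interior (Ioo (-r) r) := by rwa [interior_Ioo]
  have h1 := c.convexOn.hasDerivWithinAt_leftDeriv_of_mem_interior hint
  have h2 := c.convexOn.hasDerivWithinAt_rightDeriv_of_mem_interior hint
  have hle := c.convexOn.leftDeriv_le_rightDeriv_of_mem_interior hint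
  rcases hle.eq_or_lt with heq | hlt
  · rw [← heq] at h2
    have h3 := h1.Iic_of_Iio.union h2.Ici_of_Ioi
    rw [Iic_union_Ici, hasDerivWithinAt_univ] at h3
    exact h3.differentiableAt
  · exfalso
    obtain ⟨a, b, m, ha, hw⟩ := exists_placed_halfPlane_wedge hL
    have hs : ∀ {s t : Set ℝ} {m : ℝ}, HasDerivWithinAt f m s x → (∀ y ∈ t, x + y ∈ s) →
        HasDerivWithinAt (fun y => f (x + y) - f x) m t 0 := by
      intro s t m hd hst
      have hd' : HasDerivWithinAt f m s (x + 0) := by simpa using hd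
      have := hd'.scomp (0 : ℝ) ((hasDerivWithinAt_id (0 : ℝ) t).const_add x) hst
      simpa using this.sub_const (f x)
    have hwK := (c.shift hx).tangentWedge (convex_placed hK) (by simp)
      (hs h1 fun y hy => by simpa using hy) (hs h2 fun y hy => by simpa using hy)
    exact false_of_corner (H.placed (by simp) ha) hwK hw hlt

lemma continuousOn_deriv_of_convexOn {f : ℝ → ℝ} {s : Set ℝ} (hs : IsOpen s)
    (hf : ConvexOn ℝ s f) (hd : ∀ x ∈ s, DifferentiableAt ℝ f x) : ContinuousOn (deriv f) s := by
  have hmono : MonotoneOn (deriv f) s := hf.monotoneOn_deriv hd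
  have hord : ∀ {a b : ℝ}, a ∈ s → b ∈ s → Icc a b ⊆ s := fun ha hb =>
    hf.1.ordConnected.out ha hb
  have hw : ∀ {a b : ℝ}, a ∈ s → b ∈ s → ∀ x ∈ Icc a b,
      HasDerivWithinAt f (deriv f x) (Icc a b) x := fun ha hb x hx =>
    (hd x (hord ha hb hx)).hasDerivAt.hasDerivWithinAt
  intro x hx
  refine ContinuousAt.continuousWithinAt ?_
  obtain ⟨ε, hε, hball⟩ := Metric.isOpen_iff.1 hs x hx
  have hl : x - ε / 2 ∈ s := hball (by simp [abs_of_pos hε, hε])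
  have hr : x + ε / 2 ∈ s := hball (by simp [abs_of_pos hε, hε])
  rw [ContinuousAt, tendsto_order]
  constructor
  · intro b hb
    have : ∃ c ∈ s, c < x ∧ b < deriv f c := by
      rcases lt_or_ge b (deriv f (x - ε / 2)) with h | h
      · exact ⟨_, hl, by linarith, h⟩
      · obtain ⟨m, hm1, hm2⟩ := exists_between hb
        obtain ⟨c, hc, hcm⟩ := exists_hasDerivWithinAt_eq_of_gt_of_lt (by linarith) (hw hl hx)
          (h.trans_lt hm1) hm2
        exact ⟨c, hord hl hx (Ioo_subset_Icc_self hc), hc.2, by rwa [hcm]⟩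
    obtain ⟨c, hcs, hcx, hbc⟩ := this
    filter_upwards [lt_mem_nhds hcx, hs.mem_nhds hx] with y hy hys
    exact hbc.trans_le (hmono hcs hys hy.le)
  · intro b hb
    have : ∃ c ∈ s, x < c ∧ deriv f c < b := by
      rcases lt_or_ge (deriv f (x + ε / 2)) b with h | h
      · exact ⟨_, hr, by linarith, h⟩
      · obtain ⟨m, hm1, hm2⟩ := exists_between hb
        obtain ⟨c, hc, hcm⟩ := exists_hasDerivWithinAt_eq_of_gt_of_lt (by linarith) (hw hx hr)
          hm1 (hm2.trans_le h)
        exact ⟨c, hord hx hr (Ioo_subset_Icc_self hc), hc.1, by rwa [hcm]⟩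
    obtain ⟨c, hcs, hcx, hbc⟩ := this
    filter_upwards [gt_mem_nhds hcx, hs.mem_nhds hx] with y hy hys
    exact (hmono hys hcs hy.le).trans_lt hbc

/-- A chart whose function is continuously differentiable, with vanishing value and slope at the
origin and with small slopes throughout. -/
structure SmoothChart (K : Set ℂ) (r h : ℝ) (f f' : ℝ → ℝ) : Prop extends GraphChart K r h f where
  zero : f 0 = 0
  deriv_zero : f' 0 = 0
  hasDerivAt : ∀ x ∈ Ioo (-r) r, HasDerivAt f (f' x) x
  continuousOn_deriv : ContinuousOn f' (Ioo (-r) r)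
  small : ∀ x ∈ Ioo (-r) r, |f' x| ≤ 1 / 10
  room : 4 * r ≤ h

lemma SmoothChart.restrict {K : Set ℂ} {r h : ℝ} {f f' : ℝ → ℝ} (c : SmoothChart K r h f f')
    {s : ℝ} (hs : 0 < s) (hsr : s ≤ r) : SmoothChart K s h f f' := by
  have hsub : Ioo (-s) s ⊆ Ioo (-r) r := Ioo_subset_Ioo (by linarith) hsr
  exact ⟨c.toGraphChart.restrict hs hsr, c.zero, c.deriv_zero, fun x hx => c.hasDerivAt x (hsub hx),
    c.continuousOn_deriv.mono hsub, fun x hx => c.small x (hsub hx), by linarith [c.room]⟩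

/-- Around each boundary point there is a smooth chart, with the real axis along the tangent. -/
lemma exists_smoothChart {K L : Set ℂ} (H : AllPlacements HasIsometricSymmetry K L)
    (hK : IsProperConvex K) (hL : IsProperConvex L) {p : ℂ} (hp : p ∈ frontier K) :
    ∃ a r h f f', ‖a‖ = 1 ∧ SmoothChart (placed a p K) r h f f' := by
  obtain ⟨a, r, h, f, ha, c, hf0⟩ :=
    exists_graphChart_of_mem_frontier hK.isClosed hK.convex hK.interior_nonempty hp
  have hd :=
    (c.differentiableAt (H.placed_left ha) (convex_placed hK.convex) hL c.zero_mem).hasDerivAt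
  have hw := c.tangentWedge (convex_placed hK.convex) hf0 hd.hasDerivWithinAt hd.hasDerivWithinAt
  set m := deriv f 0
  set w : ℂ := ⟨1, m⟩ with hwdef
  have hw0 : w ≠ 0 := fun h => by simpa [hwdef] using congrArg Complex.re h
  have hwp : 0 < ‖w‖ := norm_pos_iff.2 hw0
  have hwn : ‖w‖ ^ 2 = 1 + m ^ 2 := by rw [norm_sq_eq]; simp [hwdef]
  set e : ℂ := w / ‖w‖ with he
  have he1 : ‖e‖ = 1 := by simp [he, hw0]
  have him : ∀ z : ℂ, (e * z).im - m * (e * z).re = ‖w‖ * z.im := by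
    intro z
    have e1 : e = ⟨1 / ‖w‖, m / ‖w‖⟩ := by
      apply Complex.ext
      · rw [he, Complex.div_ofReal_re]
      · rw [he, Complex.div_ofReal_im]
    rw [e1]
    simp only [Complex.mul_re, Complex.mul_im]
    field_simp
    linear_combination (-z.im) * hwn
  have hcl := isClosed_placed (a := e) (b := 0) (isClosed_placed (a := a) (b := p) hK.isClosed)
  have hcv := convex_placed (a := e) (b := 0) (convex_placed (a := a) (b := p) hK.convex)
  have hIpos : m * (e * Complex.I).re < (e * Complex.I).im := by
    have := him Complex.I
    rw [Complex.I_im, mul_one] at this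
    linarith
  have hIw := hw.blowup (e * Complex.I) hIpos hIpos
  obtain ⟨n, hn⟩ := hIw.exists
  have hn0 : (0 : ℝ) < n + 1 := by positivity
  have hint : (⟨0, 1 / (n + 1 : ℝ)⟩ : ℂ) ∈ interior (placed e 0 (placed a p K)) := by
    rw [interior_placed he1, mem_placed]
    convert hn using 1
    have : (⟨0, 1 / (n + 1 : ℝ)⟩ : ℂ) = Complex.I / ((n + 1 : ℝ) : ℂ) := by
      apply Complex.ext
      · rw [Complex.div_ofReal_re]; simp
      · rw [Complex.div_ofReal_im]; simp
    rw [this]; ring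
  have hsupp : ∀ z ∈ placed e 0 (placed a p K), 0 ≤ z.im := by
    intro z hz
    rw [mem_placed, add_zero] at hz
    have h1 := (hw.support _ hz).1
    have h2 := him z
    by_contra hcon
    have := mul_neg_of_pos_of_neg hwp (not_le.1 hcon)
    linarith
  obtain ⟨s, g, cg, hg0⟩ := exists_graphChart hcl hcv (m := 0)
    (fun z hz => by rw [zero_mul]; exact hsupp z hz)
    (by rw [mem_placed, mul_zero, add_zero]
        have := c.mem c.zero_mem
        rw [hf0] at this
        exact this) hint
  rw [placed_placed] at cg hcv hsupp
  have hdg : ∀ x ∈ Ioo (-s) s, DifferentiableAt ℝ g x := fun x hx =>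
    cg.differentiableAt (H.placed_left (by simp [ha, he1])) hcv hL hx
  have hcont := continuousOn_deriv_of_convexOn isOpen_Ioo cg.convexOn hdg
  have hg'0 : deriv g 0 = 0 := by
    refine IsLocalMin.deriv_eq_zero ?_
    filter_upwards [isOpen_Ioo.mem_nhds cg.zero_mem] with x hx
    rw [hg0]
    exact hsupp _ (cg.mem hx)
  have hsmall : ∀ᶠ x in 𝓝 (0 : ℝ), |deriv g x| < 1 / 10 := by
    have h1 := (hcont.continuousAt (isOpen_Ioo.mem_nhds cg.zero_mem)).abs
    refine h1.eventually_lt continuousAt_const ?_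
    rw [hg'0]; norm_num
  obtain ⟨ε, hε, hb⟩ := Metric.eventually_nhds_iff.1 hsmall
  set t := min (min s ε) (1 / (n + 1 : ℝ) / 4) with ht
  have ht0 : 0 < t := lt_min (lt_min cg.pos hε) (by positivity)
  have hts : t ≤ s := (min_le_left _ _).trans (min_le_left _ _)
  have htε : t ≤ ε := (min_le_left _ _).trans (min_le_right _ _)
  have hsub : Ioo (-t) t ⊆ Ioo (-s) s := Ioo_subset_Ioo (by linarith) hts
  refine ⟨a * e, t, 1 / (n + 1 : ℝ), g, deriv g, by simp [ha, he1], ?_, hg0, hg'0,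
    fun x hx => (hdg x (hsub hx)).hasDerivAt, hcont.mono hsub, fun x hx => (hb ?_).le, ?_⟩
  · have := cg.restrict ht0 hts
    simpa only [mul_zero, zero_add] using this
  · rw [Real.dist_0_eq_abs, abs_lt]
    exact ⟨by linarith [hx.1], by linarith [hx.2]⟩
  · have := min_le_right (min s ε) (1 / (n + 1 : ℝ) / 4)
    rw [← ht] at this
    linarith

/-! ### Lenses -/

/-- `K` meets the lower half-plane only in a flat cap over the chord `[0, d]` of the real axis, and
contains a flat isosceles triangle above this chord. -/
structure FlatCap (K : Set ℂ) (d : ℝ) : Prop where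
  outer : ∀ z ∈ K, z.im < 0 → -z.im ≤ z.re / 2 ∧ -z.im ≤ (d - z.re) / 2
  inner : ∀ z : ℂ, 0 ≤ z.im → z.im ≤ z.re / 2 → z.im ≤ (d - z.re) / 2 → z ∈ K

lemma le_of_forall_convexComb_le {x s d : ℝ} (h : ∀ t ∈ Ioo (0 : ℝ) 1, (1 - t) * x + t * s ≤ d) :
    x ≤ d := by
  have hc : Continuous (fun t : ℝ => (1 - t) * x + t * s) := by fun_prop
  have ht := (hc.tendsto 0).mono_left (nhdsWithin_le_nhds (s := Ioi 0))
  simp only [sub_zero, one_mul, zero_mul, add_zero] at ht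
  refine le_of_tendsto ht ?_
  filter_upwards [Ioo_mem_nhdsGT (show (0 : ℝ) < 1 by norm_num)] with t ht'
  exact h t ht'

lemma FlatCap.real_mem {K : Set ℂ} {d : ℝ} (hK : Convex ℝ K) (c : FlatCap K d) {z₀ : ℂ}
    (hz₀ : z₀ ∈ K) (hneg : z₀.im < 0) {z : ℂ} (hz : z ∈ K) (hz0 : z.im = 0) :
    0 ≤ z.re ∧ z.re ≤ d := by
  have key : ∀ t ∈ Ioo (0 : ℝ) 1, 0 ≤ (1 - t) * z.re + t * z₀.re ∧
      (1 - t) * z.re + t * z₀.re ≤ d := by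
    intro t ht
    have hm := hK hz hz₀ (a := 1 - t) (b := t) (by linarith [ht.2]) ht.1.le (by ring)
    have him : ((1 - t) • z + t • z₀).im = t * z₀.im := by simp [hz0]
    have hre : ((1 - t) • z + t • z₀).re = (1 - t) * z.re + t * z₀.re := by simp
    have hn : t * z₀.im < 0 := mul_neg_of_pos_of_neg ht.1 hneg
    have := c.outer _ hm (by rw [him]; exact hn)
    rw [him, hre] at this
    constructor <;> linarith [this.1, this.2]
  refine ⟨?_, le_of_forall_convexComb_le fun t ht => (key t ht).2⟩
  have := le_of_forall_convexComb_le (x := -z.re) (s := -z₀.re) (d := 0)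
    fun t ht => by linarith [(key t ht).1]
  linarith

lemma _root_.Convex.combo_three_mem {S : Set ℂ} (hS : Convex ℝ S) {x y z : ℂ} (hx : x ∈ S)
    (hy : y ∈ S) (hz : z ∈ S) {α β γ : ℝ} (hα : 0 ≤ α) (hβ : 0 ≤ β) (hγ : 0 ≤ γ)
    (h : α + β + γ = 1) : α * x + β * y + γ * z ∈ S := by
  have := hS.sum_mem (t := Finset.univ) (w := ![α, β, γ]) (z := ![x, y, z])
    (by intro i _; fin_cases i <;> simpa)
    (by simpa [Fin.sum_univ_three] using h)
    (by intro i _; fin_cases i <;> simpa)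
  simpa [Fin.sum_univ_three] using this

lemma interior_nonempty_of_triangle {S : Set ℂ} (hS : Convex ℝ S) {d : ℝ} (hd : 0 < d)
    (h0 : (0 : ℂ) ∈ S) (h1 : (d : ℂ) ∈ S) {z₀ : ℂ} (hz₀ : z₀ ∈ S) (him : z₀.im ≠ 0) :
    (interior S).Nonempty := by
  set G : ℂ := ⟨(d + z₀.re) / 3, z₀.im / 3⟩ with hG
  refine ⟨G, mem_interior_iff_mem_nhds.2 ?_⟩
  have c1 : Continuous (fun w : ℂ => w.im / z₀.im) := by fun_prop
  have c2 : Continuous (fun w : ℂ => (w.re - w.im / z₀.im * z₀.re) / d) := by fun_prop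
  have c3 : Continuous (fun w : ℂ => 1 - (w.re - w.im / z₀.im * z₀.re) / d - w.im / z₀.im) := by
    fun_prop
  have e1 : ∀ᶠ w in 𝓝 G, 0 < w.im / z₀.im :=
    continuousAt_const.eventually_lt c1.continuousAt (by simp only [hG]; field_simp; norm_num)
  have e2 : ∀ᶠ w in 𝓝 G, 0 < (w.re - w.im / z₀.im * z₀.re) / d :=
    continuousAt_const.eventually_lt c2.continuousAt (by
      have : (G.re - G.im / z₀.im * z₀.re) / d = 1 / 3 := by simp only [hG]; field_simp; ring
      rw [this]; norm_num)
  have e3 : ∀ᶠ w in 𝓝 G, 0 < 1 - (w.re - w.im / z₀.im * z₀.re) / d - w.im / z₀.im :=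
    continuousAt_const.eventually_lt c3.continuousAt (by
      have : 1 - (G.re - G.im / z₀.im * z₀.re) / d - G.im / z₀.im = 1 / 3 := by
        simp only [hG]; field_simp; ring
      rw [this]; norm_num)
  filter_upwards [e1, e2, e3] with w a1 a2 a3
  convert hS.combo_three_mem h0 h1 hz₀ a3.le a2.le a1.le (by ring) using 1
  apply Complex.ext
  · simp only [Complex.add_re, Complex.re_ofReal_mul, Complex.ofReal_re, Complex.zero_re]
    field_simp; ring
  · simp only [Complex.add_im, Complex.im_ofReal_mul, Complex.ofReal_im, Complex.zero_im]
    field_simp; ring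

/-- Two points at distance `d` in the disc with diameter `[0, d]`, on whose circle only the end
points are allowed, are these end points. -/
lemma eq_endpoints_of_dist_eq {d : ℝ} {X Y : ℂ}
    (hX : X.re * (X.re - d) + X.im ^ 2 < 0 ∨ X = 0 ∨ X = d)
    (hY : Y.re * (Y.re - d) + Y.im ^ 2 < 0 ∨ Y = 0 ∨ Y = d) (hXY : dist X Y = d) :
    (X = 0 ∧ Y = d) ∨ (X = d ∧ Y = 0) := by
  have hX' : X.re * (X.re - d) + X.im ^ 2 ≤ 0 := by
    rcases hX with h | h | h
    · exact h.le
    · simp [h]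
    · simp [h]
  have hY' : Y.re * (Y.re - d) + Y.im ^ 2 ≤ 0 := by
    rcases hY with h | h | h
    · exact h.le
    · simp [h]
    · simp [h]
  have hsq : (X.re - Y.re) ^ 2 + (X.im - Y.im) ^ 2 = d ^ 2 := by
    rw [← hXY, dist_eq_norm, norm_sq_eq, Complex.sub_re, Complex.sub_im]
  have hpar : (X.re + Y.re - d) ^ 2 + (X.im + Y.im) ^ 2
      = 2 * (X.re * (X.re - d) + X.im ^ 2) + 2 * (Y.re * (Y.re - d) + Y.im ^ 2) := by
    linear_combination (-1) * hsq
  have s1 := sq_nonneg (X.re + Y.re - d)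
  have s2 := sq_nonneg (X.im + Y.im)
  have hX0 := hX.resolve_left (by intro h; linarith)
  have hre : X.re + Y.re - d = 0 := by
    have : (X.re + Y.re - d) ^ 2 = 0 := by linarith
    exact pow_eq_zero_iff (by norm_num) |>.1 this
  have him : X.im + Y.im = 0 := by
    have : (X.im + Y.im) ^ 2 = 0 := by linarith
    exact pow_eq_zero_iff (by norm_num) |>.1 this
  rcases hX0 with rfl | rfl
  · left
    refine ⟨rfl, Complex.ext ?_ ?_⟩
    · simp at hre ⊢; linarith
    · simp at him ⊢; linarith
  · right
    refine ⟨rfl, Complex.ext ?_ ?_⟩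
    · simp at hre ⊢; linarith
    · simp at him ⊢; linarith

/-- Two flat caps over chords of the same length `d` are glued along the chord to a lens. Its
diameter is realised by the chord alone, so a symmetry of the lens is one of the three non-trivial
symmetries of the chord. Accordingly, the caps are congruent by a direct congruence, or
mirror images of each other, or each of them is symmetric to its own perpendicular bisector. -/
lemma lens_trichotomy {K L : Set ℂ} (H : AllPlacements HasIsometricSymmetry K L)
    (hK : Convex ℝ K) (hL : Convex ℝ L) {d : ℝ} (hd : 0 < d) (cK : FlatCap K d)
    (cL : FlatCap L d) :
    (∀ z : ℂ, z.im < 0 → (z ∈ L ↔ z ∈ K)) ∨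
    (∀ z : ℂ, z.im < 0 → (z ∈ L ↔ (d : ℂ) - conj z ∈ K)) ∨
    ((∀ z : ℂ, z.im < 0 → (z ∈ K ↔ (d : ℂ) - conj z ∈ K)) ∧
      ∀ z : ℂ, z.im < 0 → (z ∈ L ↔ (d : ℂ) - conj z ∈ L)) := by
  by_cases hflat : (∀ z ∈ K, 0 ≤ z.im) ∧ ∀ z ∈ L, 0 ≤ z.im
  · left
    intro z hz
    exact ⟨fun h => absurd (hflat.2 z h) (not_le.2 hz), fun h => absurd (hflat.1 z h) (not_le.2 hz)⟩
  set S : Set ℂ := placed 1 0 K ∩ placed (-1) d L with hS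
  have hmem : ∀ z, z ∈ S ↔ z ∈ K ∧ (d : ℂ) - z ∈ L := by
    intro z
    rw [hS, mem_inter_iff, placed_one_zero, mem_placed, show -1 * z + (d : ℂ) = d - z by ring]
  have hneg : ∀ z : ℂ, z.im < 0 → (z ∈ S ↔ z ∈ K) := by
    intro z hz
    rw [hmem]
    refine ⟨fun h => h.1, fun h => ⟨h, ?_⟩⟩
    obtain ⟨u1, u2⟩ := cK.outer z h hz
    apply cL.inner <;> simp <;> linarith
  have hpos : ∀ z : ℂ, 0 < z.im → (z ∈ S ↔ (d : ℂ) - z ∈ L) := by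
    intro z hz
    rw [hmem]
    refine ⟨fun h => h.2, fun h => ⟨?_, h⟩⟩
    obtain ⟨u1, u2⟩ := cL.outer _ h (by simpa using hz)
    simp only [Complex.sub_re, Complex.sub_im, Complex.ofReal_re, Complex.ofReal_im] at u1 u2
    apply cK.inner <;> linarith
  have h0 : (0 : ℂ) ∈ S := by
    rw [hmem]
    constructor
    · apply cK.inner <;> (simp; try linarith)
    · apply cL.inner <;> (simp; try linarith)
  have h1 : (d : ℂ) ∈ S := by
    rw [hmem]
    constructor
    · apply cK.inner <;> (simp; try linarith)
    · apply cL.inner <;> (simp; try linarith)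
  have hcvx : Convex ℝ S := (convex_placed hK).inter (convex_placed hL)
  have hint : (interior S).Nonempty := by
    rw [not_and_or] at hflat
    push Not at hflat
    rcases hflat with ⟨z, hz, hzi⟩ | ⟨z, hz, hzi⟩
    · exact interior_nonempty_of_triangle hcvx hd h0 h1 ((hneg z hzi).2 hz) hzi.ne
    · refine interior_nonempty_of_triangle hcvx hd h0 h1
        ((hpos ((d : ℂ) - z) (by simpa using hzi)).2 (by simpa using hz)) ?_
      simpa using hzi.ne
  have hreal : ∀ z ∈ S, z.im = 0 → 0 ≤ z.re ∧ z.re ≤ d := by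
    intro z hz hzi
    rw [not_and_or] at hflat
    push Not at hflat
    rcases hflat with ⟨w, hw, hwi⟩ | ⟨w, hw, hwi⟩
    · exact cK.real_mem hK hw hwi ((hmem z).1 hz).1 hzi
    · have := cL.real_mem hL hw hwi ((hmem z).1 hz).2 (by simpa using hzi)
      simp only [Complex.sub_re, Complex.ofReal_re] at this
      constructor <;> linarith [this.1, this.2]
  have hthales : ∀ z ∈ S, z.re * (z.re - d) + z.im ^ 2 < 0 ∨ z = 0 ∨ z = d := by
    intro z hz
    have hlt : ∀ x y : ℝ, 0 < y → y ≤ x / 2 → y ≤ (d - x) / 2 → x * (x - d) + y ^ 2 < 0 := by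
      intro x y hy h1 h2
      nlinarith [mul_nonneg (sub_nonneg.2 h1) (sub_nonneg.2 h2)]
    rcases lt_trichotomy z.im 0 with hi | hi | hi
    · left
      obtain ⟨u1, u2⟩ := cK.outer z ((hneg z hi).1 hz) hi
      have := hlt z.re (-z.im) (by linarith) u1 u2
      rwa [neg_sq] at this
    · obtain ⟨u1, u2⟩ := hreal z hz hi
      rcases u1.eq_or_lt with v1 | v1
      · exact Or.inr (Or.inl (Complex.ext v1.symm hi))
      rcases u2.eq_or_lt with v2 | v2
      · exact Or.inr (Or.inr (Complex.ext v2 hi))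
      · left
        rw [hi]
        nlinarith
    · left
      obtain ⟨u1, u2⟩ := cL.outer _ ((hpos z hi).1 hz) (by simpa using hi)
      simp only [Complex.sub_re, Complex.sub_im, Complex.ofReal_re, Complex.ofReal_im] at u1 u2
      exact hlt z.re z.im hi (by linarith) (by linarith)
  have hpair : ∀ {a b : ℂ} {τ : ℂ → ℂ}, ‖a‖ = 1 → Isometry τ → (∀ z, a * τ z + b ∈ S ↔ z ∈ S) →
      (a * τ 0 + b = 0 ∧ a * τ d + b = d) ∨ (a * τ 0 + b = d ∧ a * τ d + b = 0) := by
    intro a b τ ha hτ h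
    refine eq_endpoints_of_dist_eq (hthales _ ((h 0).2 h0)) (hthales _ ((h d).2 h1)) ?_
    rw [(isometry_mul_add ha b hτ).dist_eq]
    simp [hd.le]
  have hd0 : (d : ℂ) ≠ 0 := by exact_mod_cast hd.ne'
  rcases H 1 0 (-1) d (by simp) (by simp) hint with ⟨a, b, ha, hab, h⟩ | ⟨a, b, ha, h⟩
  · rcases hpair ha isometry_id h with ⟨e1, e2⟩ | ⟨e1, e2⟩
    · exfalso
      simp only [id, mul_zero, zero_add] at e1 e2
      rw [e1, add_zero] at e2
      have ha1 : a = 1 := mul_right_cancel₀ hd0 (by rw [e2, one_mul])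
      rcases hab with h' | h'
      · exact h' ha1
      · exact h' e1
    · simp only [id, mul_zero, zero_add] at e1 e2
      have ha1 : a = -1 := mul_right_cancel₀ hd0 (by linear_combination e2 - e1)
      left
      intro z hz
      rw [← hneg z hz, ← h z, ha1, e1, hpos _ (by simpa using hz)]
      rw [show (d : ℂ) - (-1 * z + d) = z by ring]
  · have hconj : Isometry (fun z : ℂ => conj z) := Complex.isometry_conj
    rcases hpair ha hconj h with ⟨e1, e2⟩ | ⟨e1, e2⟩
    · simp only [map_zero, mul_zero, zero_add, Complex.conj_ofReal] at e1 e2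
      rw [e1, add_zero] at e2
      have ha1 : a = 1 := mul_right_cancel₀ hd0 (by rw [e2, one_mul])
      right; left
      intro z hz
      have h3 := h ((d : ℂ) - conj z)
      rw [ha1, e1, add_zero, one_mul, map_sub, Complex.conj_conj, Complex.conj_ofReal,
        hneg ((d : ℂ) - conj z) (by simpa using hz), hpos _ (by simpa using hz)] at h3
      rw [← h3]
      simp
    · simp only [map_zero, mul_zero, zero_add, Complex.conj_ofReal] at e1 e2
      have ha1 : a = -1 := mul_right_cancel₀ hd0 (by linear_combination e2 - e1)
      right; right
      have h3 : ∀ z, (d : ℂ) - conj z ∈ S ↔ z ∈ S := by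
        intro z
        rw [← h z, ha1, e1, show -1 * conj z + (d : ℂ) = d - conj z by ring]
      refine ⟨fun z hz => ?_, fun z hz => ?_⟩
      · rw [← hneg z hz, ← h3 z, hneg _ (by simpa using hz)]
      · have h4 := h3 ((d : ℂ) - z)
        rw [hpos ((d : ℂ) - z) (by simpa using hz), hpos _ (by simpa using hz)] at h4
        rw [show (d : ℂ) - ((d : ℂ) - z) = z by ring] at h4
        rw [← h4, map_sub, Complex.conj_ofReal]
        ring_nf

/-- The caps of `K₁` and `K₂` over the chord `[0, d]` are equal, or mirror images of each other, or
both symmetric in the perpendicular bisector of the chord. -/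
def CapDichotomy (K₁ K₂ : Set ℂ) (d : ℝ) : Prop :=
  (∀ z : ℂ, z.im < 0 → (z ∈ K₂ ↔ z ∈ K₁)) ∨
    (∀ z : ℂ, z.im < 0 → (z ∈ K₂ ↔ (d : ℂ) - conj z ∈ K₁)) ∨
    ((∀ z : ℂ, z.im < 0 → (z ∈ K₁ ↔ (d : ℂ) - conj z ∈ K₁)) ∧
      ∀ z : ℂ, z.im < 0 → (z ∈ K₂ ↔ (d : ℂ) - conj z ∈ K₂))

/-- Two caps that are compared by `CapDichotomy` with a common third one are so with each other. -/
lemma CapDichotomy.of_common {K₁ K₂ L : Set ℂ} {d : ℝ} (h₁ : CapDichotomy K₁ L d)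
    (h₂ : CapDichotomy K₂ L d) : CapDichotomy K₁ K₂ d := by
  have hi : ∀ {z : ℂ}, z.im < 0 → ((d : ℂ) - conj z).im < 0 := fun {z} hz => by simpa using hz
  have hf : ∀ z : ℂ, (d : ℂ) - conj ((d : ℂ) - conj z) = z := fun z => by simp
  rcases h₁ with h₁ | h₁ | ⟨h₁, h₁'⟩ <;> rcases h₂ with h₂ | h₂ | ⟨h₂, h₂'⟩
  · exact Or.inl fun z hz => by rw [← h₂ z hz, h₁ z hz]
  · refine Or.inr (Or.inl fun z hz => ?_)
    rw [← h₁ _ (hi hz), h₂ _ (hi hz), hf]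
  · refine Or.inr (Or.inr ⟨fun z hz => ?_, h₂⟩)
    rw [← h₁ z hz, ← h₁ _ (hi hz), h₂' z hz]
  · refine Or.inr (Or.inl fun z hz => ?_)
    rw [← h₂ _ hz, h₁ z hz]
  · refine Or.inl fun z hz => ?_
    have e1 := h₁ _ (hi hz)
    have e2 := h₂ _ (hi hz)
    rw [hf] at e1 e2
    rw [← e1, ← e2]
  · refine Or.inr (Or.inr ⟨fun z hz => ?_, h₂⟩)
    have e1 := h₁ _ (hi hz)
    rw [hf] at e1
    rw [← e1, ← h₁ z hz, ← h₂' z hz]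
  · refine Or.inr (Or.inr ⟨h₁, fun z hz => ?_⟩)
    rw [← h₂ z hz, ← h₂ _ (hi hz), h₁' z hz]
  · refine Or.inr (Or.inr ⟨h₁, fun z hz => ?_⟩)
    have e2 := h₂ _ (hi hz)
    rw [hf] at e2
    rw [← e2, ← h₂ z hz, ← h₁' z hz]
  · exact Or.inr (Or.inr ⟨h₁, h₂⟩)

/-! ### Chords of smooth arcs -/

/-- The point of the graph of `f` over `x`. -/
def graphPoint (f : ℝ → ℝ) (x : ℝ) : ℂ := ⟨x, f x⟩

/-- The slope of the chord of the graph of `f` over `[s, t]`. -/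
noncomputable def chordSlope (f : ℝ → ℝ) (s t : ℝ) : ℝ := (f t - f s) / (t - s)

/-- The length of the chord of the graph of `f` over `[s, t]`, for `s ≤ t`. -/
noncomputable def chordLength (f : ℝ → ℝ) (s t : ℝ) : ℝ :=
  (t - s) * √(1 + chordSlope f s t ^ 2)

/-- The direction of the chord of the graph of `f` over `[s, t]`, for `s < t`. -/
noncomputable def chordDir (f : ℝ → ℝ) (s t : ℝ) : ℂ :=
  ⟨1 / √(1 + chordSlope f s t ^ 2), chordSlope f s t / √(1 + chordSlope f s t ^ 2)⟩

/-- The copy of `K` for which the chord of the graph of `f` over `[s, t]` lies on the real axis,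
starting at the origin. -/
noncomputable def alongChord (K : Set ℂ) (f : ℝ → ℝ) (s t : ℝ) : Set ℂ :=
  placed (chordDir f s t) (graphPoint f s) K

/-- The tangent of the angle between the chord over `[s, t]` and the tangent at `s`. -/
noncomputable def startSlope (f f' : ℝ → ℝ) (s t : ℝ) : ℝ :=
  (chordSlope f s t - f' s) / (1 + chordSlope f s t * f' s)

/-- The tangent of the angle between the chord over `[s, t]` and the tangent at `t`. -/
noncomputable def endSlope (f f' : ℝ → ℝ) (s t : ℝ) : ℝ :=
  (f' t - chordSlope f s t) / (1 + chordSlope f s t * f' t)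

lemma norm_chordDir (f : ℝ → ℝ) (s t : ℝ) : ‖chordDir f s t‖ = 1 := by
  have h : 0 < √(1 + chordSlope f s t ^ 2) := by positivity
  rw [← sq_eq_sq₀ (norm_nonneg _) zero_le_one, norm_sq_eq, chordDir]
  have := Real.sq_sqrt (show (0 : ℝ) ≤ 1 + chordSlope f s t ^ 2 by positivity)
  simp only
  field_simp
  rw [this]

lemma chordLength_pos (f : ℝ → ℝ) {s t : ℝ} (h : s < t) : 0 < chordLength f s t :=
  mul_pos (sub_pos.2 h) (by positivity)

lemma chordLength_sq (f : ℝ → ℝ) {s t : ℝ} (h : s < t) :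
    chordLength f s t ^ 2 = (t - s) ^ 2 + (f t - f s) ^ 2 := by
  have h1 : t - s ≠ 0 := (sub_pos.2 h).ne'
  rw [chordLength, mul_pow, Real.sq_sqrt (by positivity), chordSlope]
  field_simp

lemma chordLength_mul_chordDir (f : ℝ → ℝ) {s t : ℝ} (h : s < t) :
    chordDir f s t * chordLength f s t = graphPoint f t - graphPoint f s := by
  have h1 : t - s ≠ 0 := (sub_pos.2 h).ne'
  have h2 : 0 < √(1 + chordSlope f s t ^ 2) := by positivity
  apply Complex.ext
  · simp only [Complex.mul_re, chordDir, Complex.ofReal_re, Complex.ofReal_im, graphPoint,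
      Complex.sub_re, chordLength]
    field_simp; ring
  · simp only [Complex.mul_im, chordDir, Complex.ofReal_re, Complex.ofReal_im, graphPoint,
      Complex.sub_im, chordLength]
    have h3 : f t - f s = chordSlope f s t * (t - s) := by rw [chordSlope]; field_simp
    rw [h3]
    field_simp; ring

/-- `α` and `β` are the least slopes of lines through `0` and `d` bounding the part of `C` below
the real axis. -/
structure HasCapSlopes (C : Set ℂ) (d α β : ℝ) : Prop where
  nonneg_left : 0 ≤ α
  nonneg_right : 0 ≤ β
  bound_left : ∀ z ∈ C, z.im < 0 → -z.im ≤ α * z.re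
  bound_right : ∀ z ∈ C, z.im < 0 → -z.im ≤ β * (d - z.re)
  least_left : ∀ τ, 0 ≤ τ → (∀ z ∈ C, z.im < 0 → -z.im ≤ τ * z.re) → α ≤ τ
  least_right : ∀ τ, 0 ≤ τ → (∀ z ∈ C, z.im < 0 → -z.im ≤ τ * (d - z.re)) → β ≤ τ

namespace HasCapSlopes

variable {C₁ C₂ : Set ℂ} {d α₁ β₁ α₂ β₂ : ℝ}

lemma eq_of_cap_eq (h₁ : HasCapSlopes C₁ d α₁ β₁) (h₂ : HasCapSlopes C₂ d α₂ β₂)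
    (h : ∀ z : ℂ, z.im < 0 → (z ∈ C₂ ↔ z ∈ C₁)) : α₂ = α₁ ∧ β₂ = β₁ :=
  ⟨le_antisymm
    (h₂.least_left _ h₁.nonneg_left fun z hz hi => h₁.bound_left z ((h z hi).1 hz) hi)
    (h₁.least_left _ h₂.nonneg_left fun z hz hi => h₂.bound_left z ((h z hi).2 hz) hi),
  le_antisymm
    (h₂.least_right _ h₁.nonneg_right fun z hz hi => h₁.bound_right z ((h z hi).1 hz) hi)
    (h₁.least_right _ h₂.nonneg_right fun z hz hi => h₂.bound_right z ((h z hi).2 hz) hi)⟩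

lemma flip (h : HasCapSlopes C₁ d α₁ β₁) :
    HasCapSlopes {z | (d : ℂ) - conj z ∈ C₁} d β₁ α₁ := by
  refine ⟨h.nonneg_right, h.nonneg_left, fun z hz hi => ?_, fun z hz hi => ?_, fun τ hτ hb => ?_,
    fun τ hτ hb => ?_⟩
  · simpa using h.bound_right _ hz (by simpa using hi)
  · simpa using h.bound_left _ hz (by simpa using hi)
  · refine h.least_right τ hτ fun z hz hi => ?_
    simpa using hb ((d : ℂ) - conj z) (by simpa using hz) (by simpa using hi)
  · refine h.least_left τ hτ fun z hz hi => ?_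
    simpa using hb ((d : ℂ) - conj z) (by simpa using hz) (by simpa using hi)

lemma eq_of_cap_flip (h₁ : HasCapSlopes C₁ d α₁ β₁) (h₂ : HasCapSlopes C₂ d α₂ β₂)
    (h : ∀ z : ℂ, z.im < 0 → (z ∈ C₂ ↔ (d : ℂ) - conj z ∈ C₁)) : α₂ = β₁ ∧ β₂ = α₁ :=
  h₁.flip.eq_of_cap_eq h₂ h

end HasCapSlopes

namespace SmoothChart

variable {K : Set ℂ} {r h : ℝ} {f f' : ℝ → ℝ}

lemma abs_sub_le (c : SmoothChart K r h f f') {s t : ℝ} (hs : s ∈ Ioo (-r) r)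
    (ht : t ∈ Ioo (-r) r) : |f t - f s| ≤ 1 / 10 * |t - s| := by
  have := (convex_Ioo (-r) r).norm_image_sub_le_of_norm_hasDerivWithin_le
    (fun x hx => (c.hasDerivAt x hx).hasDerivWithinAt)
    (fun x hx => by rw [Real.norm_eq_abs]; exact c.small x hx) hs ht
  simpa only [Real.norm_eq_abs] using this

lemma abs_chordSlope_le (c : SmoothChart K r h f f') {s t : ℝ} (hs : s ∈ Ioo (-r) r)
    (ht : t ∈ Ioo (-r) r) (hst : s < t) : |chordSlope f s t| ≤ 1 / 10 := by
  have h1 : 0 < t - s := sub_pos.2 hst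
  have := c.abs_sub_le hs ht
  rw [chordSlope, abs_div, div_le_iff₀ (abs_pos.2 h1.ne')]
  exact this

lemma deriv_le_chordSlope (c : SmoothChart K r h f f') {s t : ℝ} (hs : s ∈ Ioo (-r) r)
    (ht : t ∈ Ioo (-r) r) (hst : s < t) : f' s ≤ chordSlope f s t := by
  have := c.convexOn.le_slope_of_hasDerivAt hs ht hst (c.hasDerivAt s hs)
  rwa [slope_def_field] at this

lemma chordSlope_le_deriv (c : SmoothChart K r h f f') {s t : ℝ} (hs : s ∈ Ioo (-r) r)
    (ht : t ∈ Ioo (-r) r) (hst : s < t) : chordSlope f s t ≤ f' t := by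
  have := c.convexOn.slope_le_of_hasDerivAt hs ht hst (c.hasDerivAt t ht)
  rwa [slope_def_field] at this

lemma support (c : SmoothChart K r h f f') (hK : Convex ℝ K) {x : ℝ} (hx : x ∈ Ioo (-r) r) {w : ℂ}
    (hw : w + graphPoint f x ∈ K) : f' x * w.re ≤ w.im := by
  have hd : HasDerivAt (fun y => f (x + y) - f x) (f' x) 0 := by
    have h1 : HasDerivAt f (f' x) (x + 0) := by simpa using c.hasDerivAt x hx
    exact (h1.comp_const_add x 0).sub_const _
  have := (c.shift hx).tangentWedge (convex_placed hK) (by simp) hd.hasDerivWithinAt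
    hd.hasDerivWithinAt
  exact (this.support w (by rw [mem_placed, one_mul]; exact hw)).1

lemma mul_small {x y : ℝ} (hx : |x| ≤ 1 / 10) (hy : |y| ≤ 1 / 10) : |x * y| ≤ 1 / 100 := by
  rw [abs_mul]
  calc |x| * |y| ≤ 1 / 10 * (1 / 10) := by gcongr
    _ = 1 / 100 := by norm_num

/-- The bounds on the cap coming from the tangents at the end points of the arc. -/
lemma cap_bounds (c : SmoothChart K r h f f') (hK : Convex ℝ K) {s t : ℝ} (hs : s ∈ Ioo (-r) r)
    (ht : t ∈ Ioo (-r) r) (hst : s < t) {z : ℂ} (hz : z ∈ alongChord K f s t) :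
    -z.im * (1 + chordSlope f s t * f' s) ≤ (chordSlope f s t - f' s) * z.re ∧
    -z.im * (1 + chordSlope f s t * f' t)
      ≤ (f' t - chordSlope f s t) * (chordLength f s t - z.re) := by
  have hq : 0 < √(1 + chordSlope f s t ^ 2) := by positivity
  have hre : ∀ w : ℂ, (chordDir f s t * w).re
      = (w.re - chordSlope f s t * w.im) / √(1 + chordSlope f s t ^ 2) := by
    intro w; simp only [Complex.mul_re, chordDir]; field_simp
  have him : ∀ w : ℂ, (chordDir f s t * w).im
      = (chordSlope f s t * w.re + w.im) / √(1 + chordSlope f s t ^ 2) := by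
    intro w; simp only [Complex.mul_im, chordDir]; field_simp; ring
  have h1 := c.support hK hs (w := chordDir f s t * z) hz
  have h2 := c.support hK ht (w := chordDir f s t * (z - chordLength f s t)) (by
    rw [mul_sub, chordLength_mul_chordDir f hst]
    have hz' : chordDir f s t * z + graphPoint f s ∈ K := hz
    convert hz' using 1
    ring)
  rw [hre, him, ← mul_div_assoc, div_le_div_iff_of_pos_right hq] at h1 h2
  simp only [Complex.sub_re, Complex.sub_im, Complex.ofReal_re, Complex.ofReal_im, sub_zero] at h2
  constructor <;> nlinarith

lemma flatCap (c : SmoothChart K r h f f') (hK : Convex ℝ K) {s t : ℝ} (hs : s ∈ Ioo (-r) r)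
    (ht : t ∈ Ioo (-r) r) (hst : s < t) : FlatCap (alongChord K f s t) (chordLength f s t) := by
  have hp := c.abs_chordSlope_le hs ht hst
  have hp' := abs_le.1 hp
  have hm := c.deriv_le_chordSlope hs ht hst
  have hn := c.chordSlope_le_deriv hs ht hst
  have hm' := abs_le.1 (c.small s hs)
  have hn' := abs_le.1 (c.small t ht)
  have hpm := abs_le.1 (mul_small hp (c.small s hs))
  have hpn := abs_le.1 (mul_small hp (c.small t ht))
  have hq : 0 < √(1 + chordSlope f s t ^ 2) := by positivity
  have hqsq := Real.sq_sqrt (show (0 : ℝ) ≤ 1 + chordSlope f s t ^ 2 by positivity)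
  constructor
  · intro z hz hi
    obtain ⟨b1, b2⟩ := c.cap_bounds hK hs ht hst hz
    have key : ∀ x y e k : ℝ, 0 < y → y * (1 + k) ≤ e * x → 0 ≤ e → e ≤ 1 / 5 → -(1 / 100) ≤ k →
        y ≤ x / 2 := by
      intro x y e k hy h1 he he' hk
      have hx : 0 < x := by
        by_contra hcon
        have : e * x ≤ 0 := mul_nonpos_of_nonneg_of_nonpos he (not_lt.1 hcon)
        nlinarith
      nlinarith
    exact ⟨key _ _ _ _ (by linarith) b1 (by linarith) (by linarith [hp'.2, hm'.1]) hpm.1,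
      key _ _ _ _ (by linarith) b2 (by linarith) (by linarith [hp'.1, hn'.2]) hpn.1⟩
  · intro z h0 h1 h2
    have hd : chordLength f s t = (t - s) * √(1 + chordSlope f s t ^ 2) := rfl
    rw [alongChord, mem_placed]
    set q := √(1 + chordSlope f s t ^ 2) with hqdef
    set p := chordSlope f s t with hpdef
    set w := chordDir f s t * z + graphPoint f s with hw
    have hre : w.re = s + (z.re - p * z.im) / q := by
      rw [hw]; simp only [Complex.add_re, Complex.mul_re, chordDir, graphPoint]
      rw [← hqdef, ← hpdef]; field_simp; ring
    have him : w.im = f s + (p * z.re + z.im) / q := by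
      rw [hw]; simp only [Complex.add_im, Complex.mul_im, chordDir, graphPoint]
      rw [← hqdef, ← hpdef]; field_simp; ring
    have hpy : |p * z.im| ≤ 1 / 10 * z.im := by
      rw [abs_mul, abs_of_nonneg h0]; gcongr
    have hpy' := abs_le.1 hpy
    have hre1 : s ≤ w.re := by
      rw [hre]
      have : 0 ≤ (z.re - p * z.im) / q := div_nonneg (by linarith [hpy'.2]) hq.le
      linarith
    have hre2 : w.re ≤ t := by
      have : (z.re - p * z.im) / q ≤ t - s := by
        rw [div_le_iff₀ hq, ← hd]
        linarith [hpy'.1]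
      linarith
    have hwI : w.re ∈ Ioo (-r) r := ⟨by linarith [hs.1], by linarith [ht.2]⟩
    have hq2 : q ≤ 2 := by
      rw [← sq_le_sq₀ hq.le (by norm_num), hqsq]; nlinarith
    have hq1 : 1 ≤ q := by
      rw [← sq_le_sq₀ (by norm_num) hq.le, hqsq]; nlinarith [sq_nonneg p]
    have hchord : f w.re ≤ f s + p * (w.re - s) := by
      rcases hre1.eq_or_lt with he | hl
      · rw [← he]; simp
      · have h3 := c.convexOn.secant_mono hs hwI ht hl.ne' hst.ne' hre2
        have h4 : (f w.re - f s) / (w.re - s) ≤ p := h3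
        rw [div_le_iff₀ (by linarith)] at h4
        linarith
    have hxd : p * z.re + z.im ≤ z.re * (3 / 5) := by nlinarith
    refine (c.mem_iff w hwI ?_).2 ?_
    · have hfs := c.abs_sub_le c.zero_mem hs
      rw [c.zero, sub_zero, sub_zero] at hfs
      have hs' : |s| ≤ r := (abs_lt.2 hs).le
      have hfs' := (le_abs_self (f s)).trans hfs
      have h5 : (p * z.re + z.im) / q ≤ 3 / 5 * (2 * r) := by
        rw [div_le_iff₀ hq]
        have : z.re ≤ (t - s) * q := by rw [← hd]; linarith
        have : (t - s) * q ≤ 2 * r * q := by gcongr; linarith [ht.2, hs.1]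
        linarith
      rw [him]
      linarith [c.room, c.pos]
    · refine hchord.trans ?_
      rw [him, hre, add_sub_cancel_left, add_le_add_iff_left, ← mul_div_assoc,
        div_le_div_iff_of_pos_right hq]
      nlinarith [sq_nonneg p]

lemma hasCapSlopes (c : SmoothChart K r h f f') (hK : Convex ℝ K) {s t : ℝ}
    (hs : s ∈ Ioo (-r) r) (ht : t ∈ Ioo (-r) r) (hst : s < t) :
    HasCapSlopes (alongChord K f s t) (chordLength f s t) (startSlope f f' s t)
      (endSlope f f' s t) := by
  have hp := c.abs_chordSlope_le hs ht hst
  have hm := c.deriv_le_chordSlope hs ht hst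
  have hn := c.chordSlope_le_deriv hs ht hst
  have hpm : 0 < 1 + chordSlope f s t * f' s := by
    linarith [(abs_le.1 (mul_small hp (c.small s hs))).1]
  have hpn : 0 < 1 + chordSlope f s t * f' t := by
    linarith [(abs_le.1 (mul_small hp (c.small t ht))).1]
  have hts : 0 < t - s := sub_pos.2 hst
  have hq : 0 < √(1 + chordSlope f s t ^ 2) := by positivity
  have hqsq := Real.sq_sqrt (show (0 : ℝ) ≤ 1 + chordSlope f s t ^ 2 by positivity)
  -- the points of the arc over `(s, t)`, in the coordinates of the chord
  have harc : ∀ x ∈ Ioo s t, ∃ z ∈ alongChord K f s t, z.im ≤ 0 ∧ 0 ≤ z.re ∧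
      z.re ≤ chordLength f s t ∧
      z.re * √(1 + chordSlope f s t ^ 2) = (x - s) + chordSlope f s t * (f x - f s) ∧
      z.im * √(1 + chordSlope f s t ^ 2) = (f x - f s) - chordSlope f s t * (x - s) := by
    intro x hx
    have hxI : x ∈ Ioo (-r) r := ⟨hs.1.trans hx.1, hx.2.trans ht.2⟩
    have a1 := c.abs_sub_le hs hxI
    rw [abs_of_pos (sub_pos.2 hx.1)] at a1
    have a2 := c.abs_sub_le hxI ht
    rw [abs_of_pos (sub_pos.2 hx.2)] at a2
    have hsec : (f x - f s) - chordSlope f s t * (x - s) ≤ 0 := by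
      have h3 := c.convexOn.secant_mono hs hxI ht hx.1.ne' hst.ne' hx.2.le
      have h4 : (f x - f s) / (x - s) ≤ chordSlope f s t := h3
      rw [div_le_iff₀ (sub_pos.2 hx.1)] at h4
      linarith
    have b1 : |chordSlope f s t * (f x - f s)| ≤ 1 / 10 * (1 / 10 * (x - s)) := by
      rw [abs_mul]; gcongr
    have b2 : |chordSlope f s t * (f t - f x)| ≤ 1 / 10 * (1 / 10 * (t - x)) := by
      rw [abs_mul]; gcongr
    have hft : f t - f s = chordSlope f s t * (t - s) := by rw [chordSlope]; field_simp
    refine ⟨⟨((x - s) + chordSlope f s t * (f x - f s)) / √(1 + chordSlope f s t ^ 2),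
      ((f x - f s) - chordSlope f s t * (x - s)) / √(1 + chordSlope f s t ^ 2)⟩, ?_, ?_, ?_, ?_,
      by simp only; field_simp, by simp only; field_simp⟩
    · rw [alongChord, mem_placed]
      convert c.mem hxI using 1
      apply Complex.ext
      · simp only [Complex.add_re, Complex.mul_re, chordDir, graphPoint]
        field_simp
        linear_combination (s - x) * hqsq
      · simp only [Complex.add_im, Complex.mul_im, chordDir, graphPoint]
        field_simp
        linear_combination (f s - f x) * hqsq
    · exact div_nonpos_of_nonpos_of_nonneg hsec hq.le
    · exact div_nonneg (by linarith [(abs_le.1 b1).1, hx.1]) hq.le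
    · simp only
      rw [div_le_iff₀ hq, chordLength, mul_assoc, ← sq, hqsq]
      have := (abs_le.1 b2).1
      have e : (t - s) * (1 + chordSlope f s t ^ 2)
          = (t - s) + chordSlope f s t * (f t - f s) := by rw [hft]; ring
      rw [e]
      nlinarith [hx.2]
  refine ⟨div_nonneg (by linarith) hpm.le, div_nonneg (by linarith) hpn.le, fun z hz hi => ?_,
    fun z hz hi => ?_, fun τ hτ hb => ?_, fun τ hτ hb => ?_⟩
  · rw [startSlope, div_mul_eq_mul_div, le_div_iff₀ hpm]
    exact (c.cap_bounds hK hs ht hst hz).1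
  · rw [endSlope, div_mul_eq_mul_div, le_div_iff₀ hpn]
    exact (c.cap_bounds hK hs ht hst hz).2
  · rw [startSlope, div_le_iff₀ hpm]
    have hlim : Tendsto (slope f s) (𝓝[>] s) (𝓝 (f' s)) :=
      (hasDerivWithinAt_iff_tendsto_slope' self_notMem_Ioi).1 (c.hasDerivAt s hs).hasDerivWithinAt
    refine le_of_tendsto_of_tendsto (tendsto_const_nhds.sub hlim)
      ((tendsto_const_nhds.add (hlim.const_mul (chordSlope f s t))).const_mul τ) ?_
    filter_upwards [Ioo_mem_nhdsGT hst] with x hx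
    obtain ⟨z, hz, z1, z2, z3, e1, e2⟩ := harc x hx
    have hxs : 0 < x - s := sub_pos.2 hx.1
    have : -z.im ≤ τ * z.re := by
      rcases z1.lt_or_eq with hlt | heq
      · exact hb z hz hlt
      · rw [heq]; simpa using mul_nonneg hτ z2
    have h5 : -(z.im * √(1 + chordSlope f s t ^ 2)) ≤ τ * (z.re * √(1 + chordSlope f s t ^ 2)) := by
      nlinarith
    rw [e1, e2] at h5
    rw [slope_def_field]
    have e3 : chordSlope f s t - (f x - f s) / (x - s)
        = -(f x - f s - chordSlope f s t * (x - s)) / (x - s) := by field_simp; ring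
    have e4 : τ * (1 + chordSlope f s t * ((f x - f s) / (x - s)))
        = τ * (x - s + chordSlope f s t * (f x - f s)) / (x - s) := by field_simp
    rw [e3, e4]
    gcongr
  · rw [endSlope, div_le_iff₀ hpn]
    have hlim : Tendsto (slope f t) (𝓝[<] t) (𝓝 (f' t)) :=
      (hasDerivWithinAt_iff_tendsto_slope' self_notMem_Iio).1 (c.hasDerivAt t ht).hasDerivWithinAt
    refine le_of_tendsto_of_tendsto (hlim.sub tendsto_const_nhds)
      ((tendsto_const_nhds.add (hlim.const_mul (chordSlope f s t))).const_mul τ) ?_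
    filter_upwards [Ioo_mem_nhdsLT hst] with x hx
    obtain ⟨z, hz, z1, z2, z3, e1, e2⟩ := harc x hx
    have hxt : 0 < t - x := sub_pos.2 hx.2
    have hxt' : x - t ≠ 0 := by linarith
    have : -z.im ≤ τ * (chordLength f s t - z.re) := by
      rcases z1.lt_or_eq with hlt | heq
      · exact hb z hz hlt
      · rw [heq]; simpa using mul_nonneg hτ (sub_nonneg.2 z3)
    have h5 : -(z.im * √(1 + chordSlope f s t ^ 2)) ≤ τ * (chordLength f s t *
        √(1 + chordSlope f s t ^ 2) - z.re * √(1 + chordSlope f s t ^ 2)) := by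
      nlinarith
    have hft : f t - f s = chordSlope f s t * (t - s) := by rw [chordSlope]; field_simp
    rw [e1, e2, chordLength, mul_assoc, ← sq, hqsq] at h5
    rw [slope_def_field]
    have e3 : (f x - f t) / (x - t) - chordSlope f s t
        = -(f x - f s - chordSlope f s t * (x - s)) / (t - x) := by
      field_simp
      linear_combination (x - t) * hft
    have e4 : τ * (1 + chordSlope f s t * ((f x - f t) / (x - t)))
        = τ * ((t - s) * (1 + chordSlope f s t ^ 2) - (x - s + chordSlope f s t * (f x - f s)))
          / (t - x) := by
      field_simp
      linear_combination (chordSlope f s t * (x - t) * τ) * hft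
    rw [e3, e4]
    gcongr

end SmoothChart

/-! ### Equality of the angles at the ends of a chord -/

namespace SmoothChart

variable {K : Set ℂ} {r h : ℝ} {f f' : ℝ → ℝ}

lemma continuousOn_fun (c : SmoothChart K r h f f') : ContinuousOn f (Ioo (-r) r) :=
  c.toGraphChart.continuousOn

lemma chordLength_le (c : SmoothChart K r h f f') {s t : ℝ} (hs : s ∈ Ioo (-r) r)
    (ht : t ∈ Ioo (-r) r) (hst : s < t) : chordLength f s t ≤ 2 * (t - s) := by
  have hq : √(1 + chordSlope f s t ^ 2) ≤ 2 := by
    rw [Real.sqrt_le_left (by norm_num)]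
    nlinarith [abs_le.1 (c.abs_chordSlope_le hs ht hst)]
  rw [chordLength, mul_comm]
  exact mul_le_mul_of_nonneg_right hq (sub_pos.2 hst).le

/-- The chords starting at a given point attain all lengths up to that of a given chord. -/
lemma exists_chordLength_eq (c : SmoothChart K r h f f') {s t d : ℝ} (hs : s ∈ Ioo (-r) r)
    (ht : t ∈ Ioo (-r) r) (hst : s < t) (hd : 0 < d) (hdt : d ≤ chordLength f s t) :
    ∃ x ∈ Ioc s t, chordLength f s x = d := by
  have hsub : Icc s t ⊆ Ioo (-r) r := fun x hx => ⟨hs.1.trans_le hx.1, hx.2.trans_lt ht.2⟩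
  have hcont : ContinuousOn (fun x => (x - s) ^ 2 + (f x - f s) ^ 2) (Icc s t) := by
    have := c.continuousOn_fun.mono hsub
    fun_prop
  have hmem : d ^ 2 ∈ Icc ((s - s) ^ 2 + (f s - f s) ^ 2) ((t - s) ^ 2 + (f t - f s) ^ 2) := by
    rw [← chordLength_sq f hst]
    constructor
    · simp; positivity
    · gcongr
  obtain ⟨x, hx, hxd⟩ := intermediate_value_Icc hst.le hcont hmem
  have hsx : s < x := by
    rcases hx.1.eq_or_lt with h | h
    · rw [← h] at hxd; simp at hxd; exact absurd hxd.symm (pow_pos hd 2).ne'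
    · exact h
  refine ⟨x, ⟨hsx, hx.2⟩, ?_⟩
  rw [← sq_eq_sq₀ (chordLength_pos f hsx).le hd.le, chordLength_sq f hsx]
  exact hxd

/-- The end of a chord of fixed length depends on its start in a Lipschitz way. -/
lemma abs_end_sub_le (c : SmoothChart K r h f f') {s t s' t' : ℝ} (hs : s ∈ Ioo (-r) r)
    (ht : t ∈ Ioo (-r) r) (hst : s < t) (hs' : s' ∈ Ioo (-r) r) (ht' : t' ∈ Ioo (-r) r)
    (hst' : s' < t') (hd : chordLength f s t = chordLength f s' t') :
    |t - t'| ≤ 2 * |s - s'| := by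
  have hsq := congrArg (· ^ 2) hd
  simp only [chordLength_sq f hst, chordLength_sq f hst'] at hsq
  have b1 := c.abs_sub_le hs ht
  have b2 := c.abs_sub_le hs' ht'
  have b3 := c.abs_sub_le ht' ht
  have b4 := c.abs_sub_le hs' hs
  rw [abs_of_pos (sub_pos.2 hst)] at b1
  rw [abs_of_pos (sub_pos.2 hst')] at b2
  set a := t - s
  set a' := t' - s'
  set b := f t - f s
  set b' := f t' - f s'
  have ha : 0 < a := sub_pos.2 hst
  have ha' : 0 < a' := sub_pos.2 hst'
  have hbb : |b - b'| ≤ 1 / 10 * (|t - t'| + |s - s'|) := by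
    have : b - b' = (f t - f t') - (f s - f s') := by simp only [b, b']; ring
    rw [this]
    exact (abs_sub _ _).trans (by linarith)
  have hprod : (a - a') * (a + a') = -((b - b') * (b + b')) := by linear_combination hsq
  have hsum : |b + b'| ≤ 1 / 10 * (a + a') := (abs_add_le _ _).trans (by linarith)
  have haa : |a - a'| ≤ 1 / 10 * |b - b'| := by
    have h1 : |a - a'| * (a + a') = |b - b'| * |b + b'| := by
      rw [← abs_of_pos (add_pos ha ha'), ← abs_mul, hprod, abs_neg, abs_mul]
    have h2 : |a - a'| * (a + a') ≤ |b - b'| * (1 / 10 * (a + a')) := by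
      rw [h1]; gcongr
    have h3 : 0 < a + a' := add_pos ha ha'
    have h4 : |a - a'| * (a + a') ≤ (1 / 10 * |b - b'|) * (a + a') := by linarith
    exact le_of_mul_le_mul_right h4 h3
  have htt : |t - t'| ≤ |a - a'| + |s - s'| := by
    have : t - t' = (a - a') + (s - s') := by simp only [a, a']; ring
    rw [this]; exact abs_add_le _ _
  have := abs_nonneg (s - s')
  linarith

lemma end_unique (c : SmoothChart K r h f f') {s t t' : ℝ} (hs : s ∈ Ioo (-r) r)
    (ht : t ∈ Ioo (-r) r) (hst : s < t) (ht' : t' ∈ Ioo (-r) r)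
    (hst' : s < t') (hd : chordLength f s t = chordLength f s t') : t = t' := by
  have := c.abs_end_sub_le hs ht hst hs ht' hst' hd
  rw [sub_self, abs_zero, mul_zero] at this
  exact sub_eq_zero.1 (abs_eq_zero.1 (le_antisymm this (abs_nonneg _)))

lemma one_add_mul_pos (c : SmoothChart K r h f f') {s t x : ℝ} (hs : s ∈ Ioo (-r) r)
    (ht : t ∈ Ioo (-r) r) (hst : s < t) (hx : x ∈ Ioo (-r) r) :
    0 < 1 + chordSlope f s t * f' x := by
  linarith [(abs_le.1 (mul_small (c.abs_chordSlope_le hs ht hst) (c.small x hx))).1]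

/-- If the angles at the ends of a chord differ, then the open arc lies strictly below the chord;
otherwise the arc would be the chord itself, by convexity. -/
lemma lt_chord (c : SmoothChart K r h f f') (hK : Convex ℝ K) {s t x : ℝ} (hs : s ∈ Ioo (-r) r)
    (ht : t ∈ Ioo (-r) r) (hx : x ∈ Ioo s t) (hne : startSlope f f' s t ≠ endSlope f f' s t) :
    f x - f s < chordSlope f s t * (x - s) := by
  have hst : s < t := hx.1.trans hx.2
  have hxI : x ∈ Ioo (-r) r := ⟨hs.1.trans hx.1, hx.2.trans ht.2⟩
  have h1 : 0 < x - s := sub_pos.2 hx.1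
  have h2 : 0 < t - x := sub_pos.2 hx.2
  have h3 : 0 < t - s := sub_pos.2 hst
  have hle : (f x - f s) / (x - s) ≤ chordSlope f s t :=
    c.convexOn.secant_mono hs hxI ht hx.1.ne' hst.ne' hx.2.le
  rw [div_le_iff₀ h1] at hle
  refine lt_of_le_of_ne hle fun heq => hne ?_
  have hft : f t - f s = chordSlope f s t * (t - s) := by rw [chordSlope]; field_simp
  have d1 : chordSlope f s t ≤ f' x := by
    have := c.chordSlope_le_deriv hs hxI hx.1
    have e : chordSlope f s x = chordSlope f s t := by
      rw [chordSlope, div_eq_iff h1.ne', heq]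
    rwa [e] at this
  have d2 : f' x ≤ chordSlope f s t := by
    have := c.deriv_le_chordSlope hxI ht hx.2
    have e : chordSlope f x t = chordSlope f s t := by
      rw [chordSlope, div_eq_iff h2.ne']; linear_combination hft - heq
    rwa [e] at this
  have hd : f' x = chordSlope f s t := le_antisymm d2 d1
  have hq : 0 < √(1 + chordSlope f s t ^ 2) := by positivity
  have hempty : ∀ z ∈ alongChord K f s t, 0 ≤ z.im := by
    intro z hz
    have hz' : chordDir f s t * z + graphPoint f s ∈ K := hz
    have := c.support hK hxI (w := chordDir f s t * z + graphPoint f s - graphPoint f x)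
      (by rwa [sub_add_cancel])
    rw [hd] at this
    simp only [Complex.add_re, Complex.sub_re, Complex.mul_re, Complex.add_im, Complex.sub_im,
      Complex.mul_im, chordDir, graphPoint] at this
    have e : (1 / √(1 + chordSlope f s t ^ 2) * z.im
        + chordSlope f s t / √(1 + chordSlope f s t ^ 2) * z.re + f s - f x)
        - chordSlope f s t * (1 / √(1 + chordSlope f s t ^ 2) * z.re
        - chordSlope f s t / √(1 + chordSlope f s t ^ 2) * z.im + s - x)
        = z.im * (1 + chordSlope f s t ^ 2) / √(1 + chordSlope f s t ^ 2) := by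
      field_simp
      linear_combination (-√(1 + chordSlope f s t ^ 2)) * heq
    have h4 : 0 ≤ z.im * (1 + chordSlope f s t ^ 2) / √(1 + chordSlope f s t ^ 2) := by
      rw [← e]; linarith
    by_contra hcon
    have : z.im * (1 + chordSlope f s t ^ 2) / √(1 + chordSlope f s t ^ 2) < 0 :=
      div_neg_of_neg_of_pos (mul_neg_of_neg_of_pos (not_le.1 hcon) (by positivity)) hq
    linarith
  have hcs := c.hasCapSlopes hK hs ht hst
  have e1 : startSlope f f' s t = 0 := le_antisymm
    (hcs.least_left 0 le_rfl fun z hz hi => absurd (hempty z hz) (not_le.2 hi)) hcs.nonneg_left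
  have e2 : endSlope f f' s t = 0 := le_antisymm
    (hcs.least_right 0 le_rfl fun z hz hi => absurd (hempty z hz) (not_le.2 hi)) hcs.nonneg_right
  rw [e1, e2]

end SmoothChart

/-- The caps over short chords of equal length are related as in `CapDichotomy`, since both form
lenses with the cap over a chord of `L` of that length. -/
lemma exists_capDichotomy {K L : Set ℂ} (H : AllPlacements HasIsometricSymmetry K L)
    (hK : IsProperConvex K) (hL : IsProperConvex L) {r h : ℝ} {f f' : ℝ → ℝ}
    (c : SmoothChart K r h f f') :
    ∃ δ > 0, ∀ s₁ t₁ s₂ t₂ : ℝ, s₁ ∈ Ioo (-r) r → t₁ ∈ Ioo (-r) r → s₁ < t₁ → s₂ ∈ Ioo (-r) r →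
      t₂ ∈ Ioo (-r) r → s₂ < t₂ → chordLength f s₁ t₁ < δ →
      chordLength f s₂ t₂ = chordLength f s₁ t₁ →
      CapDichotomy (alongChord K f s₁ t₁) (alongChord K f s₂ t₂) (chordLength f s₁ t₁) := by
  obtain ⟨q, hq⟩ := hL.frontier_nonempty
  obtain ⟨b, ρ, k, g, g', hb, cL⟩ := exists_smoothChart H.symm hL hK hq
  have hρ := cL.pos
  have h0 : (0 : ℝ) ∈ Ioo (-ρ) ρ := cL.zero_mem
  have h2 : ρ / 2 ∈ Ioo (-ρ) ρ := ⟨by linarith, by linarith⟩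
  have hLc : Convex ℝ (placed b q L) := convex_placed hL.convex
  have H' : AllPlacements HasIsometricSymmetry K (placed b q L) := (H.symm.placed_left hb).symm
  refine ⟨chordLength g 0 (ρ / 2), chordLength_pos g (by linarith), ?_⟩
  intro s₁ t₁ s₂ t₂ hs₁ ht₁ hst₁ hs₂ ht₂ hst₂ hδ heq
  obtain ⟨x, hx, hxd⟩ := cL.exists_chordLength_eq h0 h2 (by linarith)
    (chordLength_pos f hst₁) hδ.le
  have hxI : x ∈ Ioo (-ρ) ρ := ⟨by linarith [hx.1], by linarith [hx.2]⟩
  have fL := cL.flatCap hLc h0 hxI hx.1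
  rw [hxd] at fL
  have f₁ := c.flatCap hK.convex hs₁ ht₁ hst₁
  have f₂ := c.flatCap hK.convex hs₂ ht₂ hst₂
  rw [heq] at f₂
  have hd := chordLength_pos f hst₁
  exact CapDichotomy.of_common
    (lens_trichotomy (H'.placed (norm_chordDir f s₁ t₁) (norm_chordDir g 0 x))
      (convex_placed hK.convex) (convex_placed hLc) hd f₁ fL)
    (lens_trichotomy (H'.placed (norm_chordDir f s₂ t₂) (norm_chordDir g 0 x))
      (convex_placed hK.convex) (convex_placed hLc) hd f₂ fL)

/-- A function vanishing at both ends of an interval does not have a positive derivative at each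
of its zeros. -/
lemma false_of_deriv_pos_at_zeros {U U' : ℝ → ℝ} {a b : ℝ} (hab : a < b)
    (hU : ∀ x ∈ Icc a b, HasDerivAt U (U' x) x) (ha : U a = 0) (hb : U b = 0)
    (hpos : ∀ x ∈ Icc a b, U x = 0 → 0 < U' x) : False := by
  have hcont : ContinuousOn U (Icc a b) := fun x hx => (hU x hx).continuousAt.continuousWithinAt
  have hnonneg : ∀ x ∈ Icc a b, 0 ≤ U x := by
    intro x hx
    have := image_le_of_deriv_right_lt_deriv_boundary (f := fun x => -U x) (f' := fun x => -U' x)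
      (B := fun _ => 0) (B' := fun _ => 0) hcont.neg
      (fun y hy => (hU y (Ico_subset_Icc_self hy)).neg.hasDerivWithinAt) (by simp [ha])
      (fun y => hasDerivAt_const y 0)
      (fun y hy h0 => by simpa using hpos y (Ico_subset_Icc_self hy) (by simpa using h0)) hx
    simpa using this
  have hb' := hpos b (right_mem_Icc.2 hab.le) hb
  have ht : Tendsto (slope U b) (𝓝[<] b) (𝓝 (U' b)) :=
    (hasDerivWithinAt_iff_tendsto_slope' self_notMem_Iio).1
      (hU b (right_mem_Icc.2 hab.le)).hasDerivWithinAt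
  have hev := ht.eventually (lt_mem_nhds hb')
  obtain ⟨x, hx1, hx2⟩ := (hev.and (Ioo_mem_nhdsLT hab)).exists
  rw [slope_def_field, hb, sub_zero] at hx1
  have := hnonneg x (Ioo_subset_Icc_self hx2)
  have h3 : U x / (x - b) ≤ 0 := div_nonpos_of_nonneg_of_nonpos this (by linarith [hx2.2])
  linarith

/-- The larger of the angles between a chord and the tangents has the smaller cosine. Here `m`,
`p`, `n` are the slopes of the tangent at the start, the chord and the tangent at the end, and
`(lam, lam * n)` and `(1, m)` have the same length. -/
lemma cos_lt_of_slope_lt {m n p lam : ℝ} (hlam : 0 < lam)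
    (hsq : lam ^ 2 * (1 + n ^ 2) = 1 + m ^ 2) (hm : 0 < 1 + p * m) (hn : 0 < 1 + p * n)
    (hpn : p ≤ n) (h : (n - p) / (1 + p * n) < (p - m) / (1 + p * m)) :
    1 + p * m < lam * (1 + p * n) := by
  rw [div_lt_div_iff₀ hn hm] at h
  have h1 : ((n - p) * (1 + p * m)) ^ 2 < ((p - m) * (1 + p * n)) ^ 2 :=
    pow_lt_pow_left₀ h (mul_nonneg (by linarith) hm.le) (by norm_num)
  refine lt_of_pow_lt_pow_left₀ 2 (by positivity) ?_
  have h2 : (1 + p * m) ^ 2 * (1 + n ^ 2) * (1 + p ^ 2)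
      < (lam * (1 + p * n)) ^ 2 * (1 + n ^ 2) * (1 + p ^ 2) := by
    have e1 : (lam * (1 + p * n)) ^ 2 * (1 + n ^ 2) = (1 + m ^ 2) * (1 + p * n) ^ 2 := by
      rw [← hsq]; ring
    rw [e1]
    linarith
  exact lt_of_mul_lt_mul_right (lt_of_mul_lt_mul_right h2 (by positivity)) (by positivity)

lemma cos_gt_of_slope_gt {m n p lam : ℝ}
    (hsq : lam ^ 2 * (1 + n ^ 2) = 1 + m ^ 2) (hm : 0 < 1 + p * m) (hn : 0 < 1 + p * n)
    (hmp : m ≤ p) (h : (p - m) / (1 + p * m) < (n - p) / (1 + p * n)) :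
    lam * (1 + p * n) < 1 + p * m := by
  rw [div_lt_div_iff₀ hm hn] at h
  have h1 : ((p - m) * (1 + p * n)) ^ 2 < ((n - p) * (1 + p * m)) ^ 2 :=
    pow_lt_pow_left₀ h (mul_nonneg (by linarith) hn.le) (by norm_num)
  refine lt_of_pow_lt_pow_left₀ 2 hm.le ?_
  have h2 : (lam * (1 + p * n)) ^ 2 * (1 + n ^ 2) * (1 + p ^ 2)
      < (1 + p * m) ^ 2 * (1 + n ^ 2) * (1 + p ^ 2) := by
    have e1 : (lam * (1 + p * n)) ^ 2 * (1 + n ^ 2) = (1 + m ^ 2) * (1 + p * n) ^ 2 := by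
      rw [← hsq]; ring
    rw [e1]
    linarith
  exact lt_of_mul_lt_mul_right (lt_of_mul_lt_mul_right h2 (by positivity)) (by positivity)

namespace SmoothChart

variable {K : Set ℂ} {r h : ℝ} {f f' : ℝ → ℝ}

/-- If the caps over two adjacent chords of length `d` are equal, then the chords of length `d`
starting in between cannot all make a larger angle with the tangent at their start than with
the one at their end, nor can they all make a smaller one. Indeed, the motion carrying the first
arc to the second one moves the starts of these chords along the arc. The distance `d` is attained
at both ends of this motion, while the angles show that it is always passed in the same
direction. -/
lemma false_of_adjacent_caps (c : SmoothChart K r h f f') (hK : Convex ℝ K) {s₀ t₀ t₁ : ℝ}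
    (hs₀ : s₀ ∈ Ioo (-r) r) (ht₀ : t₀ ∈ Ioo (-r) r) (ht₁ : t₁ ∈ Ioo (-r) r) (h₀ : s₀ < t₀)
    (h₁ : t₀ < t₁) (hlen : chordLength f t₀ t₁ = chordLength f s₀ t₀)
    (hcap : ∀ z : ℂ, z.im < 0 → (z ∈ alongChord K f t₀ t₁ ↔ z ∈ alongChord K f s₀ t₀))
    (hne : startSlope f f' s₀ t₀ ≠ endSlope f f' s₀ t₀)
    (hside : (∀ s ∈ Icc s₀ t₀, ∀ t ∈ Ioo (-r) r, s < t →
        chordLength f s t = chordLength f s₀ t₀ → endSlope f f' s t < startSlope f f' s t) ∨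
      (∀ s ∈ Icc s₀ t₀, ∀ t ∈ Ioo (-r) r, s < t →
        chordLength f s t = chordLength f s₀ t₀ → startSlope f f' s t < endSlope f f' s t)) :
    False := by
  have hsub : Icc s₀ t₀ ⊆ Ioo (-r) r := fun x hx => ⟨hs₀.1.trans_le hx.1, hx.2.trans_lt ht₀.2⟩
  set u₁ := chordDir f s₀ t₀ with hu₁
  set u₂ := chordDir f t₀ t₁ with hu₂
  have hu₁n : ‖u₁‖ = 1 := norm_chordDir _ _ _
  have hu₂n : ‖u₂‖ = 1 := norm_chordDir _ _ _
  set ω : ℂ := u₂ * conj u₁ with hω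
  have hωn : ω.re ^ 2 + ω.im ^ 2 = 1 := by
    rw [← norm_sq_eq, hω, norm_mul, RCLike.norm_conj, hu₁n, hu₂n]; norm_num
  have hωu : ω * u₁ = u₂ := by rw [hω, mul_assoc, conj_mul_of_norm_eq_one hu₁n, mul_one]
  set d := chordLength f s₀ t₀ with hd
  have hdpos : 0 < d := chordLength_pos f h₀
  -- the slopes of the chords are so small that `ω` keeps the orientation along the real axis
  have hxpos : ∀ m : ℝ, |m| ≤ 1 / 10 → 0 < ω.re - ω.im * m := by
    intro m hm
    have hp₁ := c.abs_chordSlope_le hs₀ ht₀ h₀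
    have hp₂ := c.abs_chordSlope_le ht₀ ht₁ h₁
    have e : ω.re - ω.im * m = (1 + chordSlope f s₀ t₀ * chordSlope f t₀ t₁
        + chordSlope f s₀ t₀ * m - chordSlope f t₀ t₁ * m) /
        (√(1 + chordSlope f s₀ t₀ ^ 2) * √(1 + chordSlope f t₀ t₁ ^ 2)) := by
      simp only [hω, hu₁, hu₂, chordDir, Complex.mul_re, Complex.mul_im, Complex.conj_re,
        Complex.conj_im]
      field_simp
      ring
    rw [e]
    have a1 := abs_le.1 (mul_small hp₁ hp₂)
    have a2 := abs_le.1 (mul_small hp₁ hm)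
    have a3 := abs_le.1 (mul_small hp₂ hm)
    exact div_pos (by linarith [a1.1, a2.1, a3.2]) (by positivity)
  set x : ℝ → ℝ := fun σ => t₀ + (ω.re * (σ - s₀) - ω.im * (f σ - f s₀)) with hx
  set y : ℝ → ℝ := fun σ => f t₀ + (ω.im * (σ - s₀) + ω.re * (f σ - f s₀)) with hy
  set x' : ℝ → ℝ := fun σ => ω.re - ω.im * f' σ with hx'
  set y' : ℝ → ℝ := fun σ => ω.im + ω.re * f' σ with hy'
  have hG : ∀ σ, (⟨x σ, y σ⟩ : ℂ) = u₂ * (conj u₁ * (graphPoint f σ - graphPoint f s₀))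
      + graphPoint f t₀ := by
    intro σ
    rw [← mul_assoc, ← hω]
    apply Complex.ext
    · simp only [graphPoint, Complex.add_re, Complex.mul_re, Complex.sub_re, Complex.sub_im]
      ring
    · simp only [graphPoint, Complex.add_im, Complex.mul_im, Complex.sub_re, Complex.sub_im]
      ring
  have hxd : ∀ σ ∈ Icc s₀ t₀, HasDerivAt x (x' σ) σ := by
    intro σ hσ
    have hf := c.hasDerivAt σ (hsub hσ)
    have := ((((hasDerivAt_id σ).sub_const s₀).const_mul ω.re).sub
      ((hf.sub_const (f s₀)).const_mul ω.im)).const_add t₀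
    simpa [hx, hx'] using this
  have hyd : ∀ σ ∈ Icc s₀ t₀, HasDerivAt y (y' σ) σ := by
    intro σ hσ
    have hf := c.hasDerivAt σ (hsub hσ)
    have := ((((hasDerivAt_id σ).sub_const s₀).const_mul ω.im).add
      ((hf.sub_const (f s₀)).const_mul ω.re)).const_add (f t₀)
    simpa [hy, hy'] using this
  have hxc : ContinuousOn x (Icc s₀ t₀) := fun σ hσ => (hxd σ hσ).continuousAt.continuousWithinAt
  have hxmono : StrictMonoOn x (Icc s₀ t₀) :=
    strictMonoOn_of_hasDerivWithinAt_pos (convex_Icc _ _) hxc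
      (fun σ hσ => (hxd σ (interior_subset hσ)).hasDerivWithinAt)
      (fun σ hσ => hxpos _ (c.small σ (hsub (interior_subset hσ))))
  have hG0 : (⟨x s₀, y s₀⟩ : ℂ) = graphPoint f t₀ := by rw [hG]; simp
  have hG1 : (⟨x t₀, y t₀⟩ : ℂ) = graphPoint f t₁ := by
    rw [hG, ← chordLength_mul_chordDir f h₀, ← mul_assoc, ← mul_assoc, ← hω, ← hu₁, hωu, ← hd,
      ← hlen, hu₂, chordLength_mul_chordDir f h₁]
    ring
  have hx0 : x s₀ = t₀ := congrArg Complex.re hG0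
  have hy0 : y s₀ = f t₀ := congrArg Complex.im hG0
  have hx1 : x t₀ = t₁ := congrArg Complex.re hG1
  have hy1 : y t₀ = f t₁ := congrArg Complex.im hG1
  have hle : s₀ ∈ Icc s₀ t₀ := left_mem_Icc.2 h₀.le
  have hre : t₀ ∈ Icc s₀ t₀ := right_mem_Icc.2 h₀.le
  have hxI : ∀ σ ∈ Icc s₀ t₀, x σ ∈ Icc t₀ t₁ := by
    intro σ hσ
    rw [← hx0, ← hx1]
    exact ⟨hxmono.monotoneOn hle hσ hσ.1, hxmono.monotoneOn hσ hre hσ.2⟩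
  have hxr : ∀ σ ∈ Icc s₀ t₀, x σ ∈ Ioo (-r) r := fun σ hσ =>
    ⟨ht₀.1.trans_le (hxI σ hσ).1, (hxI σ hσ).2.trans_lt ht₁.2⟩
  have hyh : ∀ σ ∈ Icc s₀ t₀, y σ < h := by
    intro σ hσ
    have b1 := c.abs_sub_le c.zero_mem ht₀
    rw [c.zero, sub_zero, sub_zero] at b1
    have b2 := c.abs_sub_le hs₀ (hsub hσ)
    have b3 : |t₀| ≤ r := (abs_lt.2 ht₀).le
    have b4 : |σ - s₀| ≤ 2 * r := by
      have := hsub hσ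
      rw [abs_le]; constructor <;> linarith [this.1, this.2, hs₀.1, hs₀.2]
    have c1 : |ω.im| ≤ 1 := abs_le_one_iff_mul_self_le_one.2 (by nlinarith)
    have c2 : |ω.re| ≤ 1 := abs_le_one_iff_mul_self_le_one.2 (by nlinarith)
    have d1 : |ω.im * (σ - s₀)| ≤ 1 * |σ - s₀| := by rw [abs_mul]; gcongr
    have d2 : |ω.re * (f σ - f s₀)| ≤ 1 * |f σ - f s₀| := by rw [abs_mul]; gcongr
    have := le_abs_self (f t₀)
    have := le_abs_self (ω.im * (σ - s₀))
    have := le_abs_self (ω.re * (f σ - f s₀))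
    have := c.room
    have := c.pos
    simp only [hy]
    linarith
  -- the motion carries the first arc to the second one
  have hgraph : ∀ σ ∈ Icc s₀ t₀, f (x σ) = y σ := by
    intro σ hσ
    rcases hσ.1.eq_or_lt with he | hl
    · rw [← he, hx0, hy0]
    rcases hσ.2.eq_or_lt with he | hr
    · rw [he, hx1, hy1]
    set z : ℂ := conj u₁ * (graphPoint f σ - graphPoint f s₀) with hz
    have hzF : u₁ * z + graphPoint f s₀ = graphPoint f σ := by
      rw [hz, ← mul_assoc, mul_conj_of_norm_eq_one hu₁n]; ring
    have hzi : z.im < 0 := by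
      have := c.lt_chord hK hs₀ ht₀ ⟨hl, hr⟩ hne
      have e : z.im = (f σ - f s₀ - chordSlope f s₀ t₀ * (σ - s₀))
          / √(1 + chordSlope f s₀ t₀ ^ 2) := by
        simp only [hz, hu₁, chordDir, graphPoint, Complex.mul_im, Complex.conj_re,
          Complex.conj_im, Complex.sub_re, Complex.sub_im]
        field_simp
        ring
      rw [e]
      exact div_neg_of_neg_of_pos (by linarith) (by positivity)
    have hz1 : z ∈ alongChord K f s₀ t₀ := by
      rw [alongChord, mem_placed, ← hu₁, hzF]; exact c.mem (hsub hσ)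
    have hzint : z ∉ interior (alongChord K f s₀ t₀) := by
      rw [alongChord, interior_placed (norm_chordDir _ _ _), mem_placed, ← hu₁, hzF]
      exact c.notMem_interior (z := graphPoint f σ) (hsub hσ) le_rfl
    have hGz : (⟨x σ, y σ⟩ : ℂ) = u₂ * z + graphPoint f t₀ := hG σ
    have hGK : (⟨x σ, y σ⟩ : ℂ) ∈ K := by
      rw [hGz]; exact (hcap z hzi).2 hz1
    have hGi : (⟨x σ, y σ⟩ : ℂ) ∉ interior K := by
      intro hi
      apply hzint
      rw [hGz, ← mem_placed, hu₂, ← interior_placed (norm_chordDir _ _ _),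
        mem_interior_iff_mem_nhds] at hi
      rw [mem_interior_iff_mem_nhds]
      filter_upwards [hi, (isOpen_lt Complex.continuous_im continuous_const).mem_nhds hzi]
        with w hw hwi
      exact (hcap w hwi).1 hw
    refine le_antisymm ((c.mem_iff _ (hxr σ hσ) (hyh σ hσ).le).1 hGK) (not_lt.1 fun hlt => hGi ?_)
    exact c.mem_interior (z := ⟨x σ, y σ⟩) (hxr σ hσ) hlt (hyh σ hσ)
  have hx'c : ContinuousOn x' (Icc s₀ t₀) :=
    continuousOn_const.sub (continuousOn_const.mul (c.continuousOn_deriv.mono hsub))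
  have hy'c : ContinuousOn y' (Icc s₀ t₀) :=
    continuousOn_const.add (continuousOn_const.mul (c.continuousOn_deriv.mono hsub))
  have htan : ∀ σ ∈ Icc s₀ t₀, f' (x σ) * x' σ = y' σ := by
    have hEq : EqOn (fun σ => f' (x σ) * x' σ) y' (Ioo s₀ t₀) := by
      intro σ hσ
      have hσ' := Ioo_subset_Icc_self hσ
      have d1 : HasDerivAt (fun σ => f (x σ)) (f' (x σ) * x' σ) σ :=
        (c.hasDerivAt _ (hxr σ hσ')).comp σ (hxd σ hσ')
      refine d1.unique ((hyd σ hσ').congr_of_eventuallyEq ?_)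
      filter_upwards [Ioo_mem_nhds hσ.1 hσ.2] with τ hτ
      exact hgraph τ (Ioo_subset_Icc_self hτ)
    exact hEq.of_subset_closure ((c.continuousOn_deriv.comp hxc hxr).mul hx'c) hy'c
      Ioo_subset_Icc_self (closure_Ioo h₀.ne).ge
  set U : ℝ → ℝ := fun σ => (x σ - σ) ^ 2 + (y σ - f σ) ^ 2 - d ^ 2 with hU
  set U' : ℝ → ℝ := fun σ => 2 * (x σ - σ) * (x' σ - 1) + 2 * (y σ - f σ) * (y' σ - f' σ) with hU'
  have hUd : ∀ σ ∈ Icc s₀ t₀, HasDerivAt U (U' σ) σ := by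
    intro σ hσ
    have := (((((hxd σ hσ).sub (hasDerivAt_id σ)).pow 2).add
      (((hyd σ hσ).sub (c.hasDerivAt σ (hsub hσ))).pow 2)).sub_const (d ^ 2))
    simpa [hU, hU'] using this
  have hU0 : U s₀ = 0 := by
    simp only [hU, hx0, hy0, hd, chordLength_sq f h₀]; ring
  have hU1 : U t₀ = 0 := by
    simp only [hU, hx1, hy1, ← hlen, chordLength_sq f h₁]; ring
  have hlt : ∀ σ ∈ Icc s₀ t₀, σ < x σ := by
    intro σ hσ
    rcases hσ.2.eq_or_lt with he | hr
    · rw [he, hx1]; exact h₁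
    · exact hr.trans_le (hxI σ hσ).1
  -- at a zero of `U` there is a chord of length `d`, which determines the sign of `U'`
  have hzero : ∀ σ ∈ Icc s₀ t₀, U σ = 0 → chordLength f σ (x σ) = d := by
    intro σ hσ h0
    rw [← sq_eq_sq₀ (chordLength_pos f (hlt σ hσ)).le hdpos.le, chordLength_sq f (hlt σ hσ),
      hgraph σ hσ]
    simp only [hU] at h0
    linarith
  have hU'e : ∀ σ ∈ Icc s₀ t₀, U' σ = 2 * (x σ - σ) *
      (x' σ * (1 + chordSlope f σ (x σ) * f' (x σ)) - (1 + chordSlope f σ (x σ) * f' σ)) := by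
    intro σ hσ
    have h1 : x σ - σ ≠ 0 := (sub_pos.2 (hlt σ hσ)).ne'
    simp only [hU', chordSlope]
    rw [← htan σ hσ, hgraph σ hσ]
    field_simp
    ring
  have hsq : ∀ σ ∈ Icc s₀ t₀, x' σ ^ 2 * (1 + f' (x σ) ^ 2) = 1 + f' σ ^ 2 := by
    intro σ hσ
    have e : x' σ ^ 2 * (1 + f' (x σ) ^ 2) = x' σ ^ 2 + (f' (x σ) * x' σ) ^ 2 := by ring
    rw [e, htan σ hσ]
    simp only [hx', hy']
    linear_combination (1 + f' σ ^ 2) * hωn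
  rcases hside with hside | hside
  · refine false_of_deriv_pos_at_zeros h₀ hUd hU0 hU1 fun σ hσ h0 => ?_
    have hs := hside σ hσ (x σ) (hxr σ hσ) (hlt σ hσ) (hzero σ hσ h0)
    have := cos_lt_of_slope_lt (hxpos _ (c.small σ (hsub hσ))) (hsq σ hσ)
      (c.one_add_mul_pos (hsub hσ) (hxr σ hσ) (hlt σ hσ) (hsub hσ))
      (c.one_add_mul_pos (hsub hσ) (hxr σ hσ) (hlt σ hσ) (hxr σ hσ))
      (c.chordSlope_le_deriv (hsub hσ) (hxr σ hσ) (hlt σ hσ)) hs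
    rw [hU'e σ hσ]
    have := hlt σ hσ
    exact mul_pos (by linarith) (by linarith)
  · refine false_of_deriv_pos_at_zeros (U := fun σ => -U σ) (U' := fun σ => -U' σ) h₀
      (fun σ hσ => (hUd σ hσ).neg) (by simp [hU0]) (by simp [hU1]) fun σ hσ h0 => ?_
    have hs := hside σ hσ (x σ) (hxr σ hσ) (hlt σ hσ) (hzero σ hσ (by linarith))
    have := cos_gt_of_slope_gt (hsq σ hσ)
      (c.one_add_mul_pos (hsub hσ) (hxr σ hσ) (hlt σ hσ) (hsub hσ))
      (c.one_add_mul_pos (hsub hσ) (hxr σ hσ) (hlt σ hσ) (hxr σ hσ))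
      (c.deriv_le_chordSlope (hsub hσ) (hxr σ hσ) (hlt σ hσ)) hs
    rw [hU'e σ hσ, neg_pos]
    have := hlt σ hσ
    exact mul_neg_of_pos_of_neg (by linarith) (by linarith)

/-- Short chords make equal angles with the tangents at both ends. -/
lemma startSlope_eq_endSlope (c : SmoothChart K r h f f') (hK : Convex ℝ K) {δ : ℝ}
    (hδ : ∀ s₁ t₁ s₂ t₂ : ℝ, s₁ ∈ Ioo (-r) r → t₁ ∈ Ioo (-r) r → s₁ < t₁ → s₂ ∈ Ioo (-r) r →
      t₂ ∈ Ioo (-r) r → s₂ < t₂ → chordLength f s₁ t₁ < δ →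
      chordLength f s₂ t₂ = chordLength f s₁ t₁ →
      CapDichotomy (alongChord K f s₁ t₁) (alongChord K f s₂ t₂) (chordLength f s₁ t₁))
    {s₀ t₀ : ℝ} (hs₀ : s₀ ∈ Ioo (-(r / 8)) (r / 8)) (ht₀ : t₀ ∈ Ioo (-(r / 8)) (r / 8))
    (h₀ : s₀ < t₀) (hd : chordLength f s₀ t₀ < δ) :
    startSlope f f' s₀ t₀ = endSlope f f' s₀ t₀ := by
  by_contra hne
  have hr := c.pos
  have hsub : Ioo (-(r / 8)) (r / 8) ⊆ Ioo (-r) r := Ioo_subset_Ioo (by linarith) (by linarith)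
  have hs₀' := hsub hs₀
  have ht₀' := hsub ht₀
  have hIcc : Icc s₀ t₀ ⊆ Ioo (-r) r := fun x hx => ⟨hs₀'.1.trans_le hx.1, hx.2.trans_lt ht₀'.2⟩
  set d := chordLength f s₀ t₀ with hd'
  have hdpos : 0 < d := chordLength_pos f h₀
  have hdr : d < r / 2 := by
    have := c.chordLength_le hs₀' ht₀' h₀
    linarith [hs₀.1, ht₀.2]
  have hex : ∀ s : ℝ, ∃ t, s ∈ Icc s₀ t₀ → s < t ∧ t ∈ Ioo (-r) r ∧ chordLength f s t = d := by
    intro s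
    by_cases hs : s ∈ Icc s₀ t₀
    · have hsd : s + d ∈ Ioo (-r) r := ⟨by linarith [(hIcc hs).1], by linarith [hs.2, ht₀.2]⟩
      have hle : d ≤ chordLength f s (s + d) := by
        rw [chordLength, add_sub_cancel_left]
        exact le_mul_of_one_le_right hdpos.le
          (Real.one_le_sqrt.2 (by linarith [sq_nonneg (chordSlope f s (s + d))]))
      obtain ⟨t, ht, htd⟩ := c.exists_chordLength_eq (hIcc hs) hsd (by linarith) hdpos hle
      exact ⟨t, fun _ => ⟨ht.1, ⟨(hIcc hs).1.trans ht.1, ht.2.trans_lt hsd.2⟩, htd⟩⟩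
    · exact ⟨0, fun h => absurd h hs⟩
  choose T hT using hex
  set D : ℝ → ℝ := fun s => startSlope f f' s (T s) - endSlope f f' s (T s) with hD
  set D₀ := startSlope f f' s₀ t₀ - endSlope f f' s₀ t₀ with hD₀
  have hD₀ne : D₀ ≠ 0 := sub_ne_zero.2 hne
  have hcs₀ := c.hasCapSlopes hK hs₀' ht₀' h₀
  -- two chords of length `d` either have equal caps, or mirrored ones
  have hcaps : ∀ s ∈ Icc s₀ t₀,
      ((∀ z : ℂ, z.im < 0 → (z ∈ alongChord K f s (T s) ↔ z ∈ alongChord K f s₀ t₀)) ∧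
        D s = D₀) ∨ D s = -D₀ := by
    intro s hs
    obtain ⟨h1, h2, h3⟩ := hT s hs
    have hcs := c.hasCapSlopes hK (hIcc hs) h2 h1
    rw [h3] at hcs
    rcases hδ s₀ t₀ s (T s) hs₀' ht₀' h₀ (hIcc hs) h2 h1 hd h3 with h | h | ⟨h, -⟩
    · obtain ⟨e1, e2⟩ := hcs₀.eq_of_cap_eq hcs h
      exact Or.inl ⟨h, by simp only [hD, hD₀]; rw [e1, e2]⟩
    · obtain ⟨e1, e2⟩ := hcs₀.eq_of_cap_flip hcs h
      exact Or.inr (by simp only [hD, hD₀]; rw [e1, e2]; ring)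
    · exact absurd (hcs₀.eq_of_cap_flip hcs₀ h).1 hne
  have hTc : ContinuousOn T (Icc s₀ t₀) := by
    refine LipschitzOnWith.continuousOn (K := 2) (LipschitzOnWith.of_dist_le_mul ?_)
    intro s hs s' hs'
    obtain ⟨h1, h2, h3⟩ := hT s hs
    obtain ⟨h1', h2', h3'⟩ := hT s' hs'
    exact c.abs_end_sub_le (hIcc hs) h2 h1 (hIcc hs') h2' h1' (h3.trans h3'.symm)
  have hTm : MapsTo T (Icc s₀ t₀) (Ioo (-r) r) := fun s hs => (hT s hs).2.1
  have hfc := c.continuousOn_fun.mono hIcc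
  have hf'c := c.continuousOn_deriv.mono hIcc
  have hfT : ContinuousOn (fun s => f (T s)) (Icc s₀ t₀) := c.continuousOn_fun.comp hTc hTm
  have hf'T : ContinuousOn (fun s => f' (T s)) (Icc s₀ t₀) := c.continuousOn_deriv.comp hTc hTm
  have hpc : ContinuousOn (fun s => chordSlope f s (T s)) (Icc s₀ t₀) :=
    (hfT.sub hfc).div (hTc.sub continuousOn_id) fun s hs => (sub_pos.2 (hT s hs).1).ne'
  have hDc : ContinuousOn D (Icc s₀ t₀) := by
    refine ((hpc.sub hf'c).div (continuousOn_const.add (hpc.mul hf'c)) fun s hs => ?_).sub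
      ((hf'T.sub hpc).div (continuousOn_const.add (hpc.mul hf'T)) fun s hs => ?_)
    · exact (c.one_add_mul_pos (hIcc hs) (hT s hs).2.1 (hT s hs).1 (hIcc hs)).ne'
    · exact (c.one_add_mul_pos (hIcc hs) (hT s hs).2.1 (hT s hs).1 (hT s hs).2.1).ne'
  have hleft : s₀ ∈ Icc s₀ t₀ := left_mem_Icc.2 h₀.le
  have hright : t₀ ∈ Icc s₀ t₀ := right_mem_Icc.2 h₀.le
  have hTs₀ : T s₀ = t₀ := by
    obtain ⟨h1, h2, h3⟩ := hT s₀ hleft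
    exact c.end_unique hs₀' h2 h1 ht₀' h₀ h3
  have hDconst : EqOn D (fun _ => D₀) (Icc s₀ t₀) := by
    refine isPreconnected_Icc.eq_of_sq_eq hDc continuousOn_const (fun s hs => ?_)
      (fun _ => hD₀ne) hleft (by simp only [hD, hTs₀, hD₀])
    rcases hcaps s hs with h | h
    · simp [h.2]
    · simp [h]
  obtain ⟨h1, h2, h3⟩ := hT t₀ hright
  have hcap := (hcaps t₀ hright).resolve_right (by
    rw [hDconst hright]
    intro h
    exact hD₀ne (by linarith [show D₀ = -D₀ from h]))
  have hside : ∀ s ∈ Icc s₀ t₀, ∀ t ∈ Ioo (-r) r, s < t → chordLength f s t = d →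
      startSlope f f' s t - endSlope f f' s t = D₀ := by
    intro s hs t ht hst hdt
    obtain ⟨g1, g2, g3⟩ := hT s hs
    rw [c.end_unique (hIcc hs) ht hst g2 g1 (hdt.trans g3.symm)]
    exact hDconst hs
  refine c.false_of_adjacent_caps hK hs₀' ht₀' h2 h₀ h1 h3 hcap.1 hne ?_
  rcases hD₀ne.lt_or_gt with hlt | hgt
  · right
    intro s hs t ht hst hdt
    linarith [hside s hs t ht hst hdt]
  · left
    intro s hs t ht hst hdt
    linarith [hside s hs t ht hst hdt]

end SmoothChart

lemma mul_conj_mul_sub_add {a : ℂ} (ha : ‖a‖ = 1) (b w : ℂ) : a * (conj a * (w - b)) + b = w := by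
  rw [← mul_assoc, mul_conj_of_norm_eq_one ha]; ring

lemma IsProperConvex.placed {K : Set ℂ} (hK : IsProperConvex K) {a : ℂ} (ha : ‖a‖ = 1) {b : ℂ} :
    IsProperConvex (placed a b K) := by
  refine ⟨isClosed_placed hK.isClosed, convex_placed hK.convex, ?_, fun h => hK.ne_univ ?_⟩
  · obtain ⟨w, hw⟩ := hK.interior_nonempty
    refine ⟨conj a * (w - b), ?_⟩
    rwa [interior_placed ha, mem_placed, mul_conj_mul_sub_add ha]
  · refine eq_univ_of_forall fun w => ?_
    have : conj a * (w - b) ∈ PlanarConvex.placed a b K := by rw [h]; trivial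
    rwa [mem_placed, mul_conj_mul_sub_add ha] at this

/-- Around each boundary point there is a smooth chart whose chords make equal angles with the
tangents at both ends. -/
lemma exists_smoothChart_startSlope_eq {K L : Set ℂ} (H : AllPlacements HasIsometricSymmetry K L)
    (hK : IsProperConvex K) (hL : IsProperConvex L) {p : ℂ} (hp : p ∈ frontier K) :
    ∃ a r h f f', ‖a‖ = 1 ∧ SmoothChart (placed a p K) r h f f' ∧
      ∀ s ∈ Ioo (-r) r, ∀ t ∈ Ioo (-r) r, s < t → startSlope f f' s t = endSlope f f' s t := by
  obtain ⟨a, r, h, f, f', ha, c⟩ := exists_smoothChart H hK hL hp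
  obtain ⟨δ, hδ0, hδ⟩ := exists_capDichotomy (H.placed_left ha) (hK.placed ha) hL c
  have hr := c.pos
  have hρ : 0 < min (r / 8) (δ / 4) := lt_min (by linarith) (by linarith)
  refine ⟨a, min (r / 8) (δ / 4), h, f, f', ha,
    c.restrict hρ ((min_le_left _ _).trans (by linarith)), fun s hs t ht hst => ?_⟩
  have m1 := min_le_left (r / 8) (δ / 4)
  have m2 := min_le_right (r / 8) (δ / 4)
  have hs' : s ∈ Ioo (-(r / 8)) (r / 8) := ⟨by linarith [hs.1], by linarith [hs.2]⟩
  have ht' : t ∈ Ioo (-(r / 8)) (r / 8) := ⟨by linarith [ht.1], by linarith [ht.2]⟩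
  refine c.startSlope_eq_endSlope (convex_placed hK.convex) hδ hs' ht' hst ?_
  have := c.chordLength_le (s := s) (t := t) ⟨by linarith [hs'.1], by linarith [hs'.2]⟩
    ⟨by linarith [ht'.1], by linarith [ht'.2]⟩ hst
  linarith [hs.1, ht.2]

/-! ### Local roundness -/

namespace SmoothChart

variable {K : Set ℂ} {r h : ℝ} {f f' : ℝ → ℝ}

lemma nonneg (c : SmoothChart K r h f f') {t : ℝ} (ht : t ∈ Ioo (-r) r) : 0 ≤ f t := by
  rcases lt_trichotomy t 0 with h0 | h0 | h0
  · have := c.chordSlope_le_deriv ht c.zero_mem h0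
    rw [c.deriv_zero, chordSlope, c.zero, div_le_iff₀ (by linarith)] at this
    linarith
  · rw [h0, c.zero]
  · have := c.deriv_le_chordSlope c.zero_mem ht h0
    rw [c.deriv_zero, chordSlope, c.zero, le_div_iff₀ (by linarith)] at this
    linarith

lemma abs_le (c : SmoothChart K r h f f') {t : ℝ} (ht : t ∈ Ioo (-r) r) :
    |f t| ≤ 1 / 10 * |t| := by
  simpa [c.zero] using c.abs_sub_le c.zero_mem ht

/-- The equality of angles for the chords from the base point. -/
lemma deriv_mul_sub_sq (c : SmoothChart K r h f f')
    (hA : ∀ s ∈ Ioo (-r) r, ∀ t ∈ Ioo (-r) r, s < t → startSlope f f' s t = endSlope f f' s t)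
    {t : ℝ} (ht : t ∈ Ioo (-r) r) (h0 : t ≠ 0) : f' t * (t ^ 2 - f t ^ 2) = 2 * t * f t := by
  rcases h0.lt_or_gt with hlt | hgt
  · have hpos := c.one_add_mul_pos ht c.zero_mem hlt ht
    have e := hA t ht 0 c.zero_mem hlt
    rw [startSlope, endSlope, c.deriv_zero, mul_zero, add_zero, div_one, div_eq_iff hpos.ne'] at e
    have hs : chordSlope f t 0 = f t / t := by
      rw [chordSlope, c.zero, zero_sub, zero_sub, neg_div_neg_eq]
    rw [hs] at e
    field_simp at e
    linear_combination -e
  · have hpos := c.one_add_mul_pos c.zero_mem ht hgt ht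
    have e := hA 0 c.zero_mem t ht hgt
    rw [startSlope, endSlope, c.deriv_zero, mul_zero, add_zero, div_one, sub_zero,
      eq_div_iff hpos.ne'] at e
    have hs : chordSlope f 0 t = f t / t := by
      rw [chordSlope, c.zero, sub_zero, sub_zero]
    rw [hs] at e
    field_simp at e
    linear_combination -e

/-- The point of the chart over `-t` has the same height as the one over `t`, by the equality of
angles for the chord joining them. -/
lemma even_of_startSlope_eq (c : SmoothChart K r h f f')
    (hA : ∀ s ∈ Ioo (-r) r, ∀ t ∈ Ioo (-r) r, s < t → startSlope f f' s t = endSlope f f' s t)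
    {t : ℝ} (ht : t ∈ Ioo (-r) r) (h0 : 0 < t) : f (-t) = f t := by
  have ht' : -t ∈ Ioo (-r) r := ⟨by linarith [ht.2], by linarith [ht.1]⟩
  have hlt : -t < t := by linarith
  have e1 := c.deriv_mul_sub_sq hA ht h0.ne'
  have e2 := c.deriv_mul_sub_sq hA ht' (by linarith)
  have e3 := hA _ ht' _ ht hlt
  rw [startSlope, endSlope, div_eq_div_iff (c.one_add_mul_pos ht' ht hlt ht').ne'
    (c.one_add_mul_pos ht' ht hlt ht).ne'] at e3
  have b1 := c.abs_le ht
  have b2 := c.abs_le ht'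
  rw [abs_neg] at b2
  rw [abs_of_pos h0] at b1 b2
  obtain ⟨b, hb⟩ : ∃ b, f t = b * t := ⟨f t / t, by field_simp⟩
  obtain ⟨a, ha⟩ : ∃ a, f (-t) = a * t := ⟨f (-t) / t, by field_simp⟩
  have hb' : |b| ≤ 1 / 10 := by
    rw [hb, abs_mul, abs_of_pos h0] at b1; exact le_of_mul_le_mul_right b1 h0
  have ha' : |a| ≤ 1 / 10 := by
    rw [ha, abs_mul, abs_of_pos h0] at b2; exact le_of_mul_le_mul_right b2 h0
  have hp : chordSlope f (-t) t = (b - a) / 2 := by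
    rw [chordSlope, ha, hb]; field_simp; ring
  have hn : f' t * (1 - b ^ 2) = 2 * b := by
    rw [hb] at e1
    exact mul_right_cancel₀ (pow_ne_zero 2 h0.ne') (by linear_combination e1)
  have hm : f' (-t) * (1 - a ^ 2) = -2 * a := by
    rw [ha] at e2
    exact mul_right_cancel₀ (pow_ne_zero 2 h0.ne') (by linear_combination e2)
  rw [hp] at e3
  set n := f' t
  set m := f' (-t)
  have e4 : (b - a) * (1 - m * n) = (m + n) * (1 - ((b - a) / 2) ^ 2) := by linear_combination e3
  -- after clearing denominators
  have e5 : (b - a) * ((1 - a ^ 2) * (1 - b ^ 2) + 4 * a * b)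
      = (b - a) * (2 * (1 + a * b) * (1 - ((b - a) / 2) ^ 2)) := by
    linear_combination (1 - a ^ 2) * (1 - b ^ 2) * e4
      + ((b - a) * (n * (1 - b ^ 2)) + (1 - b ^ 2) * (1 - ((b - a) / 2) ^ 2)) * hm
      + ((b - a) * (-2 * a) + (1 - a ^ 2) * (1 - ((b - a) / 2) ^ 2)) * hn
  rw [ha, hb]
  congr 1
  by_contra hne
  have hne' : b - a ≠ 0 := fun h => hne (by linarith)
  have e6 := mul_left_cancel₀ hne' e5
  obtain ⟨a1, a2⟩ := _root_.abs_le.1 ha'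
  obtain ⟨b3, b4⟩ := _root_.abs_le.1 hb'
  have q1 := (_root_.abs_le.1 (mul_small ha' hb')).1
  have q2 := (_root_.abs_le.1 (mul_small ha' hb')).2
  have s1 : ((b - a) / 2) ^ 2 ≤ 1 / 100 := by nlinarith
  have s2 : (1 - a ^ 2) * (1 - b ^ 2) ≤ 1 := by nlinarith [sq_nonneg a, sq_nonneg b]
  have s3 : 1.9 ≤ 2 * (1 + a * b) * (1 - ((b - a) / 2) ^ 2) := by nlinarith
  linarith

/-- The ratio of `f t` and `t ^ 2 + f t ^ 2` is locally constant away from `0`, since its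
derivative vanishes. -/
lemma div_eq_div (c : SmoothChart K r h f f')
    (hA : ∀ s ∈ Ioo (-r) r, ∀ t ∈ Ioo (-r) r, s < t → startSlope f f' s t = endSlope f f' s t)
    {I : Set ℝ} (hIo : IsOpen I) (hIc : IsPreconnected I) (hI : I ⊆ Ioo (-r) r) (h0 : (0 : ℝ) ∉ I)
    {s t : ℝ} (hs : s ∈ I) (ht : t ∈ I) :
    f s / (s ^ 2 + f s ^ 2) = f t / (t ^ 2 + f t ^ 2) := by
  have hd : ∀ x ∈ I, HasDerivAt (fun x => f x / (x ^ 2 + f x ^ 2)) 0 x := by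
    intro x hx
    have hx0 : x ≠ 0 := fun h => h0 (h ▸ hx)
    have hf := c.hasDerivAt x (hI hx)
    have hden : x ^ 2 + f x ^ 2 ≠ 0 := by positivity
    have h1 : HasDerivAt (fun x => x ^ 2 + f x ^ 2) (2 * x + 2 * f x * f' x) x := by
      have := ((hasDerivAt_id' x).fun_pow 2).fun_add (hf.fun_pow 2)
      simpa using this
    have h3 := hf.fun_div h1 hden
    have h4 : (f' x * (x ^ 2 + f x ^ 2) - f x * (2 * x + 2 * f x * f' x)) / (x ^ 2 + f x ^ 2) ^ 2
        = 0 := by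
      rw [div_eq_zero_iff]
      left
      linear_combination c.deriv_mul_sub_sq hA (hI hx) hx0
    rwa [h4] at h3
  exact hIo.is_const_of_deriv_eq_zero hIc
    (fun x hx => (hd x hx).differentiableAt.differentiableWithinAt) (fun x hx => (hd x hx).deriv)
    hs ht

/-- The graph is part of a circle or of a line. -/
lemma exists_curvature (c : SmoothChart K r h f f')
    (hA : ∀ s ∈ Ioo (-r) r, ∀ t ∈ Ioo (-r) r, s < t → startSlope f f' s t = endSlope f f' s t) :
    ∃ k : ℝ, 0 ≤ k ∧ ∀ t ∈ Ioo (-r) r, f t = k * (t ^ 2 + f t ^ 2) := by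
  have hr := c.pos
  have h2 : r / 2 ∈ Ioo (-r) r := ⟨by linarith, by linarith⟩
  refine ⟨f (r / 2) / ((r / 2) ^ 2 + f (r / 2) ^ 2), div_nonneg (c.nonneg h2) (by positivity),
    fun t ht => ?_⟩
  have key : ∀ x ∈ Ioo 0 r,
      f x = f (r / 2) / ((r / 2) ^ 2 + f (r / 2) ^ 2) * (x ^ 2 + f x ^ 2) := by
    intro x hx
    rw [c.div_eq_div hA isOpen_Ioo isPreconnected_Ioo (Ioo_subset_Ioo_left (by linarith))
      (fun h => lt_irrefl _ h.1) ⟨by linarith, h2.2⟩ hx]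
    have : 0 < x := hx.1
    field_simp
  rcases lt_trichotomy t 0 with h0 | h0 | h0
  · have := key (-t) ⟨by linarith, by linarith [ht.1]⟩
    rw [c.even_of_startSlope_eq hA (t := -t) ⟨by linarith [ht.2], by linarith [ht.1]⟩
      (by linarith) |>.symm, neg_neg] at this
    rwa [neg_sq] at this
  · rw [h0, c.zero]; simp
  · exact key t ⟨h0, ht.2⟩

end SmoothChart

/-- The disc or half-plane with `p` on its boundary, inner unit normal `u` at `p` and
curvature `k`. -/
def roundSet (k : ℝ) (p u : ℂ) : Set ℂ := {z | k * ‖z - p‖ ^ 2 ≤ (conj u * (z - p)).re}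

lemma mem_roundSet {k : ℝ} {p u z : ℂ} :
    z ∈ roundSet k p u ↔ k * ‖z - p‖ ^ 2 ≤ (conj u * (z - p)).re := Iff.rfl

/-- Near each of its boundary points, `K` is a disc or a half-plane. -/
lemma exists_locally_round {K L : Set ℂ} (H : AllPlacements HasIsometricSymmetry K L)
    (hK : IsProperConvex K) (hL : IsProperConvex L) {p : ℂ} (hp : p ∈ frontier K) :
    ∃ k u, 0 ≤ k ∧ ‖u‖ = 1 ∧ ∀ᶠ z in 𝓝 p, z ∈ K ↔ z ∈ roundSet k p u := by
  obtain ⟨a, r, h, f, f', ha, c, hA⟩ := exists_smoothChart_startSlope_eq H hK hL hp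
  obtain ⟨k, hk, hkf⟩ := c.exists_curvature hA
  refine ⟨k, Complex.I * a, hk, by simp [ha], ?_⟩
  have hcont : Continuous fun z : ℂ => conj a * (z - p) := by fun_prop
  have h0 : conj a * (p - p) = 0 := by simp
  have e1 : ∀ᶠ z in 𝓝 p, (conj a * (z - p)).re ∈ Ioo (-r) r :=
    (Complex.continuous_re.comp hcont).continuousAt.eventually_mem
      (isOpen_Ioo.mem_nhds (by simp [c.pos]))
  have hh : 0 < h := by linarith [c.room, c.pos]
  have e2 : ∀ᶠ z in 𝓝 p, (conj a * (z - p)).im < h :=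
    (Complex.continuous_im.comp hcont).continuousAt.eventually_lt continuousAt_const (by simpa)
  have hf : ContinuousAt f 0 := (c.hasDerivAt 0 c.zero_mem).continuousAt
  have e3 : ∀ᶠ z in 𝓝 p, k * ((conj a * (z - p)).im + f (conj a * (z - p)).re) < 1 := by
    have hf' : ContinuousAt (fun z : ℂ => f (conj a * (z - p)).re) p := by
      refine ContinuousAt.comp (f := fun z : ℂ => (conj a * (z - p)).re) (g := f) ?_
        (Complex.continuous_re.comp hcont).continuousAt
      simpa using hf
    refine ContinuousAt.eventually_lt (continuousAt_const.mul
      ((Complex.continuous_im.comp hcont).continuousAt.add hf')) continuousAt_const ?_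
    simp [c.zero]
  filter_upwards [e1, e2, e3] with z h1 h2 h3
  have hz : z ∈ K ↔ conj a * (z - p) ∈ placed a p K := by
    rw [mem_placed, mul_conj_mul_sub_add ha]
  have hn : ‖z - p‖ = ‖conj a * (z - p)‖ := by rw [norm_mul, RCLike.norm_conj, ha, one_mul]
  have hu : (conj (Complex.I * a) * (z - p)).re = (conj a * (z - p)).im := by
    simp [Complex.mul_re, Complex.mul_im]; ring
  rw [hz, mem_roundSet, hn, hu, norm_sq_eq]
  set w := conj a * (z - p)
  rw [c.mem_iff w h1 h2.le]
  have e := hkf w.re h1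
  have e' : w.im - k * (w.re ^ 2 + w.im ^ 2)
      = (w.im - f w.re) * (1 - k * (w.im + f w.re)) := by linear_combination e
  have hpos : 0 < 1 - k * (w.im + f w.re) := by linarith
  rw [← sub_nonneg, ← mul_nonneg_iff_of_pos_right hpos, ← e', sub_nonneg]

/-! ### From local to global roundness -/

/-- The boundary circle or line of `roundSet k p u`. -/
def roundCurve (k : ℝ) (p u : ℂ) : Set ℂ := {z | k * ‖z - p‖ ^ 2 = (conj u * (z - p)).re}

lemma re_conj_mul (u z : ℂ) : (conj u * z).re = u.re * z.re + u.im * z.im := by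
  simp [Complex.mul_re]

lemma roundCurve_subset {k : ℝ} {p u : ℂ} : roundCurve k p u ⊆ roundSet k p u :=
  fun _ hz => le_of_eq hz

/-- The description of a disc or a half-plane may be based at any of its boundary points. -/
lemma exists_recenter {k : ℝ} {p u q : ℂ} (hu : ‖u‖ = 1) (hq : q ∈ roundCurve k p u) :
    ∃ v, ‖v‖ = 1 ∧ ∀ z, k * ‖z - p‖ ^ 2 - (conj u * (z - p)).re
      = k * ‖z - q‖ ^ 2 - (conj v * (z - q)).re := by
  have hq' : k * ‖q - p‖ ^ 2 = (conj u * (q - p)).re := hq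
  have hu2 : u.re ^ 2 + u.im ^ 2 = 1 := by rw [← norm_sq_eq, hu]; norm_num
  simp only [norm_sq_eq, re_conj_mul, Complex.sub_re, Complex.sub_im] at hq' ⊢
  refine ⟨⟨u.re - 2 * k * (q.re - p.re), u.im - 2 * k * (q.im - p.im)⟩, ?_, fun z => ?_⟩
  · rw [← sq_eq_sq₀ (norm_nonneg _) zero_le_one, norm_sq_eq]
    linear_combination hu2 + 4 * k * hq'
  · linear_combination hq'

lemma eventually_add_mul {P : ℂ → Prop} {p : ℂ} (h : ∀ᶠ z in 𝓝 p, P z) {g : ℝ → ℂ}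
    (hg : Continuous g) (h0 : g 0 = 0) : ∀ᶠ t in 𝓝[>] (0 : ℝ), P (p + g t) := by
  have : Tendsto (fun t => p + g t) (𝓝[>] 0) (𝓝 p) := by
    have hc : Continuous fun t => p + g t := by fun_prop
    have := (hc.tendsto 0).mono_left (nhdsWithin_le_nhds (s := Ioi 0))
    simpa [h0] using this
  exact this.eventually h

lemma normal_eq {k k' : ℝ} {p u u' : ℂ} (hu : ‖u‖ = 1) (hu' : ‖u'‖ = 1) (hk' : 0 ≤ k')
    (h : ∀ᶠ z in 𝓝 p, z ∈ roundSet k p u ↔ z ∈ roundSet k' p u') : u = u' := by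
  by_contra hne
  have h1 : u.re ^ 2 + u.im ^ 2 = 1 := by rw [← norm_sq_eq, hu]; norm_num
  have h2 : u'.re ^ 2 + u'.im ^ 2 = 1 := by rw [← norm_sq_eq, hu']; norm_num
  set α := 1 - (u.re * u'.re + u.im * u'.im) with hα
  have hαe : 2 * α = ‖u - u'‖ ^ 2 := by
    rw [norm_sq_eq, hα, Complex.sub_re, Complex.sub_im]
    linear_combination (-1) * h1 - h2
  have hαpos : 0 < α := by
    have : 0 < ‖u - u'‖ ^ 2 := pow_pos (norm_pos_iff.2 (sub_ne_zero.2 hne)) 2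
    linarith
  have e1 : ∀ t : ℝ, (conj u * (p + t * (u - u') - p)).re = t * α := by
    intro t
    rw [re_conj_mul, add_sub_cancel_left, Complex.re_ofReal_mul, Complex.im_ofReal_mul,
      Complex.sub_re, Complex.sub_im, hα]
    linear_combination t * h1
  have e2 : ∀ t : ℝ, (conj u' * (p + t * (u - u') - p)).re = -(t * α) := by
    intro t
    rw [re_conj_mul, add_sub_cancel_left, Complex.re_ofReal_mul, Complex.im_ofReal_mul,
      Complex.sub_re, Complex.sub_im, hα]
    linear_combination (-t) * h2
  have hev := eventually_add_mul h (g := fun t : ℝ => (t : ℂ) * (u - u')) (by fun_prop) (by simp)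
  have hsmall : ∀ᶠ t in 𝓝[>] (0 : ℝ), k * t * ‖u - u'‖ ^ 2 < α := by
    have hc : Continuous fun t : ℝ => k * t * ‖u - u'‖ ^ 2 := by fun_prop
    exact (hc.continuousAt.eventually_lt continuousAt_const (by simpa)).filter_mono
      nhdsWithin_le_nhds
  obtain ⟨t, ⟨ht1, ht2⟩, ht3⟩ := ((hev.and hsmall).and self_mem_nhdsWithin).exists
  have ht : 0 < t := ht3
  have hn : ‖p + t * (u - u') - p‖ ^ 2 = t ^ 2 * ‖u - u'‖ ^ 2 := by
    rw [add_sub_cancel_left, norm_mul, mul_pow]; simp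
  have m1 : p + t * (u - u') ∈ roundSet k p u := by
    rw [mem_roundSet, e1, hn]
    nlinarith
  have m2 := ht1.1 m1
  rw [mem_roundSet, e2, hn] at m2
  have : 0 ≤ k' * (t ^ 2 * ‖u - u'‖ ^ 2) := by positivity
  have : 0 < t * α := by positivity
  linarith

lemma curvature_le {k k' : ℝ} {p u : ℂ} (hu : ‖u‖ = 1) (hk : 0 ≤ k)
    (h : ∀ᶠ z in 𝓝 p, z ∈ roundSet k p u ↔ z ∈ roundSet k' p u) : k' ≤ k := by
  by_contra hlt
  rw [not_le] at hlt
  have hu2 : u.re ^ 2 + u.im ^ 2 = 1 := by rw [← norm_sq_eq, hu]; norm_num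
  have hev := eventually_add_mul h
    (g := fun t : ℝ => u * (((k' * t ^ 2 : ℝ) : ℂ) + t * Complex.I)) (by fun_prop) (by simp)
  have hsmall : ∀ᶠ t in 𝓝[>] (0 : ℝ), k * (k' ^ 2 * t ^ 2 + 1) < k' := by
    have hc : Continuous fun t : ℝ => k * (k' ^ 2 * t ^ 2 + 1) := by fun_prop
    exact (hc.continuousAt.eventually_lt continuousAt_const (by simpa)).filter_mono
      nhdsWithin_le_nhds
  obtain ⟨t, ⟨ht1, ht2⟩, ht3⟩ := ((hev.and hsmall).and self_mem_nhdsWithin).exists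
  have ht : 0 < t := ht3
  have hk' : 0 < k' := hk.trans_lt hlt
  rw [mem_roundSet, mem_roundSet, add_sub_cancel_left, norm_mul, hu, one_mul, ← mul_assoc,
    conj_mul_of_norm_eq_one hu, one_mul, norm_sq_eq] at ht1
  simp only [Complex.add_re, Complex.ofReal_re, Complex.mul_re, Complex.I_re, mul_zero,
    Complex.ofReal_im, Complex.I_im, mul_one, sub_self, add_zero, Complex.add_im, Complex.mul_im,
    zero_add] at ht1
  have m2 := ht1.1 (by nlinarith [sq_nonneg t])
  have : 0 < k' * (k' * t ^ 2) ^ 2 := by positivity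
  linarith

lemma isPreconnected_roundCurve {k : ℝ} {p u : ℂ} (hk : 0 ≤ k) (hu : ‖u‖ = 1) :
    IsPreconnected (roundCurve k p u) := by
  have hu2 : u.re ^ 2 + u.im ^ 2 = 1 := by rw [← norm_sq_eq, hu]; norm_num
  rcases hk.eq_or_lt with rfl | hk
  · refine Convex.isPreconnected (fun x hx y hy a b ha hb hab => ?_)
    simp only [roundCurve, mem_ofPred_eq, zero_mul, re_conj_mul, Complex.sub_re, Complex.sub_im,
      Complex.add_re, Complex.add_im, Complex.real_smul, Complex.re_ofReal_mul,
      Complex.im_ofReal_mul] at hx hy ⊢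
    linear_combination a * hx + b * hy - (u.re * p.re + u.im * p.im) * hab
  · have : roundCurve k p u = Metric.sphere (p + ((1 / (2 * k) : ℝ) : ℂ) * u) (1 / (2 * k)) := by
      ext z
      rw [mem_sphere_iff_norm, ← sq_eq_sq₀ (norm_nonneg _) (by positivity), norm_sq_eq]
      simp only [roundCurve, mem_ofPred_eq, norm_sq_eq, re_conj_mul, Complex.sub_re,
        Complex.sub_im, Complex.add_re, Complex.add_im, Complex.re_ofReal_mul,
        Complex.im_ofReal_mul]
      have e : (z.re - (p.re + 1 / (2 * k) * u.re)) ^ 2 + (z.im - (p.im + 1 / (2 * k) * u.im)) ^ 2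
          - (1 / (2 * k)) ^ 2 = 1 / k * (k * ((z.re - p.re) ^ 2 + (z.im - p.im) ^ 2)
            - (u.re * (z.re - p.re) + u.im * (z.im - p.im))) := by
        field_simp
        linear_combination hu2
      rw [← sub_eq_zero, ← sub_eq_zero (b := (1 / (2 * k)) ^ 2), e, mul_eq_zero]
      simp [hk.ne']
    rw [this]
    exact isPreconnected_sphere (by rw [Complex.rank_real_complex]; norm_num) _ _

lemma notMem_interior_roundSet {k : ℝ} {p u q : ℂ} (hk : 0 ≤ k) (hu : ‖u‖ = 1)
    (hq : q ∈ roundCurve k p u) : q ∉ interior (roundSet k p u) := by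
  intro hi
  obtain ⟨v, hv, hvz⟩ := exists_recenter hu hq
  rw [mem_interior_iff_mem_nhds] at hi
  have hev := eventually_add_mul hi (g := fun t : ℝ => -((t : ℂ) * v)) (by fun_prop) (by simp)
  obtain ⟨t, ht1, ht2⟩ := (hev.and self_mem_nhdsWithin).exists
  have ht : 0 < t := ht2
  have hm : k * ‖q + -(t * v) - p‖ ^ 2 ≤ (conj u * (q + -(t * v) - p)).re := ht1
  rw [← sub_nonpos, hvz, add_sub_cancel_left, mul_neg, mul_left_comm, conj_mul_of_norm_eq_one hv,
    norm_neg, norm_mul, hv] at hm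
  simp at hm
  have : 0 ≤ k * t ^ 2 := by positivity
  linarith

/-- A locally round set that agrees with a disc or half-plane near one of its boundary points does
so along the whole boundary curve: the points where it does form a subset of the curve that is open
by definition and closed because a circular arc determines its circle. -/
lemma eventually_mem_iff_of_mem_roundCurve {K : Set ℂ}
    (hloc : ∀ p ∈ frontier K, ∃ k u, 0 ≤ k ∧ ‖u‖ = 1 ∧ ∀ᶠ z in 𝓝 p, z ∈ K ↔ z ∈ roundSet k p u)
    {k : ℝ} {p u : ℂ} (hk : 0 ≤ k) (hu : ‖u‖ = 1)
    (hp : ∀ᶠ z in 𝓝 p, z ∈ K ↔ z ∈ roundSet k p u) {q : ℂ} (hq : q ∈ roundCurve k p u) :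
    ∀ᶠ z in 𝓝 q, z ∈ K ↔ z ∈ roundSet k p u := by
  set A : Set (roundCurve k p u) := {q | ∀ᶠ z in 𝓝 (q : ℂ), z ∈ K ↔ z ∈ roundSet k p u}
  have : PreconnectedSpace (roundCurve k p u) :=
    isPreconnected_iff_preconnectedSpace.1 (isPreconnected_roundCurve hk hu)
  have hopen : IsOpen A :=
    (isOpen_setOfPred_eventually_nhds (p := fun z => z ∈ K ↔ z ∈ roundSet k p u)).preimage
      continuous_subtype_val
  have hfr : ∀ q ∈ A, (q : ℂ) ∈ frontier K := by
    intro q hqA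
    have hqA' : ∀ᶠ z in 𝓝 (q : ℂ), z ∈ K ↔ z ∈ roundSet k p u := hqA
    refine ⟨subset_closure (hqA'.self_of_nhds.2 (le_of_eq q.2)), fun hi => ?_⟩
    refine notMem_interior_roundSet hk hu q.2 (mem_interior_iff_mem_nhds.2 ?_)
    filter_upwards [hqA', mem_interior_iff_mem_nhds.1 hi] with z h1 h2 using h1.1 h2
  have hclosed : IsClosed A := by
    refine isClosed_of_closure_subset fun q hqc => ?_
    have hqf : (q : ℂ) ∈ frontier K := by
      have : IsClosed {q : roundCurve k p u | (q : ℂ) ∈ frontier K} :=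
        isClosed_frontier.preimage continuous_subtype_val
      exact closure_minimal hfr this hqc
    obtain ⟨k', v', hk', hv', hq'⟩ := hloc q hqf
    -- a point of `A` close to `q`, at which both descriptions of `K` apply
    have hmem : ∀ᶠ x : roundCurve k p u in 𝓝 q, (x : ℂ) ∈ roundCurve k' q v' → x ∈ A →
        ∀ z, z ∈ roundSet k p u ↔ z ∈ roundSet k' q v' := by
      filter_upwards [(continuous_subtype_val.tendsto q).eventually hq'.eventually_nhds]
        with x hx hxc hxA
      have hxA' : ∀ᶠ z in 𝓝 (x : ℂ), z ∈ K ↔ z ∈ roundSet k p u := hxA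
      obtain ⟨w, hw, hwz⟩ := exists_recenter hu x.2
      obtain ⟨w', hw', hwz'⟩ := exists_recenter hv' hxc
      have e1 : ∀ z, z ∈ roundSet k p u ↔ z ∈ roundSet k x w := fun z => by
        rw [mem_roundSet, mem_roundSet, ← sub_nonpos, hwz, sub_nonpos]
      have e2 : ∀ z, z ∈ roundSet k' q v' ↔ z ∈ roundSet k' x w' := fun z => by
        rw [mem_roundSet, mem_roundSet, ← sub_nonpos, hwz', sub_nonpos]
      have hboth : ∀ᶠ z in 𝓝 (x : ℂ), z ∈ roundSet k x w ↔ z ∈ roundSet k' x w' := by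
        filter_upwards [hxA', hx] with z h1 h2
        rw [← e1, ← e2, ← h1, h2]
      have hww := normal_eq hw hw' hk' hboth
      subst hww
      have hkk : k = k' := le_antisymm
        (curvature_le hw hk' (hboth.mono fun z => Iff.symm)) (curvature_le hw hk hboth)
      subst hkk
      intro z
      rw [e1, e2]
    obtain ⟨x, hxA, hx, hxq⟩ := ((mem_closure_iff_frequently.1 hqc).and_eventually
      (hmem.and ((continuous_subtype_val.tendsto q).eventually hq'.eventually_nhds))).exists
    have hxc : (x : ℂ) ∈ roundCurve k' q v' := by
      have hxf := hfr x hxA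
      have hxK : (x : ℂ) ∈ roundSet k' q v' := by
        have hxA' : ∀ᶠ z in 𝓝 (x : ℂ), z ∈ K ↔ z ∈ roundSet k p u := hxA
        exact hxq.self_of_nhds.1 (hxA'.self_of_nhds.2 (le_of_eq x.2))
      refine le_antisymm hxK (not_lt.1 fun hlt => hxf.2 ?_)
      rw [mem_interior_iff_mem_nhds]
      have c1 : Continuous fun z : ℂ => k' * ‖z - q‖ ^ 2 := by fun_prop
      have c2 : Continuous fun z : ℂ => (conj v' * (z - q)).re :=
        Complex.continuous_re.comp (by fun_prop)
      filter_upwards [hxq, c1.continuousAt.eventually_lt c2.continuousAt hlt] with z h1 h2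
      exact h1.2 h2.le
    have hall := hx hxc hxA
    show ∀ᶠ z in 𝓝 (q : ℂ), z ∈ K ↔ z ∈ roundSet k p u
    filter_upwards [hq'] with z hz
    rw [hz, hall]
  have hne : A.Nonempty := ⟨⟨p, by simp [roundCurve]⟩, hp⟩
  have := IsClopen.eq_univ ⟨hclosed, hopen⟩ hne
  have hqA : (⟨q, hq⟩ : roundCurve k p u) ∈ A := by rw [this]; trivial
  exact hqA

/-! ### Discs, strips and half-planes -/

/-- The disc of radius `R` around the origin. -/
def centredDisc (R : ℝ) : Set ℂ := {z | z.re ^ 2 + z.im ^ 2 ≤ R ^ 2}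

/-- The strip of width `w` above the real axis. -/
def horizontalStrip (w : ℝ) : Set ℂ := {z | 0 ≤ z.im ∧ z.im ≤ w}

/-- The closed upper half-plane. -/
def upperHalf : Set ℂ := {z | 0 ≤ z.im}

/-- Segments from a point of a convex set `K` to a boundary point of a set `D` which agrees with
`K` near this point start in `D`. -/
lemma eventually_segment_mem {K D : Set ℂ} (hK : Convex ℝ K) {q z : ℂ}
    (hq : ∀ᶠ w in 𝓝 q, w ∈ K ↔ w ∈ D) (hqD : q ∈ D) (hz : z ∈ K) :
    ∀ᶠ t : ℝ in 𝓝[>] 0, q + t * (z - q) ∈ D := by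
  have hev := eventually_add_mul hq (g := fun t : ℝ => (t : ℂ) * (z - q)) (by fun_prop) (by simp)
  filter_upwards [hev, Ioo_mem_nhdsGT (zero_lt_one' ℝ)] with t h1 h2
  refine h1.1 ?_
  have := hK (hq.self_of_nhds.2 hqD) hz (a := 1 - t) (b := t) (by linarith [h2.2]) h2.1.le (by ring)
  convert this using 1
  simp only [Complex.real_smul]
  push_cast
  ring

/-- A closed convex set which, all along a circle or line, agrees with the disc or half-plane
bounded by it, is a disc, a strip or a half-plane. -/
lemma eq_of_agree_along_roundCurve {K : Set ℂ} (hKc : IsClosed K) (hK : Convex ℝ K) {k : ℝ}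
    {p u : ℂ} (hk : 0 ≤ k) (hu : ‖u‖ = 1)
    (h : ∀ q ∈ roundCurve k p u, ∀ᶠ z in 𝓝 q, z ∈ K ↔ z ∈ roundSet k p u) :
    (∃ a b R, ‖a‖ = 1 ∧ 0 < R ∧ K = placed a b (centredDisc R)) ∨
    (∃ a b w, ‖a‖ = 1 ∧ 0 < w ∧ K = placed a b (horizontalStrip w)) ∨
    (∃ a b, ‖a‖ = 1 ∧ K = placed a b upperHalf) := by
  have hu2 : u.re ^ 2 + u.im ^ 2 = 1 := by rw [← norm_sq_eq, hu]; norm_num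
  have hsub : roundCurve k p u ⊆ K := fun q hq => (h q hq).self_of_nhds.2 (le_of_eq hq)
  rcases hk.eq_or_lt with rfl | hk
  · right
    have hcurve : ∀ z, z ∈ roundCurve 0 p u ↔ (conj u * (z - p)).re = 0 := fun z => by
      simp [roundCurve, eq_comm]
    have hpm : p ∈ roundCurve 0 p u := by simp [hcurve]
    have hpK := hsub hpm
    have hnonneg : ∀ z ∈ K, 0 ≤ (conj u * (z - p)).re := by
      intro z hz
      obtain ⟨t, ht1, ht2⟩ := ((eventually_segment_mem hK (h p hpm) (roundCurve_subset hpm) hz).and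
        self_mem_nhdsWithin).exists
      have ht : 0 < t := ht2
      rw [mem_roundSet, add_sub_cancel_left, mul_left_comm, Complex.re_ofReal_mul, zero_mul] at ht1
      exact nonneg_of_mul_nonneg_right ht1 ht
    -- closed convex sets are invariant under translations along lines which they contain
    have htrans : ∀ z ∈ K, ∀ τ : ℝ, z + τ * (Complex.I * u) ∈ K := by
      intro z hz τ
      have ht : Tendsto (fun t : ℝ => (1 - t) • z + t • (p + ((τ / t : ℝ) : ℂ) * (Complex.I * u)))
          (𝓝[>] 0) (𝓝 (z + τ * (Complex.I * u))) := by
        have hc : Continuous fun t : ℝ => ((1 - t : ℝ) : ℂ) * z + t * p + τ * (Complex.I * u) := by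
          fun_prop
        have := (hc.tendsto 0).mono_left (nhdsWithin_le_nhds (s := Ioi 0))
        simp only [sub_zero, Complex.ofReal_one, one_mul, Complex.ofReal_zero, zero_mul,
          add_zero] at this
        refine this.congr' ?_
        filter_upwards [self_mem_nhdsWithin] with t (ht : 0 < t)
        have : (t : ℂ) ≠ 0 := by exact_mod_cast ht.ne'
        simp only [Complex.real_smul]
        push_cast
        field_simp
        ring
      refine hKc.mem_of_tendsto ht ?_
      filter_upwards [Ioo_mem_nhdsGT (zero_lt_one' ℝ)] with t ht
      refine hK hz (hsub ?_) (by linarith [ht.2]) ht.1.le (by ring)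
      rw [hcurve, add_sub_cancel_left, mul_left_comm, Complex.re_ofReal_mul, mul_left_comm,
        conj_mul_of_norm_eq_one hu]
      simp
    have hiff : ∀ z, z ∈ K ↔ p + ((conj u * (z - p)).re : ℂ) * u ∈ K := by
      have e : ∀ z, z = p + ((conj u * (z - p)).re : ℂ) * u
          + ((conj u * (z - p)).im : ℂ) * (Complex.I * u) := by
        intro z
        have : p + ((conj u * (z - p)).re : ℂ) * u
          + ((conj u * (z - p)).im : ℂ) * (Complex.I * u)
          = p + (((conj u * (z - p)).re : ℂ) + ((conj u * (z - p)).im : ℂ) * Complex.I) * u := by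
          ring
        rw [this, Complex.re_add_im, mul_comm, add_comm, mul_conj_mul_sub_add hu]
      intro z
      constructor
      · intro hz
        have := htrans z hz (-(conj u * (z - p)).im)
        convert this using 1
        rw [Complex.ofReal_neg]
        linear_combination (-1 : ℂ) * e z
      · intro hz
        have := htrans _ hz (conj u * (z - p)).im
        rwa [← e z] at this
    set I : Set ℝ := {s | p + (s : ℂ) * u ∈ K} with hI
    have hIc : IsClosed I := hKc.preimage (by fun_prop)
    have hIconv : Convex ℝ I := by
      intro x hx y hy a b ha hb hab
      have := hK hx hy ha hb hab
      have e : a • (p + (x : ℂ) * u) + b • (p + (y : ℂ) * u)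
          = p + ((a • x + b • y : ℝ) : ℂ) * u := by
        have hab' : (a : ℂ) + b = 1 := by exact_mod_cast hab
        simp only [Complex.real_smul, smul_eq_mul]
        push_cast
        linear_combination p * hab'
      rwa [e] at this
    have hI0 : (0 : ℝ) ∈ I := by simpa [hI] using hpK
    have hInn : ∀ s ∈ I, 0 ≤ s := by
      intro s hs
      have := hnonneg _ hs
      rwa [add_sub_cancel_left, mul_left_comm, conj_mul_of_norm_eq_one hu, mul_one,
        Complex.ofReal_re] at this
    have him : ∀ z, (Complex.I * conj u * z + -(Complex.I * conj u * p)).im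
        = (conj u * (z - p)).re := by
      intro z
      simp
      ring
    have ha : ‖Complex.I * conj u‖ = 1 := by simp [hu]
    by_cases hbdd : BddAbove I
    · left
      refine ⟨Complex.I * conj u, -(Complex.I * conj u * p), sSup I, ha, ?_, ?_⟩
      · have hev := eventually_add_mul (h p hpm) (g := fun t : ℝ => (t : ℂ) * u) (by fun_prop)
          (by simp)
        obtain ⟨t, ht1, ht2⟩ := (hev.and self_mem_nhdsWithin).exists
        have ht : 0 < t := ht2
        refine ht.trans_le (le_csSup hbdd (ht1.2 ?_))
        rw [mem_roundSet, add_sub_cancel_left, mul_left_comm, conj_mul_of_norm_eq_one hu]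
        simpa using ht.le
      · ext z
        rw [mem_placed, horizontalStrip, mem_ofPred_eq, him, hiff]
        exact ⟨fun hz => ⟨hInn _ hz, le_csSup hbdd hz⟩, fun hz =>
          hIconv.ordConnected.out hI0 (hIc.csSup_mem ⟨0, hI0⟩ hbdd) hz⟩
    · right
      refine ⟨Complex.I * conj u, -(Complex.I * conj u * p), ha, ?_⟩
      ext z
      rw [mem_placed, upperHalf, mem_ofPred_eq, him, hiff]
      refine ⟨fun hz => hInn _ hz, fun hz => ?_⟩
      obtain ⟨s, hs, hzs⟩ := not_bddAbove_iff.1 hbdd (conj u * (z - p)).re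
      exact hIconv.ordConnected.out hI0 hs ⟨hz, hzs.le⟩
  · left
    set R := 1 / (2 * k) with hR
    have hRpos : 0 < R := by positivity
    set o := p + (R : ℂ) * u with ho
    have hform : ∀ z, k * ‖z - p‖ ^ 2 - (conj u * (z - p)).re
        = k * (‖z - o‖ ^ 2 - R ^ 2) := by
      intro z
      simp only [ho, norm_sq_eq, re_conj_mul, Complex.sub_re, Complex.sub_im, Complex.add_re,
        Complex.add_im, Complex.re_ofReal_mul, Complex.im_ofReal_mul, hR]
      field_simp
      linear_combination (-1 : ℝ) * hu2
    have hsph : ∀ z, ‖z - o‖ = R → z ∈ roundCurve k p u := by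
      intro z hz
      have := hform z
      rw [hz, sub_self, mul_zero, sub_eq_zero] at this
      exact this
    have hball : ∀ z, ‖z - o‖ ≤ R → z ∈ K := by
      have key : ∀ (e : ℂ) (t : ℝ), ‖e‖ = 1 → 0 ≤ t → t ≤ R → o + t * e ∈ K := by
        intro e t he h0 h1
        have m1 : o + R * e ∈ K := hsub (hsph _ (by simp [he, hRpos.le]))
        have m2 : o - R * e ∈ K := hsub (hsph _ (by
          rw [sub_sub_cancel_left, norm_neg, norm_mul, he]; simp [hRpos.le]))
        have := hK m1 m2 (a := (1 + t / R) / 2) (b := (1 - t / R) / 2) (by positivity)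
          (by have := (div_le_one hRpos).2 h1; linarith) (by ring)
        convert this using 1
        have hR' : (R : ℂ) ≠ 0 := by exact_mod_cast hRpos.ne'
        simp only [Complex.real_smul]
        push_cast
        field_simp
        ring
      intro z hz
      by_cases h0 : z = o
      · simpa [h0] using key 1 0 (by simp) le_rfl hRpos.le
      · have hn : ‖z - o‖ ≠ 0 := by simpa [sub_eq_zero] using h0
        have := key ((z - o) / ‖z - o‖) ‖z - o‖ (by simp [sub_ne_zero.2 h0]) (norm_nonneg _) hz
        have e : o + (‖z - o‖ : ℂ) * ((z - o) / ‖z - o‖) = z := by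
          have : (‖z - o‖ : ℂ) ≠ 0 := by exact_mod_cast hn
          field_simp
          ring
        rwa [e] at this
    refine ⟨1, -o, R, by simp, hRpos, ?_⟩
    ext z
    rw [mem_placed, one_mul, ← sub_eq_add_neg, centredDisc, mem_ofPred_eq, ← norm_sq_eq,
      sq_le_sq₀ (norm_nonneg _) hRpos.le]
    refine ⟨fun hz => not_lt.1 fun hlt => ?_, hball z⟩
    -- the segment from the centre to a point outside the disc leaves the disc on its boundary
    have hz0 : 0 < ‖z - o‖ := hRpos.trans hlt
    have hzc : (‖z - o‖ : ℂ) ≠ 0 := by exact_mod_cast hz0.ne'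
    set q := o + ((R / ‖z - o‖ : ℝ) : ℂ) * (z - o) with hq
    have hqn : ‖q - o‖ = R := by
      rw [hq, add_sub_cancel_left, norm_mul, Complex.norm_real, Real.norm_of_nonneg (by positivity)]
      field_simp
    have hqc := hsph q hqn
    obtain ⟨t, ht1, ht2⟩ := ((eventually_segment_mem hK (h q hqc) (roundCurve_subset hqc) hz).and
        self_mem_nhdsWithin).exists
    have ht : 0 < t := ht2
    rw [mem_roundSet, ← sub_nonpos, hform] at ht1
    have hle : ‖q + t * (z - q) - o‖ ≤ R := by
      rw [← sq_le_sq₀ (norm_nonneg _) hRpos.le]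
      by_contra hcon
      have := mul_pos hk (sub_pos.2 (not_le.1 hcon))
      linarith
    have e : q + t * (z - q) - o
        = ((R / ‖z - o‖ + t * (1 - R / ‖z - o‖) : ℝ) : ℂ) * (z - o) := by
      rw [hq]; push_cast; ring
    have hlt1 : R / ‖z - o‖ < 1 := (div_lt_one hz0).2 hlt
    have hpos1 : 0 < R / ‖z - o‖ := by positivity
    have hpos2 : 0 < t * (1 - R / ‖z - o‖) := mul_pos ht (by linarith)
    rw [e, norm_mul, Complex.norm_real, Real.norm_of_nonneg (by linarith), add_mul,
      div_mul_cancel₀ _ hz0.ne'] at hle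
    have := mul_pos hpos2 hz0
    linarith

/-- The classification of the sets `K` all of whose intersections with copies of `L` have a
symmetry. -/
lemma eq_disc_or_strip_or_half {K L : Set ℂ} (H : AllPlacements HasIsometricSymmetry K L)
    (hK : IsProperConvex K) (hL : IsProperConvex L) :
    (∃ a b R, ‖a‖ = 1 ∧ 0 < R ∧ K = placed a b (centredDisc R)) ∨
    (∃ a b w, ‖a‖ = 1 ∧ 0 < w ∧ K = placed a b (horizontalStrip w)) ∨
    (∃ a b, ‖a‖ = 1 ∧ K = placed a b upperHalf) := by
  obtain ⟨p, hp⟩ := hK.frontier_nonempty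
  have hloc := fun p (hp : p ∈ frontier K) => exists_locally_round H hK hL hp
  obtain ⟨k, u, hk, hu, hpu⟩ := hloc p hp
  exact eq_of_agree_along_roundCurve hK.isClosed hK.convex hk hu fun q hq =>
    eventually_mem_iff_of_mem_roundCurve hloc hk hu hpu hq

/-! ### Pairs of discs, strips and half-planes -/

/-- `S` is symmetric in a point, namely in `c / 2`. -/
def IsPointSymmetric (S : Set ℂ) : Prop := ∃ c : ℂ, ∀ z, c - z ∈ S ↔ z ∈ S

/-- `S` is symmetric in a line, namely the one through `p` in direction `e`. -/
def IsLineSymmetric (S : Set ℂ) : Prop :=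
  ∃ p e : ℂ, ‖e‖ = 1 ∧ ∀ z, p + e ^ 2 * conj (z - p) ∈ S ↔ z ∈ S

lemma IsPointSymmetric.hasIsometricSymmetry {S : Set ℂ} (h : IsPointSymmetric S) :
    HasIsometricSymmetry S := by
  obtain ⟨c, hc⟩ := h
  refine Or.inl ⟨-1, c, by simp, Or.inl (by norm_num), fun z => ?_⟩
  rw [← hc z, neg_one_mul, neg_add_eq_sub]

lemma IsLineSymmetric.exists_conj {S : Set ℂ} (h : IsLineSymmetric S) :
    ∃ a b, ‖a‖ = 1 ∧ ∀ z, a * conj z + b ∈ S ↔ z ∈ S := by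
  obtain ⟨p, e, he, h⟩ := h
  refine ⟨e ^ 2, p - e ^ 2 * conj p, by simp [he], fun z => ?_⟩
  rw [← h z, map_sub]
  ring_nf

lemma IsLineSymmetric.hasIsometricSymmetry {S : Set ℂ} (h : IsLineSymmetric S) :
    HasIsometricSymmetry S := Or.inr h.exists_conj

lemma mem_centredDisc {R : ℝ} {z : ℂ} : z ∈ centredDisc R ↔ z.re ^ 2 + z.im ^ 2 ≤ R ^ 2 := Iff.rfl

lemma mem_horizontalStrip {w : ℝ} {z : ℂ} : z ∈ horizontalStrip w ↔ 0 ≤ z.im ∧ z.im ≤ w := Iff.rfl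

lemma mem_upperHalf {z : ℂ} : z ∈ upperHalf ↔ 0 ≤ z.im := Iff.rfl

lemma mem_interior_centredDisc {R : ℝ} {z : ℂ} (h : z.re ^ 2 + z.im ^ 2 < R ^ 2) :
    z ∈ interior (centredDisc R) := by
  rw [mem_interior_iff_mem_nhds]
  have hc : Continuous fun z : ℂ => z.re ^ 2 + z.im ^ 2 := by fun_prop
  filter_upwards [(isOpen_lt hc continuous_const).mem_nhds h] with y hy
  exact le_of_lt hy

lemma mem_interior_horizontalStrip {w : ℝ} {z : ℂ} (h0 : 0 < z.im) (h1 : z.im < w) :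
    z ∈ interior (horizontalStrip w) := by
  rw [mem_interior_iff_mem_nhds]
  filter_upwards [(isOpen_lt continuous_const Complex.continuous_im).mem_nhds h0,
    (isOpen_lt Complex.continuous_im continuous_const).mem_nhds h1] with y h2 h3
  exact ⟨le_of_lt h2, le_of_lt h3⟩

lemma mem_interior_upperHalf {z : ℂ} (h0 : 0 < z.im) : z ∈ interior upperHalf := by
  rw [mem_interior_iff_mem_nhds]
  filter_upwards [(isOpen_lt continuous_const Complex.continuous_im).mem_nhds h0] with y h2
  exact le_of_lt h2

lemma interior_inter_placed_nonempty {K L : Set ℂ} {a b a' b' z : ℂ} (ha : ‖a‖ = 1)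
    (ha' : ‖a'‖ = 1) (hK : a * z + b ∈ interior K) (hL : a' * z + b' ∈ interior L) :
    (interior (placed a b K ∩ placed a' b' L)).Nonempty := by
  rw [interior_inter, interior_placed ha, interior_placed ha']
  exact ⟨z, hK, hL⟩

/-- The unit vector by which a half-plane or strip is turned to one with boundary direction
`1 + i`. -/
noncomputable def diagDir : ℂ := ⟨-(1 / √2), 1 / √2⟩

lemma norm_diagDir : ‖diagDir‖ = 1 := by
  rw [← sq_eq_sq₀ (norm_nonneg _) zero_le_one, norm_sq_eq, diagDir]
  simp only [even_two, Even.neg_pow, div_pow, one_pow, Nat.ofNat_nonneg, Real.sq_sqrt]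
  norm_num

lemma diagDir_mul_im (z : ℂ) : (diagDir * z + 0).im = (z.re - z.im) / √2 := by
  simp [diagDir, Complex.mul_im]
  ring

/-- A strip and a half-plane may meet in a half-strip with an oblique end, which has no symmetry:
its symmetries preserve the recession direction, and then the pair of boundary rays. -/
lemma not_strip_half {w : ℝ} (hw : 0 < w) :
    ¬ AllPlacements HasIsometricSymmetry (horizontalStrip w) upperHalf := by
  intro H
  set S := placed 1 0 (horizontalStrip w) ∩ placed diagDir 0 upperHalf with hS
  have hmem : ∀ z, z ∈ S ↔ (0 ≤ z.im ∧ z.im ≤ w) ∧ z.im ≤ z.re := by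
    intro z
    rw [hS, mem_inter_iff, placed_one_zero, mem_placed, mem_upperHalf, diagDir_mul_im,
      le_div_iff₀ (by positivity), zero_mul, sub_nonneg, mem_horizontalStrip]
  have hray : ∀ t : ℝ, 0 ≤ t → (t : ℂ) ∈ S := fun t ht => by
    rw [hmem]; simp [ht, hw.le]
  have hdir : ∀ a b : ℂ, ‖a‖ = 1 → (∀ t : ℝ, 0 ≤ t → a * t + b ∈ S) → a = 1 := by
    intro a b ha h
    have hb : ∀ t : ℝ, 0 ≤ t → 0 ≤ a.im * t + b.im ∧ a.im * t + b.im ≤ w ∧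
        a.im * t + b.im ≤ a.re * t + b.re := by
      intro t ht
      have := (hmem _).1 (h t ht)
      simpa [and_assoc] using this
    have him : a.im = 0 := by
      by_contra hne
      rcases lt_or_gt_of_ne hne with hlt | hgt
      · have hb0 : 0 ≤ (|b.im| + 1) / -a.im := div_nonneg (by positivity) (by linarith)
        have := (hb _ hb0).1
        have e : a.im * ((|b.im| + 1) / -a.im) = -(|b.im| + 1) := by field_simp
        rw [e] at this
        linarith [le_abs_self b.im]
      · have := (hb ((|b.im| + w + 1) / a.im) (by positivity)).2.1
        have e : a.im * ((|b.im| + w + 1) / a.im) = |b.im| + w + 1 := by field_simp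
        rw [e] at this
        linarith [neg_abs_le b.im]
    have hre2 : a.re ^ 2 = 1 := by
      have := norm_sq_eq a
      rw [ha, him] at this
      linarith
    have hre : a.re = 1 := by
      rcases sq_eq_one_iff.1 hre2 with h | h
      · exact h
      · exfalso
        have := hb (|b.re| + 1) (by positivity)
        rw [h, him] at this
        linarith [le_abs_self b.re]
    exact Complex.ext hre him
  have hint := interior_inter_placed_nonempty (K := horizontalStrip w) (L := upperHalf) (a := 1)
    (b := 0) (a' := diagDir) (b' := 0) (z := ⟨w, w / 2⟩) (by simp) norm_diagDir
    (mem_interior_horizontalStrip (by simpa using hw) (by simpa using hw))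
    (mem_interior_upperHalf
      (by rw [diagDir_mul_im]; exact div_pos (by simp only; linarith) (by positivity)))
  have h0 : (0 : ℂ) ∈ S := by rw [hmem]; simp [hw.le]
  have hW : (⟨w, w⟩ : ℂ) ∈ S := by rw [hmem]; simp [hw.le]
  rcases H 1 0 diagDir 0 (by simp) norm_diagDir hint with ⟨a, b, ha, hab, h⟩ | ⟨a, b, ha, h⟩
  · have ha1 := hdir a b ha fun t ht => (h t).2 (hray t ht)
    subst ha1
    have h1 := (hmem _).1 ((h 0).2 h0)
    have h2 := (hmem _).1 ((h _).2 hW)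
    have h3 := (hmem _).1 ((h (-b)).1 (by convert h0 using 1; simp))
    simp at h1 h2 h3
    exact hab.resolve_left (by simp) (Complex.ext (by simp; linarith) (by simp; linarith))
  · have ha1 := hdir a b ha fun t ht => by
      rw [← Complex.conj_ofReal t]; exact (h t).2 (hray t ht)
    subst ha1
    have h1 := (hmem _).1 ((h 0).2 h0)
    have h2 := (hmem _).1 ((h _).2 hW)
    have h3 := (hmem _).1 ((h (-conj b)).1 (by convert h0 using 1; simp))
    simp at h1 h2 h3
    linarith

/-- A segment of a disc that is smaller than a half disc has no centre of symmetry. -/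
lemma not_isPointSymmetric_segment {R h : ℝ} (h0 : 0 < h) (hR : h < R) {S : Set ℂ}
    (hS : ∀ z, z ∈ S ↔ z.re ^ 2 + z.im ^ 2 ≤ R ^ 2 ∧ h ≤ z.im) : ¬ IsPointSymmetric S := by
  rintro ⟨c, hc⟩
  set x := √(R ^ 2 - h ^ 2) with hx
  have hpos : 0 < R ^ 2 - h ^ 2 := by nlinarith
  have hxpos : 0 < x := Real.sqrt_pos.2 hpos
  have hx2 : x ^ 2 = R ^ 2 - h ^ 2 := Real.sq_sqrt hpos.le
  have hT := (hS _).1 ((hc ⟨0, R⟩).2 ((hS _).2 ⟨by simp, by simpa using hR.le⟩))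
  have hA := (hS _).1 ((hc ⟨x, h⟩).2 ((hS _).2 ⟨by simp only; linarith, le_rfl⟩))
  have hB := (hS _).1 ((hc ⟨-x, h⟩).2 ((hS _).2 ⟨by simp only; linarith, le_rfl⟩))
  simp only [Complex.sub_re, Complex.sub_im] at hT hA hB
  have h1 : R ≤ c.im - h := by linarith [hT.2]
  have h2 : R ^ 2 ≤ (c.im - h) ^ 2 := pow_le_pow_left₀ (by linarith) h1 2
  have h3 : (c.re - x) ^ 2 = 0 := le_antisymm (by linarith [hA.1]) (sq_nonneg _)
  have h4 : (c.re - -x) ^ 2 = 0 := le_antisymm (by linarith [hB.1]) (sq_nonneg _)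
  have h5 := pow_eq_zero_iff (two_ne_zero) |>.1 h3
  have h6 := pow_eq_zero_iff (two_ne_zero) |>.1 h4
  linarith

lemma not_disc_half {R : ℝ} (hR : 0 < R) :
    ¬ AllPlacements IsPointSymmetric (centredDisc R) upperHalf := by
  intro H
  refine not_isPointSymmetric_segment (R := R) (h := R / 2) (by linarith) (by linarith)
    (fun z => ?_) (H 1 0 1 (-(⟨0, R / 2⟩ : ℂ)) (by simp) (by simp)
      (interior_inter_placed_nonempty (z := ⟨0, 3 * R / 4⟩) (by simp) (by simp)
      (mem_interior_centredDisc (by simp; nlinarith)) (mem_interior_upperHalf (by simp; linarith))))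
  rw [mem_inter_iff, placed_one_zero, mem_placed, mem_centredDisc, mem_upperHalf]
  simp

lemma not_disc_strip {R w : ℝ} (hR : 0 < R) (hw : 0 < w) :
    ¬ AllPlacements IsPointSymmetric (centredDisc R) (horizontalStrip w) := by
  intro H
  set h := max (R / 2) (R - w / 2) with hh
  have h1 : R / 2 ≤ h := le_max_left _ _
  have h2 : R - w / 2 ≤ h := le_max_right _ _
  have h3 : h < R := max_lt (by linarith) (by linarith)
  refine not_isPointSymmetric_segment (R := R) (h := h) (by linarith) h3
    (fun z => ?_) (H 1 0 1 (-(⟨0, h⟩ : ℂ)) (by simp) (by simp)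
      (interior_inter_placed_nonempty (z := ⟨0, (R + h) / 2⟩) (by simp) (by simp)
      (mem_interior_centredDisc (by simp; nlinarith))
      (mem_interior_horizontalStrip (by simp; linarith) (by simp; linarith))))
  rw [mem_inter_iff, placed_one_zero, mem_placed, mem_centredDisc, mem_horizontalStrip]
  simp only [one_mul, Complex.add_im, Complex.neg_im]
  constructor
  · rintro ⟨a, b, -⟩
    exact ⟨a, by linarith⟩
  · rintro ⟨a, b⟩
    refine ⟨a, by linarith, ?_⟩
    have : z.im ≤ R := abs_le_of_sq_le_sq' (by nlinarith [sq_nonneg z.re]) hR.le |>.2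
    linarith

lemma not_half_half : ¬ AllPlacements IsPointSymmetric upperHalf upperHalf := by
  intro H
  obtain ⟨c, hc⟩ := H 1 0 1 0 (by simp) (by simp)
    (interior_inter_placed_nonempty (z := Complex.I) (by simp) (by simp)
      (mem_interior_upperHalf (by simp)) (mem_interior_upperHalf (by simp)))
  have := (hc ⟨0, |c.im| + 1⟩).2 (by simp [placed_one_zero, mem_upperHalf]; positivity)
  simp [placed_one_zero, mem_upperHalf] at this
  linarith [le_abs_self c.im]

lemma eq_radius_of_le {R R' : ℝ} (hR : 0 < R) (hRR : R ≤ R')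
    (H : AllPlacements IsPointSymmetric (centredDisc R) (centredDisc R')) : R = R' := by
  obtain ⟨c, hc⟩ := H 1 0 1 (-(⟨0, R'⟩ : ℂ)) (by simp) (by simp)
    (interior_inter_placed_nonempty (z := ⟨0, R / 2⟩) (by simp) (by simp)
      (mem_interior_centredDisc (by simp; nlinarith))
      (mem_interior_centredDisc (by simp; nlinarith)))
  set S := placed 1 0 (centredDisc R) ∩ placed 1 (-(⟨0, R'⟩ : ℂ)) (centredDisc R') with hS
  have hmem : ∀ z, z ∈ S ↔ z.re ^ 2 + z.im ^ 2 ≤ R ^ 2 ∧ z.re ^ 2 + z.im ^ 2 ≤ 2 * R' * z.im := by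
    intro z
    rw [hS, mem_inter_iff, placed_one_zero, mem_placed, mem_centredDisc, mem_centredDisc]
    refine and_congr_right fun _ => ?_
    simp only [one_mul, Complex.add_re, Complex.add_im, Complex.neg_re, Complex.neg_im]
    constructor <;> intro h <;> linarith
  have hR' : 0 < R' := by linarith
  have h1 := (hmem _).1 ((hc 0).2 ((hmem 0).2 (by simp; positivity)))
  have h2 := (hmem _).1 ((hc ⟨0, R⟩).2 ((hmem _).2 (by simp; nlinarith)))
  simp only [sub_zero, Complex.sub_re, Complex.sub_im] at h1 h2
  have e1 : R ≤ c.im := by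
    have : 0 ≤ 2 * R' * (c.im - R) := by
      nlinarith [h2.2, sq_nonneg c.re, sq_nonneg (c.im - R)]
    linarith [nonneg_of_mul_nonneg_right this (by linarith : 0 < 2 * R')]
  have e2 : R ^ 2 ≤ c.im ^ 2 := pow_le_pow_left₀ hR.le e1 2
  have e3 : c.re = 0 := pow_eq_zero_iff two_ne_zero |>.1
    (le_antisymm (by linarith [h1.1]) (sq_nonneg c.re))
  have e4 : c.im = R := le_antisymm
    (abs_le_of_sq_le_sq' (by nlinarith [h1.1, sq_nonneg c.re]) hR.le).2 e1
  -- a common point of the two circles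
  set y := R ^ 2 / (2 * R') with hy
  have hyR : 2 * R' * y = R ^ 2 := by rw [hy]; field_simp
  have hypos : 0 < y := by positivity
  have hyle : y ≤ R := by
    rw [hy, div_le_iff₀ (by positivity)]; nlinarith
  have hpos : 0 ≤ R ^ 2 - y ^ 2 := by nlinarith
  have hx2 := Real.sq_sqrt hpos
  have h3 := (hmem _).1 ((hc ⟨√(R ^ 2 - y ^ 2), y⟩).2 ((hmem _).2 (by
    simp only; constructor <;> linarith)))
  simp only [Complex.sub_re, Complex.sub_im, e3, e4] at h3
  have h4 : R ^ 2 ≤ 2 * R * y := by nlinarith [h3.1]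
  have h5 : R ≤ 2 * y := by nlinarith
  have h6 : R' * R ≤ R * R := by nlinarith
  exact le_antisymm hRR (le_of_mul_le_mul_right h6 hR)

lemma eq_radius {R R' : ℝ} (hR : 0 < R) (hR' : 0 < R')
    (H : AllPlacements IsPointSymmetric (centredDisc R) (centredDisc R')) : R = R' := by
  rcases le_total R R' with h | h
  · exact eq_radius_of_le hR h H
  · exact (eq_radius_of_le hR' h H.symm).symm

/-- If the parallelogram in which two crossing strips meet has an orientation reversing symmetry,
then this symmetry preserves the longer diagonal, so the parallelogram is a rhombus. -/
lemma eq_width {w v : ℝ} (hw : 0 < w) (hv : 0 < v)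
    (H : AllPlacements IsLineSymmetric (horizontalStrip w) (horizontalStrip v)) : w = v := by
  have h2 : 0 < √2 := by positivity
  have hsq2 : √2 ^ 2 = 2 := Real.sq_sqrt (by norm_num)
  obtain ⟨a, b, ha, h⟩ := (H 1 0 diagDir 0 (by simp) norm_diagDir
    (interior_inter_placed_nonempty (z := ⟨√2 * v / 2 + w / 2, w / 2⟩) (by simp) norm_diagDir
      (mem_interior_horizontalStrip (by simpa using hw) (by simpa using hw))
      (mem_interior_horizontalStrip
        (by rw [diagDir_mul_im]; simp only [add_sub_cancel_right]; positivity)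
        (by rw [diagDir_mul_im, div_lt_iff₀ h2]; simp only [add_sub_cancel_right]; nlinarith))
    )).exists_conj
  set S := placed 1 0 (horizontalStrip w) ∩ placed diagDir 0 (horizontalStrip v) with hS
  set l := √2 * v with hl
  have hlpos : 0 < l := by positivity
  have hmem : ∀ z, z ∈ S ↔ (0 ≤ z.im ∧ z.im ≤ w) ∧ 0 ≤ z.re - z.im ∧ z.re - z.im ≤ l := by
    intro z
    rw [hS, mem_inter_iff, placed_one_zero, mem_placed, mem_horizontalStrip,
      mem_horizontalStrip, diagDir_mul_im, le_div_iff₀ h2, zero_mul, div_le_iff₀ h2, hl,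
      mul_comm √2 v]
  set D : ℂ := ⟨l + w, w⟩ with hD
  have hcentral : ∀ z, D - z ∈ S → z ∈ S := by
    intro z hz
    have := (hmem _).1 hz
    rw [hmem]
    simp only [hD, Complex.sub_re, Complex.sub_im] at this
    refine ⟨⟨?_, ?_⟩, ?_, ?_⟩ <;> linarith [this.1.1, this.1.2, this.2.1, this.2.2]
  have h0S : (0 : ℂ) ∈ S := by rw [hmem]; simp [hw.le, hlpos.le]
  have hDS : D ∈ S := by rw [hmem]; simp [hD, hw.le, hlpos.le]
  -- the end points of the longer diagonal are the only points at their distance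
  have hdiam : ∀ X ∈ S, ∀ Y ∈ S, ‖X - Y‖ = ‖D‖ → (X = 0 ∧ Y = D) ∨ (X = D ∧ Y = 0) := by
    intro X hX Y hY hXY
    obtain ⟨⟨x1, x2⟩, x3, x4⟩ := (hmem X).1 hX
    obtain ⟨⟨y1, y2⟩, y3, y4⟩ := (hmem Y).1 hY
    have e := congrArg (· ^ 2) hXY
    simp only [norm_sq_eq, hD, Complex.sub_re, Complex.sub_im] at e
    set m := X.im - Y.im with hm
    set n := (X.re - X.im) - (Y.re - Y.im) with hn
    have er : X.re - Y.re = n + m := by rw [hn, hm]; ring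
    rw [er] at e
    have m1 : m ≤ w := by linarith
    have m2 : -w ≤ m := by linarith
    have n1 : n ≤ l := by linarith
    have n2 : -l ≤ n := by linarith
    have q1 : m ^ 2 ≤ w ^ 2 := sq_le_sq' m2 m1
    have q2 : n ^ 2 ≤ l ^ 2 := sq_le_sq' n2 n1
    have q3 : n * m ≤ l * w := by
      have := abs_mul n m
      have h5 : |n| * |m| ≤ l * w := mul_le_mul (abs_le.2 ⟨n2, n1⟩) (abs_le.2 ⟨m2, m1⟩)
        (abs_nonneg _) hlpos.le
      linarith [le_abs_self (n * m)]
    have r1 : m ^ 2 = w ^ 2 := by linarith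
    have r3 : n * m = l * w := by linarith
    rcases sq_eq_sq_iff_eq_or_eq_neg.1 r1 with hmw | hmw
    · right
      have hnl : n = l := mul_right_cancel₀ hw.ne' (by rw [← r3, hmw])
      constructor
      · apply Complex.ext <;> simp only [hD] <;> linarith
      · apply Complex.ext <;> simp <;> linarith
    · left
      have hnl : n = -l := mul_right_cancel₀ hw.ne' (by rw [hmw] at r3; linarith)
      constructor
      · apply Complex.ext <;> simp <;> linarith
      · apply Complex.ext <;> simp only [hD] <;> linarith
  have hDn : ‖D‖ ^ 2 = (l + w) ^ 2 + w ^ 2 := by rw [norm_sq_eq]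
  have hDpos : 0 < (l + w) ^ 2 + w ^ 2 := by positivity
  have hDD : conj D * D = ((l + w) ^ 2 + w ^ 2 : ℝ) := by
    rw [mul_comm, Complex.mul_conj, Complex.normSq_apply]
    simp only [hD]; push_cast; ring
  have hD0 : conj D ≠ 0 := by
    intro h
    rw [h, zero_mul] at hDD
    exact hDpos.ne' (by exact_mod_cast hDD.symm)
  -- up to the central symmetry of the parallelogram, the symmetry fixes both end points
  have hfix : ∃ a : ℂ, a * conj D = D ∧ ∀ z ∈ S, a * conj z ∈ S := by
    have hd := hdiam _ ((h 0).2 h0S) _ ((h D).2 hDS) (by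
      rw [map_zero, mul_zero, zero_add, ← norm_neg]
      simp [ha])
    rw [map_zero, mul_zero, zero_add] at hd
    rcases hd with ⟨hb, hbD⟩ | ⟨hb, hbD⟩
    · subst hb
      exact ⟨a, by simpa using hbD, fun z hz => by simpa using (h z).2 hz⟩
    · subst hb
      refine ⟨-a, by linear_combination -hbD, fun z hz => hcentral _ ?_⟩
      have := (h z).2 hz
      convert this using 1
      ring
  obtain ⟨a, haD, haS⟩ := hfix
  have haeq : a * (((l + w) ^ 2 + w ^ 2 : ℝ) : ℂ) = D ^ 2 := by
    rw [← hDD]; linear_combination D * haD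
  set N := (l + w) ^ 2 + w ^ 2 with hN
  have ere := congrArg Complex.re haeq
  have eim := congrArg Complex.im haeq
  rw [Complex.re_mul_ofReal] at ere
  rw [Complex.im_mul_ofReal] at eim
  simp only [hD, sq, Complex.mul_re, Complex.mul_im] at ere eim
  obtain ⟨⟨-, h1⟩, -, h3⟩ := (hmem _).1 (haS ⟨w, w⟩ (by rw [hmem]; simp [hw.le, hlpos.le]))
  obtain ⟨⟨-, g1⟩, -, -⟩ := (hmem _).1 (haS ⟨l, 0⟩ (by rw [hmem]; simp [hw.le, hlpos.le]))
  simp only [Complex.mul_re, Complex.mul_im, Complex.conj_re, Complex.conj_im] at h1 h3 g1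
  have k1 : 2 * w ^ 2 ≤ l ^ 2 := by
    have h4 : (a.re * w - a.im * -w - (a.re * -w + a.im * w)) * N ≤ l * N :=
      mul_le_mul_of_nonneg_right h3 hDpos.le
    have h5 : 2 * w * (a.re * N) ≤ l * N := by linarith
    rw [ere, hN] at h5
    have h6 : l * (2 * w ^ 2) ≤ l * l ^ 2 := by nlinarith
    exact le_of_mul_le_mul_left h6 hlpos
  have k2 : l ^ 2 ≤ 2 * w ^ 2 := by
    have h4 : (a.re * -0 + a.im * l) * N ≤ w * N := mul_le_mul_of_nonneg_right g1 hDpos.le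
    have h5 : l * (a.im * N) ≤ w * N := by linarith
    rw [eim, hN] at h5
    have h6 : w * l ^ 2 ≤ w * (2 * w ^ 2) := by nlinarith
    exact le_of_mul_le_mul_left h6 hw
  have k3 : l ^ 2 = 2 * v ^ 2 := by rw [hl, mul_pow, hsq2]
  exact (sq_eq_sq₀ hw.le hv.le).1 (by linarith)

/-! ### The pairs with symmetric intersections -/

lemma placed_centredDisc {a b : ℂ} (ha : ‖a‖ = 1) {R : ℝ} (hR : 0 < R) {z : ℂ} :
    z ∈ placed a b (centredDisc R) ↔ ‖z - -(conj a * b)‖ ≤ R := by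
  have e : a * z + b = a * (z - -(conj a * b)) := by
    rw [sub_neg_eq_add, mul_add, ← mul_assoc, mul_conj_of_norm_eq_one ha, one_mul]
  rw [mem_placed, mem_centredDisc, ← norm_sq_eq, sq_le_sq₀ (norm_nonneg _) hR.le, e, norm_mul, ha,
    one_mul]

/-- The reflection in a line through `p` in direction `e` preserves the distances from the points
of this line. -/
lemma norm_reflect_sub {p e : ℂ} (he : ‖e‖ = 1) (t : ℝ) (z : ℂ) :
    ‖p + e ^ 2 * conj (z - p) - (p + t * e)‖ = ‖z - (p + t * e)‖ := by
  have e1 : p + e ^ 2 * conj (z - p) - (p + t * e) = e ^ 2 * conj (z - (p + t * e)) := by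
    simp only [map_sub, map_add, map_mul, Complex.conj_ofReal]
    linear_combination ((t : ℂ) * e) * mul_conj_of_norm_eq_one he
  rw [e1, norm_mul, norm_pow, he, RCLike.norm_conj]
  ring

lemma exists_sq_eq {u : ℂ} (hu : ‖u‖ = 1) : ∃ e : ℂ, ‖e‖ = 1 ∧ e ^ 2 = u := by
  obtain ⟨e, he⟩ := IsAlgClosed.exists_pow_nat_eq u (n := 2) (by norm_num)
  refine ⟨e, ?_, he⟩
  rw [← sq_eq_sq₀ (norm_nonneg _) zero_le_one, ← norm_pow, he, hu, one_pow]

lemma disc_disc_isLineSymmetric {R R' : ℝ} (hR : 0 < R) (hR' : 0 < R') :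
    AllPlacements IsLineSymmetric (centredDisc R) (centredDisc R') := by
  intro a b a' b' ha ha' _
  set o := -(conj a * b) with ho
  set o' := -(conj a' * b') with ho'
  obtain ⟨e, t, he, hte⟩ : ∃ (e : ℂ) (t : ℝ), ‖e‖ = 1 ∧ o' = o + t * e := by
    by_cases h : o' = o
    · exact ⟨1, 0, by simp, by simp [h]⟩
    · have hn : ‖o' - o‖ ≠ 0 := by simpa [sub_eq_zero] using h
      have hn' : (‖o' - o‖ : ℂ) ≠ 0 := by exact_mod_cast hn
      exact ⟨(o' - o) / ‖o' - o‖, ‖o' - o‖, by simp [sub_ne_zero.2 h], by field_simp; ring⟩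
  refine ⟨o, e, he, fun z => ?_⟩
  rw [mem_inter_iff, mem_inter_iff, placed_centredDisc ha hR, placed_centredDisc ha hR,
    placed_centredDisc ha' hR', placed_centredDisc ha' hR', ← ho, ← ho', hte, norm_reflect_sub he]
  have := norm_reflect_sub (p := o) he 0 z
  simp only [Complex.ofReal_zero, zero_mul, add_zero] at this
  rw [this]

/-- A reflection in a line through a point at which the functionals `z ↦ (a * z + b).im` and
`z ↦ (a' * z + b').im` agree carries the second one to the first one, if it does so with their
linear parts. -/
lemma im_reflect {a e p : ℂ} {a' b b' : ℂ} (hae : a * e ^ 2 = -conj a')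
    (hp : (a * p + b).im = (a' * p + b').im) (z : ℂ) :
    (a * (p + e ^ 2 * conj (z - p)) + b).im = (a' * z + b').im := by
  have e1 : a * (p + e ^ 2 * conj (z - p)) + b = (a * p + b) - conj (a' * (z - p)) := by
    rw [map_mul]; linear_combination conj (z - p) * hae
  rw [e1, Complex.sub_im, Complex.conj_im, hp]
  simp only [Complex.add_im, mul_sub, Complex.sub_im]
  ring

lemma exists_normal_sq {a : ℂ} (ha : ‖a‖ = 1) : ‖Complex.I * conj a‖ = 1 ∧
    a * (Complex.I * conj a) ^ 2 = -conj a := by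
  refine ⟨by simp [ha], ?_⟩
  rw [mul_pow, Complex.I_sq]
  linear_combination (-conj a) * mul_conj_of_norm_eq_one ha

lemma disc_isLineSymmetric {R : ℝ} (hR : 0 < R) (I : Set ℝ) :
    AllPlacements IsLineSymmetric (centredDisc R) {z | z.im ∈ I} := by
  intro a b a' b' ha ha' _
  obtain ⟨he, hae⟩ := exists_normal_sq ha'
  refine ⟨-(conj a * b), Complex.I * conj a', he, fun z => ?_⟩
  have := norm_reflect_sub (p := -(conj a * b)) he 0 z
  simp only [Complex.ofReal_zero, zero_mul, add_zero] at this
  rw [mem_inter_iff, mem_inter_iff, placed_centredDisc ha hR, placed_centredDisc ha hR, this,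
    mem_placed, mem_placed, mem_ofPred_eq, mem_ofPred_eq, im_reflect hae rfl]

lemma isLineSymmetric_of_im (I : Set ℝ) :
    AllPlacements IsLineSymmetric {z | z.im ∈ I} {z | z.im ∈ I} := by
  intro a b a' b' ha ha' _
  by_cases h : a = a'
  · subst h
    obtain ⟨he, hae⟩ := exists_normal_sq ha
    refine ⟨0, Complex.I * conj a, he, fun z => ?_⟩
    rw [mem_inter_iff, mem_inter_iff, mem_placed, mem_placed, mem_placed, mem_placed,
      mem_ofPred_eq, mem_ofPred_eq, mem_ofPred_eq, mem_ofPred_eq, im_reflect hae rfl,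
      im_reflect hae rfl]
  · -- the reflection interchanging the two sets
    obtain ⟨e, he, hee⟩ := exists_sq_eq (u := -conj (a * a')) (by simp [ha, ha'])
    have h1 : a * e ^ 2 = -conj a' := by
      rw [hee, map_mul]
      linear_combination (-conj a') * mul_conj_of_norm_eq_one ha
    have h2 : a' * e ^ 2 = -conj a := by
      rw [hee, map_mul]
      linear_combination (-conj a) * mul_conj_of_norm_eq_one ha'
    have hn : Complex.normSq (a - a') ≠ 0 := by
      simpa [Complex.normSq_eq_zero, sub_eq_zero] using h
    obtain ⟨p, hp⟩ : ∃ p : ℂ, ((a - a') * p).im = b'.im - b.im := by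
      refine ⟨conj (a - a') * (((b'.im - b.im) / Complex.normSq (a - a') : ℝ) * Complex.I), ?_⟩
      rw [← mul_assoc, Complex.mul_conj, ← mul_assoc, ← Complex.ofReal_mul,
        mul_div_cancel₀ _ hn, Complex.im_ofReal_mul]
      simp
    have hp' : (a * p + b).im = (a' * p + b').im := by
      rw [sub_mul, Complex.sub_im] at hp
      simp only [Complex.add_im]
      linarith
    refine ⟨p, e, he, fun z => ?_⟩
    rw [mem_inter_iff, mem_inter_iff, mem_placed, mem_placed, mem_placed, mem_placed,
      mem_ofPred_eq, mem_ofPred_eq, mem_ofPred_eq, mem_ofPred_eq, im_reflect h1 hp',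
      im_reflect h2 hp'.symm, and_comm]

lemma disc_disc_isPointSymmetric {R : ℝ} (hR : 0 < R) :
    AllPlacements IsPointSymmetric (centredDisc R) (centredDisc R) := by
  intro a b a' b' ha ha' _
  refine ⟨-(conj a * b) + -(conj a' * b'), fun z => ?_⟩
  rw [mem_inter_iff, mem_inter_iff, placed_centredDisc ha hR, placed_centredDisc ha hR,
    placed_centredDisc ha' hR, placed_centredDisc ha' hR]
  have e1 : -(conj a * b) + -(conj a' * b') - z - -(conj a * b) = -(z - -(conj a' * b')) := by ring
  have e2 : -(conj a * b) + -(conj a' * b') - z - -(conj a' * b') = -(z - -(conj a * b)) := by ring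
  rw [e1, e2, norm_neg, norm_neg, and_comm]

lemma strip_strip_isPointSymmetric (w v : ℝ) :
    AllPlacements IsPointSymmetric (horizontalStrip w) (horizontalStrip v) := by
  intro a b a' b' ha ha' _
  have key : ∀ c z : ℂ, (a * (c - z) + b).im = (a * c).im + 2 * b.im - (a * z + b).im ∧
      (a' * (c - z) + b').im = (a' * c).im + 2 * b'.im - (a' * z + b').im := by
    intro c z
    simp only [Complex.add_im, mul_sub, Complex.sub_im]
    constructor <;> ring
  have ha2 : a.re ^ 2 + a.im ^ 2 = 1 := by rw [← norm_sq_eq, ha]; norm_num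
  set Δ := a.im * a'.re - a.re * a'.im with hΔ
  by_cases h : Δ = 0
  · -- the strips are parallel
    set ε := a.re * a'.re + a.im * a'.im with hε
    have hε2 : ε ^ 2 = 1 := by
      have ha2' : a'.re ^ 2 + a'.im ^ 2 = 1 := by rw [← norm_sq_eq, ha']; norm_num
      have : ε ^ 2 + Δ ^ 2 = 1 := by
        rw [hε, hΔ]; linear_combination (a'.re ^ 2 + a'.im ^ 2) * ha2 + ha2'
      rw [h] at this
      linarith
    have haa : a' = ε * a := by
      apply Complex.ext
      · rw [Complex.re_ofReal_mul, hε]; linear_combination (-a'.re) * ha2 + a.im * h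
      · rw [Complex.im_ofReal_mul, hε]; linear_combination (-a'.im) * ha2 - a.re * h
    have him : ∀ z, (a' * z).im = ε * (a * z).im := fun z => by
      rw [haa, mul_assoc, Complex.im_ofReal_mul]
    obtain ⟨lo, hi, hlh⟩ : ∃ lo hi : ℝ, ∀ s : ℝ, (0 ≤ ε * s + b'.im ∧ ε * s + b'.im ≤ v) ↔
        (lo ≤ s ∧ s ≤ hi) := by
      rcases sq_eq_one_iff.1 hε2 with h1 | h1
      · refine ⟨-b'.im, v - b'.im, fun s => ?_⟩
        rw [h1]
        constructor <;> rintro ⟨_, _⟩ <;> constructor <;> linarith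
      · refine ⟨b'.im - v, b'.im, fun s => ?_⟩
        rw [h1]
        constructor <;> rintro ⟨_, _⟩ <;> constructor <;> linarith
    set lo' := max lo (-b.im)
    set hi' := min hi (w - b.im)
    have hmem : ∀ z, z ∈ placed a b (horizontalStrip w) ∩ placed a' b' (horizontalStrip v) ↔
        lo' ≤ (a * z).im ∧ (a * z).im ≤ hi' := by
      intro z
      rw [mem_inter_iff, mem_placed, mem_placed, mem_horizontalStrip, mem_horizontalStrip,
        Complex.add_im, Complex.add_im, him, hlh, max_le_iff, le_min_iff]
      constructor
      · rintro ⟨⟨_, _⟩, _, _⟩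
        refine ⟨⟨?_, ?_⟩, ?_, ?_⟩ <;> linarith
      · rintro ⟨⟨_, _⟩, _, _⟩
        refine ⟨⟨?_, ?_⟩, ?_, ?_⟩ <;> linarith
    refine ⟨conj a * (((lo' + hi' : ℝ) : ℂ) * Complex.I), fun z => ?_⟩
    have e : (a * (conj a * (((lo' + hi' : ℝ) : ℂ) * Complex.I) - z)).im
        = lo' + hi' - (a * z).im := by
      rw [mul_sub, ← mul_assoc, mul_conj_of_norm_eq_one ha, one_mul, Complex.sub_im,
        Complex.im_ofReal_mul]
      simp
    rw [hmem, hmem, e]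
    constructor <;> rintro ⟨_, _⟩ <;> constructor <;> linarith
  · -- the common centre of the two strips
    set α := w - 2 * b.im with hα
    set β := v - 2 * b'.im with hβ
    set c : ℂ := ⟨(a'.re * α - a.re * β) / Δ, (a.im * β - a'.im * α) / Δ⟩ with hc
    have c1 : (a * c).im = α := by
      simp only [hc, Complex.mul_im]; field_simp; rw [hΔ]; ring
    have c2 : (a' * c).im = β := by
      simp only [hc, Complex.mul_im]; field_simp; rw [hΔ]; ring
    refine ⟨c, fun z => ?_⟩
    rw [mem_inter_iff, mem_inter_iff, mem_placed, mem_placed, mem_placed, mem_placed,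
      mem_horizontalStrip, mem_horizontalStrip, mem_horizontalStrip, mem_horizontalStrip,
      (key c z).1, (key c z).2, c1, c2, hα, hβ]
    constructor
    · rintro ⟨⟨_, _⟩, _, _⟩
      refine ⟨⟨?_, ?_⟩, ?_, ?_⟩ <;> linarith
    · rintro ⟨⟨_, _⟩, _, _⟩
      refine ⟨⟨?_, ?_⟩, ?_, ?_⟩ <;> linarith

/-! ### Complex coordinates on the plane -/

/-- The identification of the complex numbers with the Euclidean plane. -/
noncomputable def toPlane : ℂ ≃ₗᵢ[ℝ] Plane := Complex.orthonormalBasisOneI.repr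

/-- The set of complex coordinates of the points of a subset of the plane. -/
def coords (S : Set Plane) : Set ℂ := toPlane ⁻¹' S

lemma mem_coords {S : Set Plane} {z : ℂ} : z ∈ coords S ↔ toPlane z ∈ S := Iff.rfl

lemma coords_injective : Function.Injective coords := fun S T h => by
  ext x
  rw [← toPlane.apply_symm_apply x, ← mem_coords, h, mem_coords]

lemma interior_coords (S : Set Plane) : interior (coords S) = coords (interior S) :=
  (toPlane.toHomeomorph.preimage_interior S).symm

lemma coords_nonempty {S : Set Plane} : (coords S).Nonempty ↔ S.Nonempty :=
  ⟨fun ⟨z, hz⟩ => ⟨_, hz⟩, fun ⟨x, hx⟩ => ⟨toPlane.symm x, by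
    rwa [mem_coords, toPlane.apply_symm_apply]⟩⟩

lemma isProperConvex_coords {K : Set Plane} (hc : IsClosed K) (hv : Convex ℝ K)
    (hi : (interior K).Nonempty) (hu : K ≠ univ) : IsProperConvex (coords K) := by
  refine ⟨hc.preimage toPlane.continuous, hv.linear_preimage toPlane.toLinearEquiv.toLinearMap, ?_,
    fun h => hu (coords_injective h)⟩
  rw [interior_coords]
  exact coords_nonempty.2 hi

/-- A congruence of the plane is given by `z ↦ a * z + b` or by `z ↦ a * conj z + b`, according
to its effect on the orientation. -/
lemma exists_formula (φ : PlaneCongruence) : ∃ a b : ℂ, ‖a‖ = 1 ∧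
    ((OrientationPreserving φ ∧ ∀ z, φ (toPlane z) = toPlane (a * z + b)) ∨
      (¬ OrientationPreserving φ ∧ ∀ z, φ (toPlane z) = toPlane (a * conj z + b))) := by
  set g : ℂ ≃ₗᵢ[ℝ] ℂ := toPlane.trans (φ.linearIsometryEquiv.trans toPlane.symm) with hg
  have hφ : ∀ z, φ (toPlane z) = toPlane (g z + toPlane.symm (φ 0)) := by
    intro z
    have := φ.map_vadd 0 (toPlane z)
    rw [vadd_eq_add, vadd_eq_add, add_zero] at this
    rw [this, map_add, hg]
    simp
  have hdet : LinearMap.det (φ.linearIsometryEquiv.toLinearEquiv : Plane →ₗ[ℝ] Plane)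
      = LinearMap.det (g.toLinearEquiv : ℂ →ₗ[ℝ] ℂ) :=
    (LinearMap.det_conj (φ.linearIsometryEquiv.toLinearEquiv : Plane →ₗ[ℝ] Plane)
      toPlane.toLinearEquiv.symm).symm
  obtain ⟨a, ha | ha⟩ := linear_isometry_complex g
  · refine ⟨a, toPlane.symm (φ 0), a.norm_coe, Or.inl ⟨?_, fun z => ?_⟩⟩
    · rw [OrientationPreserving, hdet, ha, det_rotation]
      norm_num
    · rw [hφ, ha, rotation_apply]
  · refine ⟨a, toPlane.symm (φ 0), a.norm_coe, Or.inr ⟨?_, fun z => ?_⟩⟩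
    · have : ((Complex.conjLIE.trans (rotation a)).toLinearEquiv : ℂ →ₗ[ℝ] ℂ)
          = ((rotation a).toLinearEquiv : ℂ →ₗ[ℝ] ℂ) ∘ₗ
            (Complex.conjLIE.toLinearEquiv : ℂ →ₗ[ℝ] ℂ) := rfl
      rw [OrientationPreserving, hdet, ha, this, LinearMap.det_comp, det_rotation,
        Complex.det_conjLIE]
      norm_num
    · rw [hφ, ha]
      simp [rotation_apply]

lemma exists_congruence (g : ℂ ≃ₗᵢ[ℝ] ℂ) (b : ℂ) :
    ∃ φ : PlaneCongruence, ∀ z, φ (toPlane z) = toPlane (g z + b) := by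
  refine ⟨toPlane.symm.toAffineIsometryEquiv.trans (g.toAffineIsometryEquiv.trans
    ((AffineIsometryEquiv.constVAdd ℝ ℂ b).trans toPlane.toAffineIsometryEquiv)), fun z => ?_⟩
  simp [add_comm]

lemma exists_motion {a : ℂ} (ha : ‖a‖ = 1) (b : ℂ) :
    ∃ φ : PlaneCongruence, OrientationPreserving φ ∧ ∀ z, φ (toPlane z) = toPlane (a * z + b) := by
  obtain ⟨u, rfl⟩ : ∃ u : Circle, (u : ℂ) = a := ⟨⟨a, mem_sphere_zero_iff_norm.2 ha⟩, rfl⟩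
  obtain ⟨φ, hφ⟩ := exists_congruence (rotation u) b
  have hφ' : ∀ z, φ (toPlane z) = toPlane (u * z + b) := fun z => by rw [hφ, rotation_apply]
  refine ⟨φ, ?_, hφ'⟩
  obtain ⟨a', b', -, h | h⟩ := exists_formula φ
  · exact h.1
  · exfalso
    have e : ∀ z, u * z + b = a' * conj z + b' := fun z =>
      toPlane.injective (by rw [← hφ', h.2])
    have e0 := e 0
    have e1 := e 1
    have e2 := e Complex.I
    simp only [map_zero, mul_zero, zero_add, map_one, mul_one, Complex.conj_I] at e0 e1 e2
    have e3 : (u : ℂ) * (2 * Complex.I) = 0 := by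
      linear_combination e2 + Complex.I * e1 - (1 + Complex.I) * e0
    exact (mul_eq_zero.1 e3).elim (ne_zero_of_norm_eq_one ha) (by simp)

lemma exists_reversing {a : ℂ} (ha : ‖a‖ = 1) (b : ℂ) :
    ∃ φ : PlaneCongruence, ∀ z, φ (toPlane z) = toPlane (a * conj z + b) := by
  obtain ⟨u, rfl⟩ : ∃ u : Circle, (u : ℂ) = a := ⟨⟨a, mem_sphere_zero_iff_norm.2 ha⟩, rfl⟩
  obtain ⟨φ, hφ⟩ := exists_congruence (Complex.conjLIE.trans (rotation u)) b
  exact ⟨φ, fun z => by rw [hφ]; simp [rotation_apply]⟩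

lemma coords_image {φ : PlaneCongruence} {a b : ℂ} (ha : ‖a‖ = 1)
    (h : ∀ z, φ (toPlane z) = toPlane (a * z + b)) (K : Set Plane) :
    coords (φ '' K) = placed (conj a) (-(conj a * b)) (coords K) := by
  ext z
  have : toPlane z = φ (toPlane (conj a * z + -(conj a * b))) := by
    rw [h, ← sub_eq_add_neg, ← mul_sub, mul_conj_mul_sub_add ha]
  rw [mem_coords, this, φ.injective.mem_set_image, mem_placed, mem_coords]

lemma coords_inter (S T : Set Plane) : coords (S ∩ T) = coords S ∩ coords T := rfl

lemma allIntersectionsSatisfy_iff {P : Set Plane → Prop} {P' : Set ℂ → Prop}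
    (hP : ∀ S, P S ↔ P' (coords S)) (K L : Set Plane) :
    AllIntersectionsSatisfy P K L ↔ AllPlacements P' (coords K) (coords L) := by
  constructor
  · intro H a b a' b' ha ha' hi
    have hc : ∀ {a : ℂ}, ‖a‖ = 1 → ‖conj a‖ = 1 := fun h => by rw [RCLike.norm_conj, h]
    obtain ⟨φ, hφ, hφz⟩ := exists_motion (hc ha) (-(conj a * b))
    obtain ⟨ψ, hψ, hψz⟩ := exists_motion (hc ha') (-(conj a' * b'))
    have hsimp : ∀ {a : ℂ}, ‖a‖ = 1 → ∀ b, -(conj (conj a) * -(conj a * b)) = b := fun h b => by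
      rw [Complex.conj_conj, mul_neg, neg_neg, ← mul_assoc, mul_conj_of_norm_eq_one h, one_mul]
    have e1 := coords_image (hc ha) hφz K
    have e2 := coords_image (hc ha') hψz L
    rw [hsimp ha, Complex.conj_conj] at e1
    rw [hsimp ha', Complex.conj_conj] at e2
    rw [← e1, ← e2, ← coords_inter] at hi ⊢
    rw [interior_coords, coords_nonempty] at hi
    exact (hP _).1 (H φ ψ hφ hψ hi)
  · intro H φ ψ hφ hψ hi
    obtain ⟨a, b, ha, h | h⟩ := exists_formula φ
    swap
    · exact absurd hφ h.1
    obtain ⟨a', b', ha', h' | h'⟩ := exists_formula ψ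
    swap
    · exact absurd hψ h'.1
    rw [← coords_nonempty, ← interior_coords] at hi
    rw [hP]
    rw [coords_inter, coords_image ha h.2, coords_image ha' h'.2] at hi ⊢
    exact H _ _ _ _ (by rwa [RCLike.norm_conj]) (by rwa [RCLike.norm_conj]) hi

lemma image_eq_iff (σ : PlaneCongruence) (S : Set Plane) {τ : ℂ → ℂ}
    (h : ∀ z, σ (toPlane z) = toPlane (τ z)) : σ '' S = S ↔ ∀ z, τ z ∈ coords S ↔ z ∈ coords S := by
  constructor
  · intro e z
    rw [mem_coords, ← h, mem_coords]
    conv_lhs => rw [← e]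
    exact σ.injective.mem_set_image
  · intro e
    ext x
    obtain ⟨y, rfl⟩ := σ.surjective x
    obtain ⟨z, rfl⟩ := toPlane.surjective y
    rw [σ.injective.mem_set_image, h, ← mem_coords, ← mem_coords, e]

lemma hasNontrivialSymmetry_iff (S : Set Plane) :
    HasNontrivialSymmetry S ↔ HasIsometricSymmetry (coords S) := by
  constructor
  · rintro ⟨σ, hσ, e⟩
    obtain ⟨a, b, ha, h | h⟩ := exists_formula σ
    · refine Or.inl ⟨a, b, ha, ?_, (image_eq_iff σ S h.2).1 e⟩
      by_contra hcon
      rw [not_or, not_not, not_not] at hcon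
      refine hσ (AffineIsometryEquiv.ext fun x => ?_)
      obtain ⟨z, rfl⟩ := toPlane.surjective x
      rw [h.2, hcon.1, hcon.2]
      simp
    · exact Or.inr ⟨a, b, ha, (image_eq_iff σ S h.2).1 e⟩
  · rintro (⟨a, b, ha, hab, h⟩ | ⟨a, b, ha, h⟩)
    · obtain ⟨σ, -, hσ⟩ := exists_motion ha b
      refine ⟨σ, fun e => ?_, (image_eq_iff σ S hσ).2 h⟩
      have e' : ∀ z, a * z + b = z := fun z =>
        toPlane.injective (by rw [← hσ, e]; simp)
      have e0 := e' 0
      have e1 := e' 1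
      rw [mul_zero, zero_add] at e0
      rw [mul_one, e0, add_zero] at e1
      exact hab.elim (fun h => h e1) fun h => h e0
    · obtain ⟨σ, hσ⟩ := exists_reversing ha b
      refine ⟨σ, fun e => ?_, (image_eq_iff σ S hσ).2 h⟩
      have e' : ∀ z, a * conj z + b = z := fun z =>
        toPlane.injective (by rw [← hσ, e]; simp)
      have e0 := e' 0
      have e1 := e' 1
      have e2 := e' Complex.I
      rw [map_zero, mul_zero, zero_add] at e0
      rw [map_one, mul_one, e0, add_zero] at e1
      rw [e0, e1, Complex.conj_I] at e2
      have := congrArg Complex.im e2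
      norm_num at this

lemma isCentrallySymmetric_iff (S : Set Plane) :
    IsCentrallySymmetric S ↔ IsPointSymmetric (coords S) := by
  have key : ∀ c z : ℂ, AffineIsometryEquiv.pointReflection ℝ (toPlane c) (toPlane z)
      = toPlane (2 * c - z) := by
    intro c z
    rw [AffineIsometryEquiv.pointReflection_apply, vsub_eq_sub, vadd_eq_add, ← map_sub, ← map_add]
    congr 1
    ring
  constructor
  · rintro ⟨c, hc⟩
    obtain ⟨c, rfl⟩ := toPlane.surjective c
    exact ⟨2 * c, (image_eq_iff _ S (key c)).1 hc⟩
  · rintro ⟨c, hc⟩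
    exact ⟨toPlane (c / 2), (image_eq_iff _ S (key (c / 2))).2 (by
      simpa [mul_div_cancel₀] using hc)⟩

lemma inner_toPlane (v z : ℂ) : inner ℝ (toPlane v) (toPlane z) = (conj v * z).re := by
  rw [LinearIsometryEquiv.inner_map_map, Complex.inner, mul_comm]

lemma reflection_line {p e : ℂ} {s : ℝ} (he : ‖e‖ = 1) (hs : s ≠ 0) (z : ℂ) :
    EuclideanGeometry.reflection (line[ℝ, toPlane p, toPlane (p + s * e)]) (toPlane z)
      = toPlane (p + e ^ 2 * conj (z - p)) := by
  set t : ℝ := (conj e * (z - p)).re with ht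
  set y : ℂ := p + t * e with hy
  have hmem : toPlane y ∈ line[ℝ, toPlane p, toPlane (p + s * e)] := by
    have : toPlane y = AffineMap.lineMap (toPlane p) (toPlane (p + s * e)) (t / s) := by
      rw [AffineMap.lineMap_apply, vsub_eq_sub, vadd_eq_add, ← map_sub, ← map_smul, ← map_add, hy]
      congr 1
      rw [Complex.real_smul]
      have : (s : ℂ) ≠ 0 := by exact_mod_cast hs
      push_cast
      field_simp
      ring
    rw [this]
    exact AffineMap.lineMap_mem_affineSpan_pair _ _ _
  have horth : toPlane (z - y) ∈ (line[ℝ, toPlane p, toPlane (p + s * e)]).directionᗮ := by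
    rw [direction_affineSpan, vectorSpan_pair_rev,
      Submodule.mem_orthogonal_singleton_iff_inner_right,
      vsub_eq_sub, ← map_sub, inner_toPlane]
    have : conj (p + s * e - p) * (z - y) = s * (conj e * (z - p) - t) := by
      rw [hy, add_sub_cancel_left, map_mul, Complex.conj_ofReal]
      linear_combination (-(s : ℂ) * t) * conj_mul_of_norm_eq_one he
    rw [this, Complex.re_ofReal_mul, Complex.sub_re, ← ht, Complex.ofReal_re, sub_self, mul_zero]
  have := EuclideanGeometry.reflection_orthogonal_vadd hmem horth
  rw [vadd_eq_add, ← map_add, sub_add_cancel, vadd_eq_add, ← map_neg, ← map_add] at this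
  rw [this]
  congr 1
  have h2 : (2 * t : ℂ) = conj e * (z - p) + e * conj (z - p) := by
    have := Complex.add_conj (conj e * (z - p))
    rw [← ht, map_mul, Complex.conj_conj] at this
    rw [← Complex.ofReal_ofNat, ← Complex.ofReal_mul, this]
  rw [hy]
  linear_combination e * h2 + (z - p) * mul_conj_of_norm_eq_one he

lemma isAxiallySymmetric_iff (S : Set Plane) :
    IsAxiallySymmetric S ↔ IsLineSymmetric (coords S) := by
  constructor
  · rintro ⟨p, q, hpq, h⟩
    obtain ⟨p, rfl⟩ := toPlane.surjective p
    obtain ⟨q, rfl⟩ := toPlane.surjective q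
    have hne : q - p ≠ 0 := sub_ne_zero.2 fun h => hpq (by rw [h])
    have hn : (‖q - p‖ : ℂ) ≠ 0 := by simpa using hne
    have hq : q = p + ‖q - p‖ * ((q - p) / ‖q - p‖) := by field_simp; ring
    rw [hq] at h
    have he : ‖(q - p) / ‖q - p‖‖ = 1 := by simp [hne]
    exact ⟨p, _, he, (image_eq_iff _ S (reflection_line he (norm_ne_zero_iff.2 hne))).1 h⟩
  · rintro ⟨p, e, he, h⟩
    refine ⟨toPlane p, toPlane (p + (1 : ℝ) * e), fun h => ?_,
      (image_eq_iff _ S (reflection_line he one_ne_zero)).2 h⟩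
    have := toPlane.injective h
    simp [ne_zero_of_norm_eq_one he] at this

/-! ### Circles, strips and half-planes in complex coordinates -/

lemma isCircle_iff (S : Set Plane) :
    IsCircle S ↔ ∃ a b R, ‖a‖ = 1 ∧ 0 < R ∧ coords S = placed a b (centredDisc R) := by
  constructor
  · rintro ⟨c, r, hr, rfl⟩
    obtain ⟨c, rfl⟩ := toPlane.surjective c
    refine ⟨1, -c, r, by simp, hr, ?_⟩
    ext z
    rw [placed_centredDisc (by simp) hr, mem_coords, mem_closedBall_iff_norm, ← map_sub,
      toPlane.norm_map]
    simp
  · rintro ⟨a, b, R, ha, hR, h⟩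
    refine ⟨toPlane (-(conj a * b)), R, hR, coords_injective ?_⟩
    ext z
    rw [h, placed_centredDisc ha hR, mem_coords, mem_closedBall_iff_norm, ← map_sub,
      toPlane.norm_map]

/-- The motion that turns a linear functional into a multiple of the imaginary part. -/
lemma exists_im_eq {v : ℂ} (hv : v ≠ 0) (s : ℝ) : ∃ a b : ℂ, ‖a‖ = 1 ∧
    ∀ z, ‖v‖ * (a * z + b).im = (conj v * z).re - s := by
  have hn : ‖v‖ ≠ 0 := norm_ne_zero_iff.2 hv
  refine ⟨Complex.I * conj v / ‖v‖, ((-s / ‖v‖ : ℝ) : ℂ) * Complex.I, by simp [hv], fun z => ?_⟩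
  rw [Complex.add_im, Complex.im_ofReal_mul, Complex.I_im, mul_one, div_mul_eq_mul_div,
    Complex.div_ofReal_im, mul_assoc, Complex.I_mul_im]
  field_simp
  ring

lemma im_eq_inner (a b z : ℂ) : (a * z + b).im
    = inner ℝ (toPlane (Complex.I * conj a)) (toPlane z) + b.im := by
  rw [inner_toPlane]
  simp [Complex.mul_im, Complex.mul_re]

lemma toPlane_normal_ne_zero {a : ℂ} (ha : ‖a‖ = 1) : toPlane (Complex.I * conj a) ≠ 0 := by
  simp [ne_zero_of_norm_eq_one ha]

lemma isStrip_iff (S : Set Plane) :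
    IsStrip S ↔ ∃ a b w, ‖a‖ = 1 ∧ 0 < w ∧ coords S = placed a b (horizontalStrip w) := by
  constructor
  · rintro ⟨v, s, t, hv, hst, rfl⟩
    obtain ⟨v, rfl⟩ := toPlane.surjective v
    have hv' : v ≠ 0 := fun h => hv (by simp [h])
    have hn : 0 < ‖v‖ := norm_pos_iff.2 hv'
    obtain ⟨a, b, ha, h⟩ := exists_im_eq hv' s
    refine ⟨a, b, (t - s) / ‖v‖, ha, div_pos (sub_pos.2 hst) hn, ?_⟩
    ext z
    rw [mem_coords, mem_placed, mem_horizontalStrip, le_div_iff₀ hn, mul_comm _ ‖v‖, h,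
      ← mul_nonneg_iff_of_pos_left hn, h, mem_ofPred_eq, inner_toPlane]
    constructor <;> rintro ⟨_, _⟩ <;> constructor <;> linarith
  · rintro ⟨a, b, w, ha, hw, h⟩
    refine ⟨toPlane (Complex.I * conj a), -b.im, w - b.im, toPlane_normal_ne_zero ha, by linarith,
      coords_injective ?_⟩
    ext z
    rw [h, mem_placed, mem_horizontalStrip, im_eq_inner, mem_coords, mem_ofPred_eq]
    constructor <;> rintro ⟨_, _⟩ <;> constructor <;> linarith

lemma isHalfPlane_iff (S : Set Plane) :
    IsHalfPlane S ↔ ∃ a b, ‖a‖ = 1 ∧ coords S = placed a b upperHalf := by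
  constructor
  · rintro ⟨v, s, hv, rfl⟩
    obtain ⟨v, rfl⟩ := toPlane.surjective v
    have hv' : -v ≠ 0 := fun h => hv (by simp [neg_eq_zero.1 h])
    have hn : 0 < ‖-v‖ := norm_pos_iff.2 hv'
    obtain ⟨a, b, ha, h⟩ := exists_im_eq hv' (-s)
    refine ⟨a, b, ha, ?_⟩
    ext z
    rw [mem_coords, mem_placed, mem_upperHalf, ← mul_nonneg_iff_of_pos_left hn, h, mem_ofPred_eq,
      inner_toPlane, map_neg, neg_mul, Complex.neg_re]
    constructor <;> intro _ <;> linarith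
  · rintro ⟨a, b, ha, h⟩
    refine ⟨-toPlane (Complex.I * conj a), b.im, neg_ne_zero.2 (toPlane_normal_ne_zero ha),
      coords_injective ?_⟩
    ext z
    rw [h, mem_placed, mem_upperHalf, im_eq_inner, mem_coords, mem_ofPred_eq, inner_neg_left]
    constructor <;> intro _ <;> linarith

lemma congruentSets_of_placed {K L : Set Plane} {M : Set ℂ} {a b a' b' : ℂ} (ha : ‖a‖ = 1)
    (ha' : ‖a'‖ = 1) (hK : coords K = placed a b M) (hL : coords L = placed a' b' M) :
    CongruentSets K L := by
  obtain ⟨φ, -, hφ⟩ := exists_motion (a := conj a' * a) (by simp [ha, ha']) (conj a' * (b - b'))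
  refine ⟨φ, ?_⟩
  ext x
  obtain ⟨y, rfl⟩ := φ.surjective x
  obtain ⟨z, rfl⟩ := toPlane.surjective y
  rw [φ.injective.mem_set_image, hφ, ← mem_coords, ← mem_coords, hK, hL, mem_placed, mem_placed]
  have e : a' * (conj a' * a * z + conj a' * (b - b')) + b' = a * z + b := by
    linear_combination (a * z + b - b') * mul_conj_of_norm_eq_one ha'
  rw [e]

/-- A congruent copy of a set with an axis of symmetry is a copy by a motion. -/
lemma _root_.CongruentSets.exists_placed {K L : Set Plane} (h : CongruentSets K L) {M : Set ℂ}
    (hM : ∀ z, -conj z ∈ M ↔ z ∈ M) {a b : ℂ} (ha : ‖a‖ = 1) (hK : coords K = placed a b M) :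
    ∃ a' b', ‖a'‖ = 1 ∧ coords L = placed a' b' M := by
  obtain ⟨φ, rfl⟩ := h
  obtain ⟨c, d, hc, h | h⟩ := exists_formula φ
  · exact ⟨a * conj c, _, by simp [ha, hc], by rw [coords_image hc h.2, hK, placed_placed]⟩
  · refine ⟨-conj (a * c), conj (a * c) * d - conj b, by simp [ha, hc], ?_⟩
    ext z
    have e : toPlane z = φ (toPlane (c * conj (z - d))) := by
      rw [h.2, map_mul, Complex.conj_conj, mul_conj_mul_sub_add hc]
    rw [mem_coords, e, φ.injective.mem_set_image, ← mem_coords, hK, mem_placed, mem_placed, ← hM]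
    simp only [map_add, map_mul, map_sub, Complex.conj_conj]
    ring_nf

/-! ### The equivalences in complex coordinates -/

lemma allPlacements_placed_iff {P : Set ℂ → Prop} {K L : Set ℂ} {a b a' b' : ℂ} (ha : ‖a‖ = 1)
    (ha' : ‖a'‖ = 1) :
    AllPlacements P (placed a b K) (placed a' b' L) ↔ AllPlacements P K L := by
  refine ⟨fun H => ?_, fun H => H.placed ha ha'⟩
  have hinv : ∀ {a : ℂ}, ‖a‖ = 1 → ∀ (b : ℂ) (K : Set ℂ),
      placed (conj a) (-(conj a * b)) (placed a b K) = K := fun {a} h b K => by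
    rw [placed_placed, mul_conj_of_norm_eq_one h, mul_neg, ← mul_assoc,
      mul_conj_of_norm_eq_one h, one_mul, neg_add_cancel, placed_one_zero]
  have := H.placed (a := conj a) (b := -(conj a * b)) (a' := conj a') (b' := -(conj a' * b'))
    (by rwa [RCLike.norm_conj]) (by rwa [RCLike.norm_conj])
  rwa [hinv ha, hinv ha'] at this

section Pairs

variable {K L : Set Plane}

lemma _root_.IsCircle.lineSymmetric_circle (hK : IsCircle K) (hL : IsCircle L) :
    AllPlacements IsLineSymmetric (coords K) (coords L) := by
  obtain ⟨a, b, R, ha, hR, h⟩ := (isCircle_iff K).1 hK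
  obtain ⟨a', b', R', ha', hR', h'⟩ := (isCircle_iff L).1 hL
  rw [h, h', allPlacements_placed_iff ha ha']
  exact disc_disc_isLineSymmetric hR hR'

lemma _root_.IsCircle.lineSymmetric_strip_or_half (hK : IsCircle K)
    (hL : IsStrip L ∨ IsHalfPlane L) :
    AllPlacements IsLineSymmetric (coords K) (coords L) := by
  obtain ⟨a, b, R, ha, hR, h⟩ := (isCircle_iff K).1 hK
  rcases hL with hL | hL
  · obtain ⟨a', b', w, ha', hw, h'⟩ := (isStrip_iff L).1 hL
    rw [h, h', allPlacements_placed_iff ha ha']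
    exact disc_isLineSymmetric hR (Icc 0 w)
  · obtain ⟨a', b', ha', h'⟩ := (isHalfPlane_iff L).1 hL
    rw [h, h', allPlacements_placed_iff ha ha']
    exact disc_isLineSymmetric hR (Ici 0)

lemma _root_.IsHalfPlane.lineSymmetric (hK : IsHalfPlane K) (hL : IsHalfPlane L) :
    AllPlacements IsLineSymmetric (coords K) (coords L) := by
  obtain ⟨a, b, ha, h⟩ := (isHalfPlane_iff K).1 hK
  obtain ⟨a', b', ha', h'⟩ := (isHalfPlane_iff L).1 hL
  rw [h, h', allPlacements_placed_iff ha ha']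
  exact isLineSymmetric_of_im (Ici 0)

lemma _root_.IsStrip.pointSymmetric (hK : IsStrip K) (hL : IsStrip L) :
    AllPlacements IsPointSymmetric (coords K) (coords L) := by
  obtain ⟨a, b, w, ha, hw, h⟩ := (isStrip_iff K).1 hK
  obtain ⟨a', b', w', ha', hw', h'⟩ := (isStrip_iff L).1 hL
  rw [h, h', allPlacements_placed_iff ha ha']
  exact strip_strip_isPointSymmetric w w'

lemma _root_.IsStrip.lineSymmetric_iff (hK : IsStrip K) (hL : IsStrip L) :
    AllPlacements IsLineSymmetric (coords K) (coords L) ↔ CongruentSets K L := by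
  obtain ⟨a, b, w, ha, hw, h⟩ := (isStrip_iff K).1 hK
  constructor
  · obtain ⟨a', b', w', ha', hw', h'⟩ := (isStrip_iff L).1 hL
    rw [h, h', allPlacements_placed_iff ha ha']
    intro H
    obtain rfl := eq_width hw hw' H
    exact congruentSets_of_placed ha ha' h h'
  · intro hc
    obtain ⟨a', b', ha', h'⟩ := hc.exists_placed (fun z => by simp [mem_horizontalStrip]) ha h
    rw [h, h', allPlacements_placed_iff ha ha']
    exact isLineSymmetric_of_im (Icc 0 w)

lemma _root_.IsCircle.pointSymmetric_iff (hK : IsCircle K) (hL : IsCircle L) :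
    AllPlacements IsPointSymmetric (coords K) (coords L) ↔ CongruentSets K L := by
  obtain ⟨a, b, R, ha, hR, h⟩ := (isCircle_iff K).1 hK
  constructor
  · obtain ⟨a', b', R', ha', hR', h'⟩ := (isCircle_iff L).1 hL
    rw [h, h', allPlacements_placed_iff ha ha']
    intro H
    obtain rfl := eq_radius hR hR' H
    exact congruentSets_of_placed ha ha' h h'
  · intro hc
    obtain ⟨a', b', ha', h'⟩ := hc.exists_placed (fun z => by simp [mem_centredDisc]) ha h
    rw [h, h', allPlacements_placed_iff ha ha']
    exact disc_disc_isPointSymmetric hR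

lemma _root_.IsStrip.not_isometricSymmetry_half (hK : IsStrip K) (hL : IsHalfPlane L) :
    ¬ AllPlacements HasIsometricSymmetry (coords K) (coords L) := by
  obtain ⟨a, b, w, ha, hw, h⟩ := (isStrip_iff K).1 hK
  obtain ⟨a', b', ha', h'⟩ := (isHalfPlane_iff L).1 hL
  rw [h, h', allPlacements_placed_iff ha ha']
  exact not_strip_half hw

lemma _root_.IsCircle.not_pointSymmetric_strip_or_half (hK : IsCircle K)
    (hL : IsStrip L ∨ IsHalfPlane L) :
    ¬ AllPlacements IsPointSymmetric (coords K) (coords L) := by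
  obtain ⟨a, b, R, ha, hR, h⟩ := (isCircle_iff K).1 hK
  rcases hL with hL | hL
  · obtain ⟨a', b', w, ha', hw, h'⟩ := (isStrip_iff L).1 hL
    rw [h, h', allPlacements_placed_iff ha ha']
    exact not_disc_strip hR hw
  · obtain ⟨a', b', ha', h'⟩ := (isHalfPlane_iff L).1 hL
    rw [h, h', allPlacements_placed_iff ha ha']
    exact not_disc_half hR

lemma _root_.IsHalfPlane.not_pointSymmetric (hK : IsHalfPlane K) (hL : IsHalfPlane L) :
    ¬ AllPlacements IsPointSymmetric (coords K) (coords L) := by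
  obtain ⟨a, b, ha, h⟩ := (isHalfPlane_iff K).1 hK
  obtain ⟨a', b', ha', h'⟩ := (isHalfPlane_iff L).1 hL
  rw [h, h', allPlacements_placed_iff ha ha']
  exact not_half_half

lemma isCircle_or_isStrip_or_isHalfPlane
    (H : AllPlacements HasIsometricSymmetry (coords K) (coords L))
    (hK : IsProperConvex (coords K)) (hL : IsProperConvex (coords L)) :
    IsCircle K ∨ IsStrip K ∨ IsHalfPlane K := by
  rw [isCircle_iff, isStrip_iff, isHalfPlane_iff]
  exact eq_disc_or_strip_or_half H hK hL

lemma isometricSymmetry_iff (hK : IsProperConvex (coords K)) (hL : IsProperConvex (coords L)) :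
    AllPlacements HasIsometricSymmetry (coords K) (coords L) ↔
      (IsCircle K ∧ IsCircle L) ∨
      (IsCircle K ∧ (IsStrip L ∨ IsHalfPlane L)) ∨
      ((IsStrip K ∨ IsHalfPlane K) ∧ IsCircle L) ∨
      (IsStrip K ∧ IsStrip L) ∨
      (IsHalfPlane K ∧ IsHalfPlane L) := by
  constructor
  · intro H
    have h1 := isCircle_or_isStrip_or_isHalfPlane H hK hL
    have h2 := isCircle_or_isStrip_or_isHalfPlane H.symm hL hK
    have h3 : ¬ (IsStrip K ∧ IsHalfPlane L) := fun h => h.1.not_isometricSymmetry_half h.2 H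
    have h4 : ¬ (IsStrip L ∧ IsHalfPlane K) := fun h => h.1.not_isometricSymmetry_half h.2 H.symm
    tauto
  · have hl := fun S => IsLineSymmetric.hasIsometricSymmetry (S := S)
    have hp := fun S => IsPointSymmetric.hasIsometricSymmetry (S := S)
    rintro (⟨h, h'⟩ | ⟨h, h'⟩ | ⟨h, h'⟩ | ⟨h, h'⟩ | ⟨h, h'⟩)
    · exact (h.lineSymmetric_circle h').mono hl
    · exact (h.lineSymmetric_strip_or_half h').mono hl
    · exact (h'.lineSymmetric_strip_or_half h).symm.mono hl
    · exact (h.pointSymmetric h').mono hp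
    · exact (h.lineSymmetric h').mono hl

lemma pointSymmetric_iff (hK : IsProperConvex (coords K)) (hL : IsProperConvex (coords L)) :
    AllPlacements IsPointSymmetric (coords K) (coords L) ↔
      (IsCircle K ∧ IsCircle L ∧ CongruentSets K L) ∨ (IsStrip K ∧ IsStrip L) := by
  constructor
  · intro H
    rcases (isometricSymmetry_iff hK hL).1 (H.mono fun S => IsPointSymmetric.hasIsometricSymmetry)
      with ⟨h, h'⟩ | ⟨h, h'⟩ | ⟨h, h'⟩ | ⟨h, h'⟩ | ⟨h, h'⟩
    · exact Or.inl ⟨h, h', (h.pointSymmetric_iff h').1 H⟩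
    · exact absurd H (h.not_pointSymmetric_strip_or_half h')
    · exact absurd H.symm (h'.not_pointSymmetric_strip_or_half h)
    · exact Or.inr ⟨h, h'⟩
    · exact absurd H (h.not_pointSymmetric h')
  · rintro (⟨h, h', hc⟩ | ⟨h, h'⟩)
    · exact (h.pointSymmetric_iff h').2 hc
    · exact h.pointSymmetric h'

lemma lineSymmetric_iff (hK : IsProperConvex (coords K)) (hL : IsProperConvex (coords L)) :
    AllPlacements IsLineSymmetric (coords K) (coords L) ↔
      (IsCircle K ∧ IsCircle L) ∨
      (IsCircle K ∧ (IsStrip L ∨ IsHalfPlane L)) ∨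
      ((IsStrip K ∨ IsHalfPlane K) ∧ IsCircle L) ∨
      (IsStrip K ∧ IsStrip L ∧ CongruentSets K L) ∨
      (IsHalfPlane K ∧ IsHalfPlane L) := by
  constructor
  · intro H
    have h := (isometricSymmetry_iff hK hL).1
      (H.mono fun S => IsLineSymmetric.hasIsometricSymmetry)
    have hs : IsStrip K ∧ IsStrip L → CongruentSets K L := fun h => (h.1.lineSymmetric_iff h.2).1 H
    tauto
  · rintro (⟨h, h'⟩ | ⟨h, h'⟩ | ⟨h, h'⟩ | ⟨h, h', hc⟩ | ⟨h, h'⟩)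
    · exact h.lineSymmetric_circle h'
    · exact h.lineSymmetric_strip_or_half h'
    · exact (h'.lineSymmetric_strip_or_half h).symm
    · exact (h.lineSymmetric_iff h').2 hc
    · exact h.lineSymmetric h'

end Pairs

end PlanarConvex

theorem theorem4 (K L : Set Plane)
    (hKclosed : IsClosed K) (hKconvex : Convex ℝ K)
    (hKint : (interior K).Nonempty) (hKproper : K ≠ Set.univ)
    (hLclosed : IsClosed L) (hLconvex : Convex ℝ L)
    (hLint : (interior L).Nonempty) (hLproper : L ≠ Set.univ) :
    (AllIntersectionsSatisfy HasNontrivialSymmetry K L ↔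
      (IsCircle K ∧ IsCircle L) ∨
      (IsCircle K ∧ (IsStrip L ∨ IsHalfPlane L)) ∨
      ((IsStrip K ∨ IsHalfPlane K) ∧ IsCircle L) ∨
      (IsStrip K ∧ IsStrip L) ∨
      (IsHalfPlane K ∧ IsHalfPlane L)) ∧
    (AllIntersectionsSatisfy IsCentrallySymmetric K L ↔
      (IsCircle K ∧ IsCircle L ∧ CongruentSets K L) ∨
      (IsStrip K ∧ IsStrip L)) ∧
    (AllIntersectionsSatisfy IsAxiallySymmetric K L ↔
      (IsCircle K ∧ IsCircle L) ∨
      (IsCircle K ∧ (IsStrip L ∨ IsHalfPlane L)) ∨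
      ((IsStrip K ∨ IsHalfPlane K) ∧ IsCircle L) ∨
      (IsStrip K ∧ IsStrip L ∧ CongruentSets K L) ∨
      (IsHalfPlane K ∧ IsHalfPlane L)) := by
  have hK := PlanarConvex.isProperConvex_coords hKclosed hKconvex hKint hKproper
  have hL := PlanarConvex.isProperConvex_coords hLclosed hLconvex hLint hLproper
  rw [PlanarConvex.allIntersectionsSatisfy_iff PlanarConvex.hasNontrivialSymmetry_iff,
    PlanarConvex.allIntersectionsSatisfy_iff PlanarConvex.isCentrallySymmetric_iff,
    PlanarConvex.allIntersectionsSatisfy_iff PlanarConvex.isAxiallySymmetric_iff]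
  exact ⟨PlanarConvex.isometricSymmetry_iff hK hL, PlanarConvex.pointSymmetric_iff hK hL,
    PlanarConvex.lineSymmetric_iff hK hL⟩
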